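/- Let $p$ be a prime and let $\psi$ be an additive character of $\mathbb{Q}_p$ that is unramified, i.e. continuous with values in the unit circle, trivial on $\mathbb{Z}_p$ and nontrivial on $p^{-1}\mathbb{Z}_p$. For unitary characters $\chi_1,\chi_2$ of $\mathbb{Q}_p^\times$, let $\chi_1\boxplus\chi_2$ be the principal series representation of $\mathrm{GL}(2,\mathbb{Q}_p)$ obtained from $\chi_1\otimes\chi_2$ by normalized parabolic induction from the upper triangular Borel subgroup. For $\pi=\chi_1\boxplus\chi_2$ let $p^{c(\pi)}$ be its conductor, where $c(\pi)$ is the least $n\ge 0$ such that $\pi$ has a nonzero vector fixed by the group $K_1(p^n)$ of all $\begin{pmatrix} x&y\\ z&w\end{pmatrix}\in \mathrm{GL}(2,\mathbb{Z}_p)$ with $z\equiv 0$, $w\equiv 1$ modulo $p^n$; a newvector is a nonzero vector fixed by $K_1(p^{c(\pi)})$. Let $W_\circ$ be the newvector in the Whittaker model of $\pi$ with respect to $\psi$, normalized by $W_\circ(1)=1$, and let $$h(\pi):=\max_{g\in \mathrm{GL}(2,\mathbb{Q}_p)} |W_\circ(g)|.$$ 1. If $\chi_1$ is unramified and $\chi_2$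 has conductor $p^c$, where $c\ge 1$ or $p\ge 5$, then $W_\circ$ exists and is unique, the maximum is attained, and $$h(\chi_1\boxplus\chi_2)=p^{\frac12\lfloor \frac c2\rfloor}.$$ 2. Consequently $h$ is determined for all twist-minimal principal series: if $\pi=\chi_1\boxplus\chi_2$, with $\chi_1,\chi_2$ unitary, satisfies $c(\eta\otimes\pi)\ge c(\pi)$ for every unitary character $\eta$ of $\mathbb{Q}_p^\times$, and $c(\pi)\ge 1$ or $p\ge 5$, then $W_\circ$ exists and is unique, the maximum is attained, and $$h(\pi)=p^{\frac12\lfloor \frac{c(\pi)}2\rfloor}.$$ -/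

import Mathlib

open scoped MatrixGroups Topology

noncomputable section

namespace LocalWhittaker

variable (p : ℕ) [Fact p.Prime]

/-- The group `GL(2, ℚ_p)`, with its `p`-adic topology. -/
abbrev G : Type := GL (Fin 2) ℚ_[p]

/-- Unitary characters of `ℚ_pˣ`: continuous homomorphisms to the unit circle. -/
abbrev UnitaryChar : Type := ℚ_[p]ˣ →ₜ* Circle

variable {p}

/-! ### Characters -/

/-- A character of `ℚ_pˣ` is unramified if it is trivial on `ℤ_pˣ`. -/
def IsUnramified (χ : UnitaryChar p) : Prop :=
  ∀ u : ℚ_[p]ˣ, ‖(u : ℚ_[p])‖ = 1 → χ u = 1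

/-- The exponent `c(χ)` of the conductor `p ^ c(χ)` of a character `χ` of `ℚ_pˣ`: the least `n`
such that `χ` is trivial on `ℤ_pˣ ∩ (1 + p ^ n ℤ_p)`. -/
def charConductorExponent (χ : UnitaryChar p) : ℕ :=
  sInf {n : ℕ | ∀ u : ℚ_[p]ˣ, ‖(u : ℚ_[p])‖ = 1 →
    ‖(u : ℚ_[p]) - 1‖ ≤ (p : ℝ) ^ (-(n : ℤ)) → χ u = 1}

/-- An additive character of `ℚ_p` is unramified if it is continuous, trivial on `ℤ_p` and
nontrivial on `p⁻¹ ℤ_p`. -/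
def IsUnramifiedAdd (ψ : AddChar ℚ_[p] Circle) : Prop :=
  Continuous ψ ∧ (∀ x : ℚ_[p], ‖x‖ ≤ 1 → ψ x = 1) ∧ ∃ x : ℚ_[p], ‖x‖ ≤ p ∧ ψ x ≠ 1

/-! ### Elements and subgroups of `GL(2, ℚ_p)` -/

/-- The upper triangular matrix `(a b; 0 d)`. -/
def upper (a : ℚ_[p]ˣ) (b : ℚ_[p]) (d : ℚ_[p]ˣ) : G p :=
  Matrix.GeneralLinearGroup.mkOfDetNeZero !![(a : ℚ_[p]), b; 0, (d : ℚ_[p])]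
    (by simp [Matrix.det_fin_two_of])

/-- The unipotent matrix `(1 x; 0 1)`. -/
def unip (x : ℚ_[p]) : G p := upper 1 x 1

variable (p) in
/-- The congruence subgroup `K₁(p ^ n)` of all `(a b; c d)` in `GL(2, ℤ_p)` with
`c ≡ 0` and `d ≡ 1` modulo `p ^ n`; for `n = 0` it is `GL(2, ℤ_p)`. -/
def K1 (n : ℕ) : Set (G p) :=
  {k | (∀ i j, ‖k i j‖ ≤ 1) ∧ ‖(k : Matrix (Fin 2) (Fin 2) ℚ_[p]).det‖ = 1 ∧
    ‖k 1 0‖ ≤ (p : ℝ) ^ (-(n : ℤ)) ∧ ‖k 1 1 - 1‖ ≤ (p : ℝ) ^ (-(n : ℤ))}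

/-! ### Representations: conductor, newvectors, twists, Whittaker models -/

section Rep

variable {V : Type*} [AddCommGroup V] [Module ℂ V]

/-- `v` is fixed by `K₁(p ^ n)`. When `ρ` has central character `ω` and `n ≥ 1` this says that
`(a b; c d)` acts on `v` by `ω(d)` whenever it lies in `GL(2, ℤ_p)` and `p ^ n ∣ c`. -/
def IsK1Fixed (ρ : Representation ℂ (G p) V) (n : ℕ) (v : V) : Prop :=
  ∀ k ∈ K1 p n, ρ k v = v

/-- The exponent `c(ρ)` of the conductor `p ^ c(ρ)` of `ρ`: the least `n` such that `ρ` has a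
nonzero vector fixed by `K₁(p ^ n)`. -/
def conductorExponent (ρ : Representation ℂ (G p) V) : ℕ :=
  sInf {n : ℕ | ∃ v : V, v ≠ 0 ∧ IsK1Fixed ρ n v}

/-- A newvector of `ρ`: a nonzero vector fixed by `K₁(p ^ c(ρ))`. -/
def IsNewvector (ρ : Representation ℂ (G p) V) (v : V) : Prop :=
  v ≠ 0 ∧ IsK1Fixed ρ (conductorExponent ρ) v

/-- The twist `η ⊗ ρ`, in which `g` acts by `η(det g) ρ(g)`. -/
def twist (η : UnitaryChar p) (ρ : Representation ℂ (G p) V) : Representation ℂ (G p) V where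
  toFun g := ((η (Matrix.GeneralLinearGroup.det g) : Circle) : ℂ) • ρ g
  map_one' := by simp
  map_mul' g h := by
    ext v
    simp only [map_mul, Circle.coe_mul, LinearMap.smul_apply, Module.End.mul_apply, map_smul,
      smul_smul]
    rw [mul_comm]

/-- `ρ` is twist-minimal if no twist of `ρ` by a character has smaller conductor. -/
def IsTwistMinimal (ρ : Representation ℂ (G p) V) : Prop :=
  ∀ η : UnitaryChar p, conductorExponent ρ ≤ conductorExponent (twist η ρ)

/-- `Φ` realizes `ρ` in a space of functions `W` on `GL(2, ℚ_p)` with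
`W((1 x; 0 1) g) = ψ(x) W(g)`, on which the group acts by right translation; the range of `Φ` is
then a Whittaker model of `ρ` with respect to `ψ`. -/
structure IsWhittakerEmbedding (ρ : Representation ℂ (G p) V) (ψ : AddChar ℚ_[p] Circle)
    (Φ : V →ₗ[ℂ] (G p → ℂ)) : Prop where
  injective : Function.Injective Φ
  equivariant : ∀ (g h : G p) (v : V), Φ (ρ g v) h = Φ v (h * g)
  whittaker : ∀ (x : ℚ_[p]) (g : G p) (v : V), Φ v (unip x * g) = (ψ x : ℂ) * Φ v g

/-- `W` is a newvector in a Whittaker model of `ρ`, normalized by `W(1) = 1`. -/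
def IsNormalizedNewvector (ρ : Representation ℂ (G p) V) (ψ : AddChar ℚ_[p] Circle)
    (W : G p → ℂ) : Prop :=
  (∃ Φ : V →ₗ[ℂ] (G p → ℂ), IsWhittakerEmbedding ρ ψ Φ ∧ ∃ v : V, IsNewvector ρ v ∧ Φ v = W) ∧
    W 1 = 1

/-- The set of all absolute values `|W(g)|`, for `W` a normalized Whittaker newvector. -/
def newvectorValues (ρ : Representation ℂ (G p) V) (ψ : AddChar ℚ_[p] Circle) : Set ℝ :=
  {r | ∃ W : G p → ℂ, IsNormalizedNewvector ρ ψ W ∧ ∃ g : G p, ‖W g‖ = r}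

/-- The local invariant `h(ρ)`, the maximum of `|W(g)|` over all `g`, where `W` is the normalized
newvector in the Whittaker model of `ρ`. -/
def localInvariant (ρ : Representation ℂ (G p) V) (ψ : AddChar ℚ_[p] Circle) : ℝ :=
  sSup (newvectorValues ρ ψ)

/-- The invariant `h(ρ)` is well defined: there is exactly one normalized newvector in the
Whittaker model, and its absolute value attains its maximum `h(ρ)`. -/
def LocalInvariantWellDefined (ρ : Representation ℂ (G p) V) (ψ : AddChar ℚ_[p] Circle) : Prop :=
  (∃! W : G p → ℂ, IsNormalizedNewvector ρ ψ W) ∧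
    IsGreatest (newvectorValues ρ ψ) (localInvariant ρ ψ)

end Rep

/-! ### Principal series -/

/-- The space of the principal series `χ₁ ⊞ χ₂` (normalized induction from the upper triangular
Borel subgroup): functions `f` on `GL(2, ℚ_p)` which are right invariant under a neighbourhood of
the identity and satisfy `f((a b; 0 d) g) = χ₁(a) χ₂(d) |a / d| ^ (1 / 2) f(g)`. -/
def principalSeriesSpace (χ₁ χ₂ : UnitaryChar p) : Submodule ℂ (G p → ℂ) where
  carrier := {f | (∃ U ∈ 𝓝 (1 : G p), ∀ k ∈ U, ∀ g, f (g * k) = f g) ∧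
    ∀ (a d : ℚ_[p]ˣ) (b : ℚ_[p]) (g : G p), f (upper a b d * g) =
      (χ₁ a : ℂ) * (χ₂ d : ℂ) * (Real.sqrt ‖(a : ℚ_[p]) / (d : ℚ_[p])‖ : ℂ) * f g}
  zero_mem' := ⟨⟨Set.univ, Filter.univ_mem, by simp⟩, by simp⟩
  add_mem' := by
    rintro f f' ⟨⟨U, hU, h⟩, hf⟩ ⟨⟨U', hU', h'⟩, hf'⟩
    refine ⟨⟨U ∩ U', Filter.inter_mem hU hU', fun k hk g => ?_⟩, fun a d b g => ?_⟩
    · simp [h k hk.1 g, h' k hk.2 g]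
    · simp only [Pi.add_apply, hf, hf']
      ring
  smul_mem' := by
    rintro z f ⟨⟨U, hU, h⟩, hf⟩
    refine ⟨⟨U, hU, fun k hk g => ?_⟩, fun a d b g => ?_⟩
    · simp [h k hk g]
    · simp only [Pi.smul_apply, hf, smul_eq_mul]
      ring

/-- The principal series representation `χ₁ ⊞ χ₂`: the group acts by right translation. -/
def principalSeries (χ₁ χ₂ : UnitaryChar p) :
    Representation ℂ (G p) (principalSeriesSpace χ₁ χ₂) where
  toFun g :=
    { toFun := fun f => ⟨fun x => f.1 (x * g), by
        obtain ⟨f, ⟨U, hU, h⟩, hf⟩ := f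
        refine ⟨⟨{k | g⁻¹ * k * g ∈ U}, ?_, fun k hk x => ?_⟩, fun a d b x => ?_⟩
        · have hc : Continuous fun k : G p => g⁻¹ * k * g := by fun_prop
          exact hc.continuousAt.preimage_mem_nhds (by simpa using hU)
        · have := h _ hk (x * g)
          simpa [mul_assoc] using this
        · simp only [mul_assoc (upper a b d), hf]⟩
      map_add' := fun _ _ => rfl
      map_smul' := fun _ _ => rfl }
  map_one' := by
    ext f x
    simp
  map_mul' g h := by
    ext f x
    simp [mul_assoc]

end LocalWhittaker

end

open MeasureTheory Filter Metric

namespace LocalWhittaker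

variable {p : ℕ} [Fact p.Prime]

/-! ### Haar measure on `ℚ_p` -/

/-! Throughout, `χ = χ₂ χ₁⁻¹` and `c` is its conductor exponent. Restricting a vector `f` to the big
cell, `x ↦ f(w n(x))`, turns the principal series into functions on `ℚ_p`, and the Whittaker
functional becomes the Fourier coefficient `∫ f(w n(x)) ψ(-x) dx`, taken over balls that grow until
the value stabilises. It is unique up to a scalar (`exists_eq_mul_whittakerFunctional`) and its
translates separate vectors (`eq_zero_of_whittaker_eq_zero`). So `W_∘` is determined as soon as the
newvector is unique up to a scalar.

Newvectors come from the double cosets of the Borel subgroup and `K₁(p ^ n)`, represented by `w`, by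
`1` and by `lower z` with `‖z‖ = p ^ (-j)`. A fixed vector can be nonzero on the coset of such a
`lower z`, `j ≤ n`, only if `c(χ₁) ≤ n - j` and `c(χ₂) ≤ j`. Hence the conductor exponent is `c(χ₁)
+ c(χ₂)`. Twisting by `χ₁⁻¹` then shows that a twist-minimal principal series has an unramified
character, and the second claim reduces to an unramified `χ₁` or an unramified `χ₂`.

If exactly one character is ramified, the newvector is the function `bigCellVec` supported on `w
n(ℤ_p)` modulo the Borel subgroup, or its Atkin-Lehner translate. A right translation does not
change the set of values of `|W|`, so both cases concern the same function, and its value used for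
the normalization has absolute value 1. On the coset of `w` the Whittaker integral is a Gauss sum
and `|W| ≤ 1` (`norm_sq_whittaker_weyl`). At `diag(y, 1) lower z` with `‖z‖ < 1` one finds `|W|² =
‖y‖ |F|²`, where `F = ∫_{ℤ_p} χ(1 + t z) ψ(-y t) dt`. For `‖z‖ = p ^ (-j)` with `1 ≤ j < c`, an
autocorrelation gives `‖y‖ |F|² ≤ p ^ j` (`norm_sq_unitIntegral_le`), while `F` vanishes for `‖y‖ >
p ^ (c - j)` (`unitIntegral_eq_zero`). Thus `|W|² ≤ min(p ^ j, p ^ (c - j)) ≤ p ^ ⌊c/2⌋`. The bound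
is attained at `j = c - ⌊c/2⌋`: there `t ↦ χ(1 + t z)` is additive, hence equal to `ψ(y t)` for some
`y` of norm `p ^ ⌊c/2⌋`, and `F = 1` (`exists_charExt_eq_addChar`).

If both characters are unramified, the spherical Whittaker function at `‖y‖ = p ^ (-r)` is `p ^
(-r/2)` times a sum of `r + 1` terms, each of absolute value `|W(1)|`. The maximum is therefore at 1
once `(r + 1)² ≤ p ^ r` for all `r`, which holds for `p ≥ 5`. -/

theorem prime_cast_pos : (0 : ℝ) < p := by exact_mod_cast (Fact.out : p.Prime).pos

theorem one_lt_prime_cast : (1 : ℝ) < p := by exact_mod_cast (Fact.out : p.Prime).one_lt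

theorem prime_padic_ne_zero : (p : ℚ_[p]) ≠ 0 := by
  exact_mod_cast (Fact.out : p.Prime).ne_zero

theorem exists_norm_eq_zpow {x : ℚ_[p]} (hx : x ≠ 0) : ∃ k : ℤ, ‖x‖ = (p : ℝ) ^ k :=
  ⟨_, Padic.norm_eq_zpow_neg_valuation hx⟩

theorem zpow_prime_le_iff {m n : ℤ} : (p : ℝ) ^ m ≤ (p : ℝ) ^ n ↔ m ≤ n :=
  zpow_le_zpow_iff_right₀ one_lt_prime_cast

theorem zpow_prime_lt_iff {m n : ℤ} : (p : ℝ) ^ m < (p : ℝ) ^ n ↔ m < n :=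
  zpow_lt_zpow_iff_right₀ one_lt_prime_cast

theorem zpow_prime_pos (n : ℤ) : (0 : ℝ) < (p : ℝ) ^ n := zpow_pos prime_cast_pos n

theorem norm_prime_zpow (n : ℤ) : ‖(p : ℚ_[p]) ^ n‖ = (p : ℝ) ^ (-n) := Padic.norm_p_zpow n

/-- A discreteness property of the norm. -/
theorem norm_lt_zpow_iff {x : ℚ_[p]} {k : ℤ} : ‖x‖ < (p : ℝ) ^ k ↔ ‖x‖ ≤ (p : ℝ) ^ (k - 1) := by
  rcases eq_or_ne x 0 with rfl | hx
  · simp [zpow_prime_pos, (zpow_prime_pos (p := p) _).le]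
  · obtain ⟨m, hm⟩ := exists_norm_eq_zpow hx
    rw [hm, zpow_prime_lt_iff, zpow_prime_le_iff]
    omega

theorem norm_add_eq_left {x y : ℚ_[p]} (h : ‖y‖ < ‖x‖) : ‖x + y‖ = ‖x‖ := by
  rw [IsUltrametricDist.norm_add_eq_max_of_norm_ne_norm h.ne', max_eq_left h.le]

theorem norm_add_le_of_le {x y : ℚ_[p]} {r : ℝ} (hx : ‖x‖ ≤ r) (hy : ‖y‖ ≤ r) : ‖x + y‖ ≤ r :=
  (IsUltrametricDist.norm_add_le_max x y).trans (max_le hx hy)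

theorem norm_sub_le_of_le {x y : ℚ_[p]} {r : ℝ} (hx : ‖x‖ ≤ r) (hy : ‖y‖ ≤ r) : ‖x - y‖ ≤ r := by
  rw [sub_eq_add_neg]
  exact norm_add_le_of_le hx (by rwa [norm_neg])

theorem norm_eq_one_of_sub_one_lt {x : ℚ_[p]} (h : ‖x - 1‖ < 1) : ‖x‖ = 1 := by
  have := norm_add_eq_left (x := (1 : ℚ_[p])) (y := x - 1) (by simpa using h)
  simpa using this

/-- The elements of the ball of radius `p ^ (k + N)` have a unique approximation, up to distance
`p ^ k`, among `i * p ^ (-(k + N))`, for natural numbers `i < p ^ N`. -/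
theorem exists_unique_digits (k : ℤ) (N : ℕ) {x : ℚ_[p]} (hx : ‖x‖ ≤ (p : ℝ) ^ (k + N)) :
    ∃! i : ℕ, i < p ^ N ∧ ‖x - i * (p : ℚ_[p]) ^ (-(k + N))‖ ≤ (p : ℝ) ^ k := by
  have hp := prime_padic_ne_zero (p := p)
  have key : ∀ i : ℕ, ‖x - i * (p : ℚ_[p]) ^ (-(k + N))‖ ≤ (p : ℝ) ^ k ↔
      ‖x * (p : ℚ_[p]) ^ (k + N) - i‖ ≤ (p : ℝ) ^ (-(N : ℤ)) := by
    intro i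
    have h1 : x - i * (p : ℚ_[p]) ^ (-(k + N)) =
        (x * (p : ℚ_[p]) ^ (k + N) - i) * (p : ℚ_[p]) ^ (-(k + N)) := by
      rw [sub_mul, mul_assoc, ← zpow_add₀ hp]
      simp
    have h2 : (p : ℝ) ^ k = (p : ℝ) ^ (-(N : ℤ)) * (p : ℝ) ^ (k + N) := by
      rw [← zpow_add₀ prime_cast_pos.ne']
      congr 1
      ring
    rw [h1, norm_mul, norm_prime_zpow, neg_neg, h2, mul_le_mul_iff_left₀ (zpow_prime_pos _)]
  simp only [key]
  have hy : ‖x * (p : ℚ_[p]) ^ (k + N)‖ ≤ 1 := by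
    rw [norm_mul, norm_prime_zpow, zpow_neg]
    exact (div_le_one (zpow_prime_pos _)).2 hx
  obtain ⟨y, hy'⟩ : ∃ y : ℤ_[p], (y : ℚ_[p]) = x * (p : ℚ_[p]) ^ (k + N) := ⟨⟨_, hy⟩, rfl⟩
  rw [← hy']
  have h0 := (PadicInt.norm_le_pow_iff_mem_span_pow _ _).2
    (PadicInt.appr_spec N y)
  rw [PadicInt.norm_def, PadicInt.coe_sub, PadicInt.coe_natCast] at h0
  refine ⟨_, ⟨PadicInt.appr_lt _ N, h0⟩, fun j ⟨hj, hj'⟩ => ?_⟩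
  have h3 := norm_sub_le_of_le h0 hj'
  rw [sub_sub_sub_cancel_left] at h3
  have h4 := (Padic.norm_int_le_pow_iff_dvd (p := p) ((j : ℤ) - (PadicInt.appr y N : ℤ)) N).1
    (by push_cast; exact h3)
  have h6 := PadicInt.appr_lt y N
  have h5 := Int.eq_zero_of_abs_lt_dvd h4 (by
    rw [abs_lt]
    zify at h6 hj
    constructor <;> linarith)
  omega

noncomputable instance : MeasurableSpace ℚ_[p] := borel _

instance : BorelSpace ℚ_[p] := ⟨rfl⟩

variable (p) in
/-- The ring `ℤ_p`, as a compact subset of `ℚ_p` with nonempty interior. -/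
noncomputable def integerCompacts : TopologicalSpace.PositiveCompacts ℚ_[p] where
  carrier := closedBall 0 1
  isCompact' := isCompact_closedBall 0 1
  interior_nonempty' := ⟨0, mem_interior_iff_mem_nhds.2 (closedBall_mem_nhds 0 one_pos)⟩

/-- The Haar measure on `ℚ_p` for which `ℤ_p` has measure `1`. -/
noncomputable instance : MeasureSpace ℚ_[p] := ⟨Measure.addHaarMeasure (integerCompacts p)⟩

instance : Measure.IsAddHaarMeasure (volume : Measure ℚ_[p]) :=
  Measure.isAddHaarMeasure_addHaarMeasure _

theorem volume_closedBall_one : volume (closedBall (0 : ℚ_[p]) 1) = 1 :=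
  Measure.addHaarMeasure_self

/-- The larger ball is the disjoint union of `p ^ N` translates of the smaller one, indexed by the
digits of `exists_unique_digits`. -/
theorem volume_closedBall_zpow_add (k : ℤ) (N : ℕ) :
    volume (closedBall (0 : ℚ_[p]) ((p : ℝ) ^ (k + N))) =
      (p : ENNReal) ^ N * volume (closedBall (0 : ℚ_[p]) ((p : ℝ) ^ k)) := by
  have h1 : closedBall (0 : ℚ_[p]) ((p : ℝ) ^ (k + N)) = ⋃ i ∈ Finset.range (p ^ N),
      closedBall (i * (p : ℚ_[p]) ^ (-(k + N))) ((p : ℝ) ^ k) := by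
    ext x
    simp only [mem_closedBall, Set.mem_iUnion, Finset.mem_range, dist_eq_norm, exists_prop,
      sub_zero]
    constructor
    · intro hx
      obtain ⟨i, ⟨hi, hi'⟩, -⟩ := exists_unique_digits k N hx
      exact ⟨i, hi, hi'⟩
    · rintro ⟨i, -, hi⟩
      have h2 : ‖(i : ℚ_[p]) * (p : ℚ_[p]) ^ (-(k + N))‖ ≤ (p : ℝ) ^ (k + N) := by
        rw [norm_mul, norm_prime_zpow, neg_neg]
        exact mul_le_of_le_one_left (zpow_prime_pos _).le (Padic.norm_int_le_one i)
      simpa using norm_add_le_of_le (hi.trans (zpow_prime_le_iff.2 (by omega))) h2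
  rw [h1, measure_biUnion_finset]
  · simp_rw [Measure.addHaar_closedBall_center]
    simp
  · intro i hi j hj hij
    refine Set.disjoint_left.2 fun x hx hx' => hij ?_
    rw [mem_closedBall, dist_eq_norm] at hx hx'
    have hx0 : x ∈ closedBall (0 : ℚ_[p]) ((p : ℝ) ^ (k + N)) := by
      rw [h1]
      exact Set.mem_biUnion hi (by rwa [mem_closedBall, dist_eq_norm])
    rw [mem_closedBall, dist_zero_right] at hx0
    exact (exists_unique_digits k N hx0).unique ⟨by simpa using hi, hx⟩ ⟨by simpa using hj, hx'⟩
  · exact fun i _ => measurableSet_closedBall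

theorem volume_closedBall_zpow (k : ℤ) :
    volume (closedBall (0 : ℚ_[p]) ((p : ℝ) ^ k)) = ENNReal.ofReal ((p : ℝ) ^ k) := by
  have hp : (p : ENNReal) ≠ 0 := by exact_mod_cast (Fact.out : p.Prime).ne_zero
  rcases le_total 0 k with hk | hk
  · obtain ⟨N, rfl⟩ := Int.eq_ofNat_of_zero_le hk
    have := volume_closedBall_zpow_add (p := p) 0 N
    rw [zpow_zero, volume_closedBall_one, zero_add] at this
    rw [this, zpow_natCast, ENNReal.ofReal_pow prime_cast_pos.le, ENNReal.ofReal_natCast, mul_one]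
  · obtain ⟨N, hN⟩ := Int.eq_ofNat_of_zero_le (neg_nonneg.2 hk)
    obtain rfl : k = -N := by omega
    have := volume_closedBall_zpow_add (p := p) (-N) N
    rw [neg_add_cancel, zpow_zero, volume_closedBall_one] at this
    rw [zpow_neg, zpow_natCast, ENNReal.ofReal_inv_of_pos (pow_pos prime_cast_pos N),
      ENNReal.ofReal_pow prime_cast_pos.le, ENNReal.ofReal_natCast]
    exact (ENNReal.eq_inv_of_mul_eq_one_left (by rw [mul_comm]; simpa using this.symm))

theorem volume_real_closedBall_zpow (k : ℤ) :
    volume.real (closedBall (0 : ℚ_[p]) ((p : ℝ) ^ k)) = (p : ℝ) ^ k := by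
  rw [measureReal_def, volume_closedBall_zpow, ENNReal.toReal_ofReal (zpow_prime_pos k).le]

/-- The image measure is again a Haar measure, so it is a multiple of `volume`; the constant is the
measure of the preimage of `ℤ_p`, a ball of radius `‖a‖⁻¹`. -/
theorem map_mul_left_volume {a : ℚ_[p]} (ha : a ≠ 0) :
    Measure.map (fun x => a * x) (volume : Measure ℚ_[p]) = ENNReal.ofReal ‖a‖⁻¹ • volume := by
  have h1 : (Measure.map (fun x => a * x) (volume : Measure ℚ_[p])).IsAddHaarMeasure :=
    Measure.isAddHaarMeasure_map (volume : Measure ℚ_[p]) (AddMonoidHom.mulLeft a)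
      (continuous_const_mul a) (mul_left_surjective₀ ha)
      (Homeomorph.mulLeft₀ a ha).isClosedEmbedding.tendsto_cocompact
  have h2 := Measure.addHaarMeasure_unique (Measure.map (fun x => a * x) (volume : Measure ℚ_[p]))
    (integerCompacts p)
  rw [h2]
  congr 1
  change Measure.map (fun x => a * x) (volume : Measure ℚ_[p]) (closedBall 0 1) = _
  rw [Measure.map_apply (measurable_const_mul a) measurableSet_closedBall]
  obtain ⟨k, hk⟩ := exists_norm_eq_zpow ha
  have h3 : (fun x => a * x) ⁻¹' closedBall (0 : ℚ_[p]) 1 = closedBall 0 ((p : ℝ) ^ (-k)) := by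
    ext x
    simp only [Set.mem_preimage, mem_closedBall, dist_zero_right, norm_mul, hk, zpow_neg]
    rw [mul_comm, ← le_div_iff₀ (zpow_prime_pos k), one_div]
  rw [h3, volume_closedBall_zpow, hk, zpow_neg]

theorem integral_comp_mul_left {a : ℚ_[p]} (ha : a ≠ 0) (f : ℚ_[p] → ℂ) :
    ∫ x, f (a * x) = (‖a‖ : ℂ)⁻¹ * ∫ x, f x := by
  have h1 := (Homeomorph.mulLeft₀ a ha).measurableEmbedding.integral_map (μ := volume) f
  have h2 : ⇑(Homeomorph.mulLeft₀ a ha) = fun x => a * x := rfl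
  rw [h2, map_mul_left_volume ha, integral_smul_measure] at h1
  rw [← h1, ENNReal.toReal_ofReal (by positivity), Complex.real_smul, Complex.ofReal_inv]

/-! ### Additive characters -/

section AddChar

variable {ψ : AddChar ℚ_[p] Circle}

theorem IsUnramifiedAdd.eq_one (hψ : IsUnramifiedAdd ψ) {x : ℚ_[p]} (hx : ‖x‖ ≤ 1) : ψ x = 1 :=
  hψ.2.1 x hx

theorem IsUnramifiedAdd.eq_one_iff (hψ : IsUnramifiedAdd ψ) {x : ℚ_[p]} : ψ x = 1 ↔ ‖x‖ ≤ 1 := by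
  refine ⟨fun h => ?_, hψ.eq_one⟩
  by_contra! hx
  obtain ⟨y, hy, hy1⟩ := hψ.2.2
  have hx0 : x ≠ 0 := by
    rintro rfl
    simp at hx
    linarith
  obtain ⟨k, hk⟩ := exists_norm_eq_zpow hx0
  have hk0 : 0 < k := by
    rw [hk, ← zpow_zero (p : ℝ), zpow_prime_lt_iff] at hx
    exact hx
  obtain ⟨m, rfl⟩ : ∃ m : ℕ, k = m + 1 := ⟨(k - 1).toNat, by omega⟩
  have h2 : ‖y / x‖ ≤ 1 := by
    rw [norm_div, div_le_one (hk ▸ zpow_prime_pos _), hk]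
    refine hy.trans ?_
    conv_lhs => rw [← zpow_one (p : ℝ)]
    rw [zpow_prime_le_iff]
    omega
  -- Since `‖y / x‖ ≤ 1`, a natural number `i` approximates `y / x` to within `‖x‖⁻¹`. Then `y - i
  -- x` is integral, and `ψ x = 1` would force `ψ y = 1`.
  obtain ⟨i, ⟨-, hi⟩, -⟩ := exists_unique_digits (p := p) (-(m + 1 : ℤ)) (m + 1) (x := y / x)
    (h2.trans_eq (by simp))
  have h3 : ψ (y - i * x) = 1 := by
    apply hψ.eq_one
    have : y - i * x = (y / x - i) * x := by field_simp
    rw [this, norm_mul, hk]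
    have h4 : ‖y / x - i‖ ≤ (p : ℝ) ^ (-(m + 1 : ℤ)) := by simpa using hi
    calc _ ≤ (p : ℝ) ^ (-(m + 1 : ℤ)) * (p : ℝ) ^ (m + 1 : ℤ) := by gcongr
      _ = 1 := by rw [← zpow_add₀ prime_cast_pos.ne']; simp
  apply hy1
  have h5 : y = (y - i * x) + i • x := by rw [nsmul_eq_mul]; ring
  rw [h5, AddChar.map_add_eq_mul, h3, AddChar.map_nsmul_eq_pow, h, one_pow, one_mul]

theorem IsUnramifiedAdd.measurable (hψ : IsUnramifiedAdd ψ) :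
    Measurable fun x => (ψ x : ℂ) :=
  (continuous_subtype_val.comp hψ.1).measurable

end AddChar

/-! ### Integrals over balls -/

theorem integral_closedBall_add (f : ℚ_[p] → ℂ) {r : ℝ} {v : ℚ_[p]} (hv : ‖v‖ ≤ r) :
    ∫ x in closedBall 0 r, f (x + v) = ∫ x in closedBall 0 r, f x := by
  rw [← integral_indicator measurableSet_closedBall, ← integral_indicator measurableSet_closedBall,
    ← integral_add_right_eq_self ((closedBall 0 r).indicator f) v]
  congr 1 with x
  have : x + v ∈ closedBall (0 : ℚ_[p]) r ↔ x ∈ closedBall 0 r := by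
    simp only [mem_closedBall, dist_zero_right]
    exact ⟨fun h => by simpa using norm_sub_le_of_le h hv, fun h => norm_add_le_of_le h hv⟩
  by_cases hx : x ∈ closedBall (0 : ℚ_[p]) r
  · rw [Set.indicator_of_mem hx, Set.indicator_of_mem (this.2 hx)]
  · rw [Set.indicator_of_notMem hx, Set.indicator_of_notMem (fun h => hx (this.1 h))]

theorem integrableOn_closedBall {f : ℚ_[p] → ℂ} (hf : Measurable f) {C : ℝ} (hC : ∀ x, ‖f x‖ ≤ C)
    (x : ℚ_[p]) (r : ℝ) : IntegrableOn f (closedBall x r) :=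
  Measure.integrableOn_of_bounded (isCompact_closedBall x r).measure_lt_top.ne
    hf.aestronglyMeasurable (Eventually.of_forall hC)

/-- Orthogonality: if `v` is too large, translating the ball by an element `a` of maximal norm
multiplies the integral by `ψ(a v) ≠ 1`. -/
theorem integral_addChar {ψ : AddChar ℚ_[p] Circle} (hψ : IsUnramifiedAdd ψ) (v : ℚ_[p]) (k : ℤ) :
    ∫ x in closedBall (0 : ℚ_[p]) ((p : ℝ) ^ k), (ψ (x * v) : ℂ) =
      if ‖v‖ ≤ (p : ℝ) ^ (-k) then (p : ℂ) ^ k else 0 := by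
  split_ifs with hv
  · rw [setIntegral_congr_fun (g := fun _ => (1 : ℂ)) measurableSet_closedBall]
    · rw [setIntegral_const, volume_real_closedBall_zpow]
      simp
    · intro x hx
      rw [mem_closedBall, dist_zero_right] at hx
      have : ‖x * v‖ ≤ 1 := by
        rw [norm_mul]
        calc _ ≤ (p : ℝ) ^ k * (p : ℝ) ^ (-k) := by gcongr
          _ = 1 := by rw [← zpow_add₀ prime_cast_pos.ne']; simp
      simp [hψ.eq_one this]
  · push Not at hv
    have hv0 : v ≠ 0 := by
      rintro rfl
      rw [norm_zero] at hv
      exact (zpow_prime_pos _).not_gt hv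
    set a : ℚ_[p] := (p : ℚ_[p]) ^ (-k) with ha
    have ha' : ‖a‖ = (p : ℝ) ^ k := by rw [ha, norm_prime_zpow, neg_neg]
    have h1 := integral_closedBall_add (fun x => (ψ (x * v) : ℂ)) (v := a) ha'.le
    have h2 : ψ (a * v) ≠ 1 := by
      rw [Ne, hψ.eq_one_iff, norm_mul, ha', not_le]
      calc 1 = (p : ℝ) ^ k * (p : ℝ) ^ (-k) := by rw [← zpow_add₀ prime_cast_pos.ne']; simp
        _ < _ := by gcongr; exact zpow_prime_pos k
    simp_rw [add_mul, AddChar.map_add_eq_mul, Circle.coe_mul] at h1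
    rw [integral_mul_const] at h1
    have h3 : ((ψ (a * v) : ℂ) - 1) ≠ 0 := by
      rw [sub_ne_zero]
      exact fun h => h2 (Circle.ext (by simpa using h))
    rw [← ha'] at *
    apply (mul_eq_zero.1 _).resolve_right h3
    rw [mul_sub, h1, mul_one, sub_self]

end LocalWhittaker

namespace LocalWhittaker

variable {p : ℕ} [Fact p.Prime]

/-! ### Characters of `ℚ_pˣ` and their conductors -/

theorem norm_mul_sub_one_le {x y : ℚ_[p]} {r : ℝ} (hx : ‖x‖ = 1) (hx1 : ‖x - 1‖ ≤ r)
    (hy1 : ‖y - 1‖ ≤ r) : ‖x * y - 1‖ ≤ r := by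
  have : x * y - 1 = x * (y - 1) + (x - 1) := by ring
  rw [this]
  exact norm_add_le_of_le (by rwa [norm_mul, hx, one_mul]) hx1

/-- There are no small subgroups near 1: as long as a power `w` of `z` stays within 1/2 of 1, the
identity `w² - 1 = (w + 1)(w - 1)` with `‖w + 1‖ ≥ 3/2` makes the distance to 1 grow geometrically
under repeated squaring. -/
theorem eq_one_of_norm_pow_sub_one_le {z : ℂ} (h : ∀ k : ℕ, ‖z ^ k - 1‖ ≤ 1 / 2) : z = 1 := by
  by_contra hz
  have key : ∀ k : ℕ, (3 / 2 : ℝ) ^ k * ‖z - 1‖ ≤ ‖z ^ 2 ^ k - 1‖ := by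
    intro k
    induction k with
    | zero => simp
    | succ k ih =>
      have h1 : z ^ 2 ^ (k + 1) - 1 = (2 + (z ^ 2 ^ k - 1)) * (z ^ 2 ^ k - 1) := by
        rw [pow_succ, pow_mul]
        ring
      have h2 : (3 / 2 : ℝ) ≤ ‖2 + (z ^ 2 ^ k - 1)‖ := by
        have := norm_sub_le_norm_add (2 : ℂ) (z ^ 2 ^ k - 1)
        have h3 := h (2 ^ k)
        rw [show ‖(2 : ℂ)‖ = 2 by simp] at this
        linarith
      rw [h1, norm_mul, pow_succ']
      calc 3 / 2 * (3 / 2 : ℝ) ^ k * ‖z - 1‖ = 3 / 2 * ((3 / 2 : ℝ) ^ k * ‖z - 1‖) := by ring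
        _ ≤ _ := by gcongr
  have hpos : 0 < ‖z - 1‖ := norm_pos_iff.2 (sub_ne_zero.2 hz)
  obtain ⟨k, hk⟩ := pow_unbounded_of_one_lt (1 / ‖z - 1‖) (by norm_num : (1 : ℝ) < 3 / 2)
  have h4 := (key k).trans (h (2 ^ k))
  rw [div_lt_iff₀ hpos] at hk
  linarith

/-- Continuity keeps `χ` close to 1 on a small neighbourhood `1 + p ^ n ℤ_p`, whose units are closed
under powers; the circle has no small subgroups. In particular the infimum that defines
`charConductorExponent` is attained. -/
theorem exists_conductor (χ : UnitaryChar p) : ∃ n : ℕ, ∀ u : ℚ_[p]ˣ, ‖(u : ℚ_[p])‖ = 1 →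
    ‖(u : ℚ_[p]) - 1‖ ≤ (p : ℝ) ^ (-(n : ℤ)) → χ u = 1 := by
  have h1 : ∀ᶠ u : ℚ_[p]ˣ in 𝓝 1, ‖(χ u : ℂ) - 1‖ < 1 / 2 := by
    have hc : Continuous fun u : ℚ_[p]ˣ => ‖(χ u : ℂ) - 1‖ :=
      ((continuous_subtype_val.comp (map_continuous χ)).sub continuous_const).norm
    have := hc.tendsto 1
    simp only [map_one, Circle.coe_one, sub_self, norm_zero] at this
    exact this.eventually_lt_const (by norm_num)
  rw [Units.isEmbedding_val₀.nhds_eq_comap, eventually_comap, Units.val_one,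
    Metric.eventually_nhds_iff] at h1
  obtain ⟨ε, hε, h1⟩ := h1
  obtain ⟨n, hn⟩ := exists_pow_lt_of_lt_one hε (inv_lt_one_of_one_lt₀ (one_lt_prime_cast (p := p)))
  refine ⟨n, fun u hu hu1 => Circle.ext (eq_one_of_norm_pow_sub_one_le fun k => ?_)⟩
  have h2 : ‖((u ^ k : ℚ_[p]ˣ) : ℚ_[p]) - 1‖ ≤ (p : ℝ) ^ (-(n : ℤ)) := by
    induction k with
    | zero => simp
    | succ k ih =>
      rw [pow_succ, Units.val_mul]
      exact norm_mul_sub_one_le (by simp [hu]) ih hu1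
  have h3 := h1 (y := ((u ^ k : ℚ_[p]ˣ) : ℚ_[p])) (by
    rw [dist_eq_norm]
    refine h2.trans_lt ?_
    rwa [zpow_neg, zpow_natCast, ← inv_pow]) (u ^ k) rfl
  simpa using h3.le

theorem charConductorExponent_le {χ : UnitaryChar p} {n : ℕ}
    (h : ∀ u : ℚ_[p]ˣ, ‖(u : ℚ_[p])‖ = 1 → ‖(u : ℚ_[p]) - 1‖ ≤ (p : ℝ) ^ (-(n : ℤ)) → χ u = 1) :
    charConductorExponent χ ≤ n :=
  Nat.sInf_le h

theorem apply_eq_one {χ : UnitaryChar p} {n : ℕ} (hn : charConductorExponent χ ≤ n) {u : ℚ_[p]ˣ}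
    (hu : ‖(u : ℚ_[p])‖ = 1) (hu1 : ‖(u : ℚ_[p]) - 1‖ ≤ (p : ℝ) ^ (-(n : ℤ))) : χ u = 1 :=
  Nat.sInf_mem (exists_conductor χ) u hu (hu1.trans (zpow_prime_le_iff.2 (by
    change -(n : ℤ) ≤ -(charConductorExponent χ : ℤ)
    omega)))

theorem exists_apply_ne_one {χ : UnitaryChar p} {n : ℕ} (hn : n < charConductorExponent χ) :
    ∃ u : ℚ_[p]ˣ, ‖(u : ℚ_[p])‖ = 1 ∧ ‖(u : ℚ_[p]) - 1‖ ≤ (p : ℝ) ^ (-(n : ℤ)) ∧ χ u ≠ 1 := by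
  by_contra! h
  exact hn.not_ge (charConductorExponent_le h)

theorem isUnramified_iff {χ : UnitaryChar p} : IsUnramified χ ↔ charConductorExponent χ = 0 := by
  constructor
  · intro h
    exact Nat.le_zero.1 (charConductorExponent_le fun u hu _ => h u hu)
  · intro h u hu
    refine apply_eq_one h.le hu ?_
    simpa using norm_sub_le_of_le hu.le (by simp : ‖(1 : ℚ_[p])‖ ≤ 1)

theorem inv_unitaryChar_apply (χ : UnitaryChar p) (u : ℚ_[p]ˣ) : χ⁻¹ u = (χ u)⁻¹ := rfl

theorem charConductorExponent_inv (χ : UnitaryChar p) :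
    charConductorExponent χ⁻¹ = charConductorExponent χ := by
  simp [charConductorExponent, inv_unitaryChar_apply]

theorem charConductorExponent_mul_le (χ η : UnitaryChar p) :
    charConductorExponent (χ * η) ≤ max (charConductorExponent χ) (charConductorExponent η) := by
  refine charConductorExponent_le fun u hu hu1 => ?_
  rw [ContinuousMonoidHom.mul_apply, apply_eq_one (le_max_left _ _) hu hu1,
    apply_eq_one (le_max_right _ _) hu hu1, one_mul]

theorem charConductorExponent_mul_of_isUnramified {χ η : UnitaryChar p} (hη : IsUnramified η) :
    charConductorExponent (χ * η) = charConductorExponent χ := by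
  have h0 := isUnramified_iff.1 hη
  apply le_antisymm
  · simpa [h0] using charConductorExponent_mul_le χ η
  · simpa [h0, charConductorExponent_inv] using charConductorExponent_mul_le (χ * η) η⁻¹

open Classical in
/-- The extension by zero to `ℚ_p` of a character of `ℚ_pˣ`. -/
noncomputable def charExt (χ : UnitaryChar p) : ℚ_[p] →*₀ ℂ where
  toFun x := if hx : x = 0 then 0 else (χ (Units.mk0 x hx) : ℂ)
  map_zero' := by simp
  map_one' := by simp
  map_mul' x y := by
    by_cases hx : x = 0
    · simp [hx]
    by_cases hy : y = 0
    · simp [hy]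
    · simp [hx, hy, ← Circle.coe_mul, ← map_mul]

theorem charExt_units (χ : UnitaryChar p) (u : ℚ_[p]ˣ) : charExt χ u = χ u := by
  simp [charExt]

theorem norm_charExt (χ : UnitaryChar p) {x : ℚ_[p]} (hx : x ≠ 0) : ‖charExt χ x‖ = 1 := by
  obtain ⟨u, rfl⟩ := (isUnit_iff_ne_zero.2 hx)
  rw [charExt_units, Circle.norm_coe]

theorem charExt_ne_zero (χ : UnitaryChar p) {x : ℚ_[p]} (hx : x ≠ 0) : charExt χ x ≠ 0 := by
  simpa using hx

theorem norm_charExt_le (χ : UnitaryChar p) (x : ℚ_[p]) : ‖charExt χ x‖ ≤ 1 := by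
  rcases eq_or_ne x 0 with rfl | hx
  · simp
  · exact (norm_charExt χ hx).le

theorem charExt_mul (χ η : UnitaryChar p) (x : ℚ_[p]) :
    charExt (χ * η) x = charExt χ x * charExt η x := by
  rcases eq_or_ne x 0 with rfl | hx
  · simp
  · obtain ⟨u, rfl⟩ := (isUnit_iff_ne_zero.2 hx)
    simp [charExt_units]

theorem charExt_inv (χ : UnitaryChar p) (x : ℚ_[p]) : charExt χ⁻¹ x = charExt χ x⁻¹ := by
  rcases eq_or_ne x 0 with rfl | hx
  · simp
  · obtain ⟨u, rfl⟩ := (isUnit_iff_ne_zero.2 hx)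
    rw [← Units.val_inv_eq_inv_val, charExt_units, charExt_units, map_inv,
      inv_unitaryChar_apply]

theorem conj_charExt (χ : UnitaryChar p) (x : ℚ_[p]) :
    (starRingEnd ℂ) (charExt χ x) = charExt χ x⁻¹ := by
  rcases eq_or_ne x 0 with rfl | hx
  · simp
  · rw [map_inv₀, Complex.inv_def, Complex.normSq_eq_norm_sq, norm_charExt χ hx]
    simp

theorem charExt_eq_one {χ : UnitaryChar p} {n : ℕ} (hn : charConductorExponent χ ≤ n) {x : ℚ_[p]}
    (hx : ‖x‖ = 1) (hx1 : ‖x - 1‖ ≤ (p : ℝ) ^ (-(n : ℤ))) : charExt χ x = 1 := by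
  obtain ⟨u, rfl⟩ := (isUnit_iff_ne_zero.2 (norm_pos_iff.1 (hx ▸ one_pos : 0 < ‖x‖)))
  rw [charExt_units, apply_eq_one hn hx hx1, Circle.coe_one]

theorem IsUnramified.charExt_eq_one {χ : UnitaryChar p} (hχ : IsUnramified χ) {x : ℚ_[p]}
    (hx : ‖x‖ = 1) : charExt χ x = 1 := by
  obtain ⟨u, rfl⟩ := (isUnit_iff_ne_zero.2 (norm_pos_iff.1 (hx ▸ one_pos : 0 < ‖x‖)))
  rw [charExt_units, hχ u hx, Circle.coe_one]

theorem IsUnramified.charExt_eq {χ : UnitaryChar p} (hχ : IsUnramified χ) {x y : ℚ_[p]}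
    (h : ‖x‖ = ‖y‖) : charExt χ x = charExt χ y := by
  rcases eq_or_ne y 0 with rfl | hy
  · rw [norm_zero, norm_eq_zero] at h
    rw [h]
  · have h1 : charExt χ (x / y) = 1 :=
      hχ.charExt_eq_one (by rw [norm_div, h, div_self (norm_ne_zero_iff.2 hy)])
    rw [map_div₀, div_eq_one_iff_eq (charExt_ne_zero χ hy)] at h1
    exact h1

/-- Away from 0 the extended character is locally constant, because `y / x` is close to 1 when `y`
is close to `x`. -/
theorem measurable_charExt (χ : UnitaryChar p) : Measurable (charExt χ) := by
  refine measurable_of_continuousOn_compl_singleton 0 fun x hx => ?_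
  have hx : x ≠ 0 := hx
  set n := charConductorExponent χ + 1
  apply ContinuousAt.continuousWithinAt
  have h1 : charExt χ =ᶠ[𝓝 x] fun _ => charExt χ x := by
    filter_upwards [closedBall_mem_nhds x
      (mul_pos (zpow_prime_pos (p := p) (-(n : ℤ))) (norm_pos_iff.2 hx))] with y hy
    rw [mem_closedBall, dist_eq_norm] at hy
    have h2 : ‖y / x - 1‖ ≤ (p : ℝ) ^ (-(n : ℤ)) := by
      rwa [div_sub_one hx, norm_div, div_le_iff₀ (norm_pos_iff.2 hx)]
    have h3 : ‖y / x‖ = 1 := norm_eq_one_of_sub_one_lt (h2.trans_lt (by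
      rw [← zpow_zero (p : ℝ), zpow_prime_lt_iff]
      omega))
    have h4 := LocalWhittaker.charExt_eq_one (χ := χ) (Nat.le_succ _) h3 h2
    rw [map_div₀, div_eq_one_iff_eq (charExt_ne_zero χ hx)] at h4
    exact h4
  exact continuousAt_const.congr h1.symm

end LocalWhittaker

namespace LocalWhittaker

variable {p : ℕ} [Fact p.Prime]

/-! ### Matrices -/

/-- The determinant of a matrix, as an element of the field. -/
noncomputable abbrev gdet (g : G p) : ℚ_[p] := (g : Matrix (Fin 2) (Fin 2) ℚ_[p]).det

variable (p) in
/-- The Weyl element `(0 1; 1 0)`. -/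
noncomputable def weyl : G p :=
  Matrix.GeneralLinearGroup.mkOfDetNeZero !![0, 1; 1, 0] (by simp [Matrix.det_fin_two_of])

/-- The lower triangular unipotent matrix `(1 0; z 1)`. -/
noncomputable def lower (z : ℚ_[p]) : G p :=
  Matrix.GeneralLinearGroup.mkOfDetNeZero !![1, 0; z, 1] (by simp [Matrix.det_fin_two_of])

theorem coe_upper (a : ℚ_[p]ˣ) (b : ℚ_[p]) (d : ℚ_[p]ˣ) :
    (upper a b d : Matrix (Fin 2) (Fin 2) ℚ_[p]) = !![(a : ℚ_[p]), b; 0, (d : ℚ_[p])] := rfl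

theorem coe_unip (x : ℚ_[p]) :
    (unip x : Matrix (Fin 2) (Fin 2) ℚ_[p]) = !![1, x; 0, 1] := rfl

theorem coe_weyl : (weyl p : Matrix (Fin 2) (Fin 2) ℚ_[p]) = !![0, 1; 1, 0] := rfl

theorem coe_lower (z : ℚ_[p]) :
    (lower z : Matrix (Fin 2) (Fin 2) ℚ_[p]) = !![1, 0; z, 1] := rfl

theorem gl_ext {g h : G p} (h00 : g 0 0 = h 0 0) (h01 : g 0 1 = h 0 1) (h10 : g 1 0 = h 1 0)
    (h11 : g 1 1 = h 1 1) : g = h := by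
  ext i j
  fin_cases i <;> fin_cases j <;> assumption

theorem mul_entry (g h : G p) (i j : Fin 2) :
    (g * h) i j = g i 0 * h 0 j + g i 1 * h 1 j := by
  rw [Units.val_mul, Matrix.mul_apply, Fin.sum_univ_two]

theorem gdet_mul (g h : G p) : gdet (g * h) = gdet g * gdet h := by
  simp [gdet]

theorem gdet_eq (g : G p) : gdet g = g 0 0 * g 1 1 - g 0 1 * g 1 0 := Matrix.det_fin_two _

theorem gdet_ne_zero (g : G p) : gdet g ≠ 0 :=
  (Matrix.isUnits_det_units g).ne_zero

theorem gdet_upper (a : ℚ_[p]ˣ) (b : ℚ_[p]) (d : ℚ_[p]ˣ) : gdet (upper a b d) = a * d := by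
  simp [gdet, coe_upper]

theorem gdet_unip (x : ℚ_[p]) : gdet (unip x) = 1 := by
  simp [gdet, coe_unip]

theorem gdet_weyl : gdet (weyl p) = -1 := by
  simp [gdet, coe_weyl]

theorem gdet_lower (z : ℚ_[p]) : gdet (lower z) = 1 := by
  simp [gdet, coe_lower]

theorem unip_add (x y : ℚ_[p]) : unip (x + y) = unip x * unip y := by
  apply gl_ext <;> simp [mul_entry, coe_unip, add_comm]

theorem unip_zero : unip (0 : ℚ_[p]) = 1 := by
  apply gl_ext <;> simp [coe_unip]

theorem lower_zero : lower (0 : ℚ_[p]) = 1 := by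
  apply gl_ext <;> simp [coe_lower]

/-- This governs the behaviour at infinity on the big cell: for large `x` the factor `lower x⁻¹` is
close to 1. -/
theorem weyl_mul_unip {x : ℚ_[p]} (hx : x ≠ 0) :
    weyl p * unip x = upper (-(Units.mk0 x hx)⁻¹) 1 (Units.mk0 x hx) * lower x⁻¹ := by
  apply gl_ext <;> simp [mul_entry, coe_unip, coe_weyl, coe_lower, coe_upper, hx]

theorem weyl_mul_unip_mul_upper (x : ℚ_[p]) (y : ℚ_[p]ˣ) :
    weyl p * unip x * upper y 0 1 = upper 1 0 y * (weyl p * unip (x / (y : ℚ_[p]))) := by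
  apply gl_ext <;> simp [mul_entry, coe_unip, coe_weyl, coe_upper, mul_div_cancel₀]

theorem upper_eq (a : ℚ_[p]ˣ) (b : ℚ_[p]) (d : ℚ_[p]ˣ) :
    upper a b d = unip (b / (d : ℚ_[p])) * (upper d 0 d * upper (a / d) 0 1) := by
  apply gl_ext <;> simp [mul_entry, coe_unip, coe_upper, mul_div_cancel₀]

theorem upper_scalar_mul_comm (d : ℚ_[p]ˣ) (g : G p) : upper d 0 d * g = g * upper d 0 d := by
  apply gl_ext <;> simp [mul_entry, coe_upper, mul_comm]

theorem row_ne_zero (g : G p) : g 1 0 ≠ 0 ∨ g 1 1 ≠ 0 := by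
  by_contra! h
  apply gdet_ne_zero g
  rw [gdet_eq, h.1, h.2]
  ring

/-- The big cell. -/
theorem exists_upper_mul_weyl {g : G p} (hg : g 1 0 ≠ 0) :
    ∃ a b d, g = upper a b d * (weyl p * unip (g 1 1 / g 1 0)) := by
  refine ⟨Units.mk0 (-(gdet g) / g 1 0) (div_ne_zero (neg_ne_zero.2 (gdet_ne_zero g)) hg), g 0 0,
    Units.mk0 (g 1 0) hg, ?_⟩
  apply gl_ext <;> simp [mul_entry, coe_unip, coe_weyl, coe_upper, gdet_eq] <;> field_simp
  ring

theorem exists_upper_mul_lower {g : G p} (hg : g 1 1 ≠ 0) :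
    ∃ a b d, g = upper a b d * lower (g 1 0 / g 1 1) := by
  refine ⟨Units.mk0 (gdet g / g 1 1) (div_ne_zero (gdet_ne_zero g) hg), g 0 1,
    Units.mk0 (g 1 1) hg, ?_⟩
  apply gl_ext <;> simp [mul_entry, coe_lower, coe_upper, gdet_eq] <;> field_simp
  ring

/-- An Iwasawa decomposition: modulo the Borel subgroup only the bottom row up to scaling matters, a
point of the projective line, and the two charts correspond to which entry has the larger norm. -/
theorem eq_upper_mul_weyl_or_lower (g : G p) :
    (∃ a b d t, ‖t‖ ≤ 1 ∧ g = upper a b d * (weyl p * unip t)) ∨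
      ∃ a b d z, ‖z‖ < 1 ∧ g = upper a b d * lower z := by
  rcases le_or_gt ‖g 1 1‖ ‖g 1 0‖ with h | h
  · have h0 : g 1 0 ≠ 0 := by
      intro h0
      rw [h0, norm_zero, norm_le_zero_iff] at h
      exact (row_ne_zero g).elim (fun h' => h' h0) (fun h' => h' h)
    obtain ⟨a, b, d, hg⟩ := exists_upper_mul_weyl h0
    refine Or.inl ⟨a, b, d, _, ?_, hg⟩
    rw [norm_div]
    exact div_le_one_of_le₀ h (norm_nonneg _)
  · have h0 : g 1 1 ≠ 0 := norm_pos_iff.1 ((norm_nonneg _).trans_lt h)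
    obtain ⟨a, b, d, hg⟩ := exists_upper_mul_lower h0
    refine Or.inr ⟨a, b, d, _, ?_, hg⟩
    rw [norm_div, div_lt_one (norm_pos_iff.2 h0)]
    exact h

theorem continuous_lower : Continuous (lower : ℚ_[p] → G p) := by
  rw [Units.continuous_iff]
  constructor
  · refine continuous_matrix fun i j => ?_
    fin_cases i <;> fin_cases j <;> simp [coe_lower, continuous_const, continuous_id']
  · have h : ∀ z : ℚ_[p], (lower z)⁻¹ = lower (-z) := fun z => by
      rw [inv_eq_iff_mul_eq_one]
      apply gl_ext <;> simp [mul_entry, coe_lower]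
    simp_rw [h]
    refine continuous_matrix fun i j => ?_
    fin_cases i <;> fin_cases j <;> simp [coe_lower, continuous_const, continuous_neg]

variable (p) in
/-- The principal congruence subgroup of level `p ^ n`. -/
def principalCongruence (n : ℕ) : Set (G p) :=
  {k ∈ K1 p n | ‖k 0 0 - 1‖ ≤ (p : ℝ) ^ (-(n : ℤ))}

theorem principalCongruence_mem_nhds (n : ℕ) : principalCongruence p n ∈ 𝓝 (1 : G p) := by
  have hent : ∀ i j : Fin 2, Tendsto (fun k : G p => k i j) (𝓝 1) (𝓝 ((1 : G p) i j)) :=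
    fun i j => ((Units.continuous_val.matrix_elem i j).tendsto 1)
  have hball : ∀ i j : Fin 2, ∀ᶠ k : G p in 𝓝 1,
      ‖k i j - (1 : G p) i j‖ ≤ (p : ℝ) ^ (-(n : ℤ)) := by
    intro i j
    filter_upwards [(hent i j).eventually (closedBall_mem_nhds _ (zpow_prime_pos (p := p) (-(n : ℤ))))]
      with k hk
    rwa [← dist_eq_norm]
  have hdet : ∀ᶠ k : G p in 𝓝 1, ‖gdet k - 1‖ < 1 := by
    have : Tendsto (fun k : G p => gdet k) (𝓝 1) (𝓝 (gdet 1)) :=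
      (Units.continuous_val.matrix_det.tendsto 1)
    rw [show gdet (1 : G p) = 1 by simp [gdet]] at this
    filter_upwards [this.eventually (ball_mem_nhds _ one_pos)] with k hk
    rwa [← dist_eq_norm]
  have hn : (p : ℝ) ^ (-(n : ℤ)) ≤ 1 := by
    rw [← zpow_zero (p : ℝ), zpow_prime_le_iff]
    omega
  filter_upwards [hball 0 0, hball 0 1, hball 1 0, hball 1 1, hdet] with k h00 h01 h10 h11 hd
  simp at h00 h01 h10 h11
  refine ⟨⟨?_, norm_eq_one_of_sub_one_lt hd, by simpa using h10, by simpa using h11⟩,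
    by simpa using h00⟩
  simp at hn
  have aux : ∀ x : ℚ_[p], ‖x - 1‖ ≤ ((p : ℝ) ^ n)⁻¹ → ‖x‖ ≤ 1 := fun x hx => by
    simpa using norm_add_le_of_le (hx.trans hn) (by simp : ‖(1 : ℚ_[p])‖ ≤ 1)
  intro i j
  fin_cases i <;> fin_cases j
  · exact aux _ h00
  · exact h01.trans hn
  · exact h10.trans hn
  · exact aux _ h11

theorem K1_mem_nhds (n : ℕ) : K1 p n ∈ 𝓝 (1 : G p) :=
  mem_of_superset (principalCongruence_mem_nhds n) fun _ hk => hk.1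

/-! ### Functions on `GL(2, ℚ_p)` given by functions of the bottom row -/

/-- Homogeneity of a function of the bottom row. -/
def IsRowHomogeneous (χ : UnitaryChar p) (Q : ℚ_[p] → ℚ_[p] → ℂ) : Prop :=
  ∀ (t : ℚ_[p]ˣ) (c d : ℚ_[p]), Q (t * c) (t * d) = charExt χ t * (‖(t : ℚ_[p])‖ : ℂ)⁻¹ * Q c d

/-- The function on `GL(2, ℚ_p)` attached to a function of the bottom row. -/
noncomputable def rowFun (χ₁ : UnitaryChar p) (Q : ℚ_[p] → ℚ_[p] → ℂ) (g : G p) : ℂ :=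
  charExt χ₁ (gdet g) * (Real.sqrt ‖gdet g‖ : ℂ) * Q (g 1 0) (g 1 1)

/-- The bookkeeping is `χ₁(a d) (χ₂ χ₁⁻¹)(d) = χ₁(a) χ₂(d)` and `√|a d| · |d|⁻¹ = √|a / d|`, which
is why homogeneity is required with the factor `‖t‖⁻¹`. -/
theorem rowFun_upper_mul {χ₁ χ₂ : UnitaryChar p} {Q : ℚ_[p] → ℚ_[p] → ℂ}
    (hQ : IsRowHomogeneous (χ₂ * χ₁⁻¹) Q) (a d : ℚ_[p]ˣ) (b : ℚ_[p]) (g : G p) :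
    rowFun χ₁ Q (upper a b d * g) =
      (χ₁ a : ℂ) * (χ₂ d : ℂ) * (Real.sqrt ‖(a : ℚ_[p]) / (d : ℚ_[p])‖ : ℂ) * rowFun χ₁ Q g := by
  have h10 : (upper a b d * g) 1 0 = d * g 1 0 := by simp [mul_entry, coe_upper]
  have h11 : (upper a b d * g) 1 1 = d * g 1 1 := by simp [mul_entry, coe_upper]
  have hd := norm_pos_iff.2 d.ne_zero
  have hs : Real.sqrt ‖(a : ℚ_[p]) / (d : ℚ_[p])‖ =
      Real.sqrt ‖(a : ℚ_[p]) * (d : ℚ_[p])‖ * ‖(d : ℚ_[p])‖⁻¹ := by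
    rw [norm_div, norm_mul, show ‖(a : ℚ_[p])‖ * ‖(d : ℚ_[p])‖ =
      ‖(a : ℚ_[p])‖ / ‖(d : ℚ_[p])‖ * ‖(d : ℚ_[p])‖ ^ 2 by field_simp,
      Real.sqrt_mul (by positivity), Real.sqrt_sq hd.le, mul_assoc, mul_inv_cancel₀ hd.ne', mul_one]
  have hc : charExt χ₁ (d : ℚ_[p]) ≠ 0 := charExt_ne_zero _ d.ne_zero
  rw [rowFun, rowFun, h10, h11, hQ, gdet_mul, gdet_upper, norm_mul, Real.sqrt_mul (norm_nonneg _),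
    hs, charExt_mul, charExt_inv, map_inv₀, map_mul, map_mul, ← charExt_units, ← charExt_units]
  push_cast
  field_simp

theorem rowFun_mul {χ₁ : UnitaryChar p} {Q : ℚ_[p] → ℚ_[p] → ℂ} (g k : G p)
    (hk : ‖gdet k‖ = 1) : rowFun χ₁ Q (g * k) =
      charExt χ₁ (gdet g) * (Real.sqrt ‖gdet g‖ : ℂ) * (charExt χ₁ (gdet k) *
        Q (g 1 0 * k 0 0 + g 1 1 * k 1 0) (g 1 0 * k 0 1 + g 1 1 * k 1 1)) := by
  rw [rowFun, mul_entry, mul_entry, gdet_mul, norm_mul, hk, mul_one, map_mul]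
  ring

theorem rowFun_mem {χ₁ χ₂ : UnitaryChar p} {Q : ℚ_[p] → ℚ_[p] → ℂ}
    (hQ : IsRowHomogeneous (χ₂ * χ₁⁻¹) Q) {U : Set (G p)} (hU : U ∈ 𝓝 1)
    (h : ∀ k ∈ U, ∀ g, rowFun χ₁ Q (g * k) = rowFun χ₁ Q g) :
    rowFun χ₁ Q ∈ principalSeriesSpace χ₁ χ₂ :=
  ⟨⟨U, hU, h⟩, fun a d b g => rowFun_upper_mul hQ a d b g⟩

end LocalWhittaker

namespace LocalWhittaker

variable {p : ℕ} [Fact p.Prime]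

theorem neg_zpow_lt_one {n : ℕ} (hn : 1 ≤ n) : (p : ℝ) ^ (-(n : ℤ)) < 1 := by
  rw [← zpow_zero (p : ℝ), zpow_prime_lt_iff]
  omega

theorem neg_zpow_le_one (n : ℕ) : (p : ℝ) ^ (-(n : ℤ)) ≤ 1 := by
  rw [← zpow_zero (p : ℝ), zpow_prime_le_iff]
  omega

/-! ### The vector supported on the big cell over `ℤ_p` -/

/-- The bottom row function that is supported on `‖d‖ ≤ ‖c‖`. -/
noncomputable def bigCellRow (χ : UnitaryChar p) (c d : ℚ_[p]) : ℂ :=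
  if ‖d‖ ≤ ‖c‖ then charExt χ c * (‖c‖ : ℂ)⁻¹ else 0

theorem bigCellRow_homogeneous (χ : UnitaryChar p) : IsRowHomogeneous χ (bigCellRow χ) := by
  intro t c d
  have ht := norm_pos_iff.2 t.ne_zero
  simp only [bigCellRow, norm_mul, mul_le_mul_iff_right₀ ht]
  split_ifs
  · rw [map_mul]
    push_cast
    rw [mul_inv]
    ring
  · simp

theorem norm_diag_of_integral {k : G p} (hk : ∀ i j, ‖k i j‖ ≤ 1) (hdet : ‖gdet k‖ = 1)
    (h10 : ‖k 1 0‖ < 1) : ‖k 0 0‖ = 1 ∧ ‖k 1 1‖ = 1 := by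
  have h1 : ‖k 0 1 * k 1 0‖ < 1 := by
    rw [norm_mul]
    exact (mul_le_of_le_one_left (norm_nonneg _) (hk 0 1)).trans_lt h10
  have h2 : ‖k 0 0 * k 1 1‖ = 1 := by
    have h3 := norm_add_eq_left (x := gdet k) (y := k 0 1 * k 1 0) (by rwa [hdet])
    rwa [hdet, gdet_eq, sub_add_cancel] at h3
  rw [norm_mul] at h2
  have h00 := hk 0 0
  have h11 := hk 1 1
  constructor
  · nlinarith [norm_nonneg (k 0 0), norm_nonneg (k 1 1)]
  · nlinarith [norm_nonneg (k 0 0), norm_nonneg (k 1 1)]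

/-- A matrix of `GL(2, ℤ_p)` that is upper triangular modulo `p` preserves the condition `‖d‖ ≤
‖c‖`. On this set it multiplies `c` by the unit `k 0 0 + (d / c) k 1 0`. -/
theorem bigCellRow_mul (χ : UnitaryChar p) {k : G p} (hk : ∀ i j, ‖k i j‖ ≤ 1)
    (hdet : ‖gdet k‖ = 1) (h10 : ‖k 1 0‖ < 1) (c d : ℚ_[p]) :
    bigCellRow χ (c * k 0 0 + d * k 1 0) (c * k 0 1 + d * k 1 1) =
      charExt χ (k 0 0 + d / c * k 1 0) * bigCellRow χ c d := by
  obtain ⟨h00, h11⟩ := norm_diag_of_integral hk hdet h10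
  rcases le_or_gt ‖d‖ ‖c‖ with h | h
  · rcases eq_or_ne c 0 with rfl | hc
    · obtain rfl : d = 0 := by simpa using h
      simp [bigCellRow]
    · have hdc : ‖d / c‖ ≤ 1 := by
        rw [norm_div]
        exact div_le_one_of_le₀ h (norm_nonneg _)
      have e1 : c * k 0 0 + d * k 1 0 = c * (k 0 0 + d / c * k 1 0) := by field_simp
      have hu : ‖k 0 0 + d / c * k 1 0‖ = 1 := by
        rw [norm_add_eq_left, h00]
        rw [h00, norm_mul]
        exact (mul_le_of_le_one_left (norm_nonneg _) hdc).trans_lt h10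
      have hle : ‖c * k 0 1 + d * k 1 1‖ ≤ ‖c‖ := norm_add_le_of_le
        (by rw [norm_mul]; exact mul_le_of_le_one_right (norm_nonneg _) (hk 0 1))
        (by rw [norm_mul, h11, mul_one]; exact h)
      rw [bigCellRow, e1, norm_mul, hu, mul_one, if_pos hle, bigCellRow, if_pos h, map_mul]
      ring
  · have h1 : ‖c * k 0 1 + d * k 1 1‖ = ‖d‖ := by
      rw [add_comm, norm_add_eq_left, norm_mul, h11, mul_one]
      rw [norm_mul, norm_mul, h11, mul_one]
      exact (mul_le_of_le_one_right (norm_nonneg _) (hk 0 1)).trans_lt h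
    have h2 : ‖c * k 0 0 + d * k 1 0‖ < ‖d‖ := by
      refine (IsUltrametricDist.norm_add_le_max _ _).trans_lt (max_lt ?_ ?_)
      · rwa [norm_mul, h00, mul_one]
      · rw [norm_mul]
        exact mul_lt_of_lt_one_right ((norm_nonneg _).trans_lt h) h10
    rw [bigCellRow, h1, if_neg h2.not_ge, bigCellRow, if_neg h.not_ge, mul_zero]

/-- The function in the principal series which is supported on the big cell and constant on
`(0 1; 1 0) (1 x; 0 1)` for `x` in `ℤ_p`. -/
noncomputable def bigCellFun (χ₁ χ₂ : UnitaryChar p) : G p → ℂ :=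
  rowFun χ₁ (bigCellRow (χ₂ * χ₁⁻¹))

theorem bigCellFun_mul {χ₁ χ₂ : UnitaryChar p} {k : G p} (hk : ∀ i j, ‖k i j‖ ≤ 1)
    (hdet : ‖gdet k‖ = 1) (h10 : ‖k 1 0‖ < 1)
    (h : ∀ t : ℚ_[p], ‖t‖ ≤ 1 →
      charExt χ₁ (gdet k / (k 0 0 + t * k 1 0)) * charExt χ₂ (k 0 0 + t * k 1 0) = 1)
    (g : G p) : bigCellFun χ₁ χ₂ (g * k) = bigCellFun χ₁ χ₂ g := by
  rw [bigCellFun, rowFun_mul g k hdet, bigCellRow_mul _ hk hdet h10, rowFun]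
  rcases le_or_gt ‖g 1 1‖ ‖g 1 0‖ with hg | hg
  · have := h (g 1 1 / g 1 0) (by
      rw [norm_div]
      exact div_le_one_of_le₀ hg (norm_nonneg _))
    rw [map_div₀] at this
    rw [charExt_mul, charExt_inv, map_inv₀]
    linear_combination (charExt χ₁ (gdet g) * (Real.sqrt ‖gdet g‖ : ℂ) *
      bigCellRow (χ₂ * χ₁⁻¹) (g 1 0) (g 1 1)) * this
  · rw [bigCellRow, if_neg hg.not_ge]
    simp

theorem bigCellFun_mem (χ₁ χ₂ : UnitaryChar p) :
    bigCellFun χ₁ χ₂ ∈ principalSeriesSpace χ₁ χ₂ := by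
  set n := max (charConductorExponent χ₁) (charConductorExponent χ₂) + 1 with hn
  refine rowFun_mem (bigCellRow_homogeneous _) (principalCongruence_mem_nhds n) fun k hk g => ?_
  obtain ⟨⟨hk, hdet, h10, h11⟩, h00⟩ := hk
  have hlt := neg_zpow_lt_one (p := p) (n := n) (by omega)
  refine bigCellFun_mul hk hdet (h10.trans_lt hlt) (fun t ht => ?_) g
  have hu1 : ‖k 0 0 + t * k 1 0 - 1‖ ≤ (p : ℝ) ^ (-(n : ℤ)) := by
    rw [add_sub_right_comm]
    refine norm_add_le_of_le h00 ?_
    rw [norm_mul]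
    exact (mul_le_of_le_one_left (norm_nonneg _) ht).trans h10
  have hu : ‖k 0 0 + t * k 1 0‖ = 1 := norm_eq_one_of_sub_one_lt (hu1.trans_lt hlt)
  have hu0 : k 0 0 + t * k 1 0 ≠ 0 := norm_ne_zero_iff.1 (by rw [hu]; exact one_ne_zero)
  have hd1 : ‖gdet k / (k 0 0 + t * k 1 0) - 1‖ ≤ (p : ℝ) ^ (-(n : ℤ)) := by
    rw [div_sub_one hu0, norm_div, hu, div_one, gdet_eq]
    have : k 0 0 * k 1 1 - k 0 1 * k 1 0 - (k 0 0 + t * k 1 0) =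
      k 0 0 * (k 1 1 - 1) - (k 0 1 + t) * k 1 0 := by ring
    rw [this]
    refine norm_sub_le_of_le ?_ ?_
    · rw [norm_mul]
      exact (mul_le_of_le_one_left (norm_nonneg _) (hk 0 0)).trans h11
    · rw [norm_mul]
      exact (mul_le_of_le_one_left (norm_nonneg _) (norm_add_le_of_le (hk 0 1) ht)).trans h10
  rw [charExt_eq_one (by omega) (by rw [norm_div, hu, div_one]; exact hdet) hd1,
    charExt_eq_one (by omega) hu hu1, one_mul]

/-- The unramified `χ₂` ignores the unit by which `c` is multiplied, and `χ₁` sees only `det k`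
divided by that unit, which is congruent to 1 modulo `p ^ c(χ₁)`. -/
theorem bigCellFun_K1_fixed {χ₁ χ₂ : UnitaryChar p} (h2 : IsUnramified χ₂)
    (h1 : 1 ≤ charConductorExponent χ₁) {k : G p} (hk : k ∈ K1 p (charConductorExponent χ₁))
    (g : G p) : bigCellFun χ₁ χ₂ (g * k) = bigCellFun χ₁ χ₂ g := by
  obtain ⟨hk, hdet, h10, h11⟩ := hk
  have hlt := neg_zpow_lt_one (p := p) h1
  refine bigCellFun_mul hk hdet (h10.trans_lt hlt) (fun t ht => ?_) g
  have hu : ‖k 0 0 + t * k 1 0‖ = 1 := by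
    have h00 := (norm_diag_of_integral hk hdet (h10.trans_lt hlt)).1
    rw [norm_add_eq_left, h00]
    rw [h00, norm_mul]
    exact (mul_le_of_le_one_left (norm_nonneg _) ht).trans_lt (h10.trans_lt hlt)
  have hu0 : k 0 0 + t * k 1 0 ≠ 0 := norm_ne_zero_iff.1 (by rw [hu]; exact one_ne_zero)
  have hd1 : ‖gdet k / (k 0 0 + t * k 1 0) - 1‖ ≤
      (p : ℝ) ^ (-(charConductorExponent χ₁ : ℤ)) := by
    rw [div_sub_one hu0, norm_div, hu, div_one, gdet_eq]
    have : k 0 0 * k 1 1 - k 0 1 * k 1 0 - (k 0 0 + t * k 1 0) =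
      k 0 0 * (k 1 1 - 1) - (k 0 1 + t) * k 1 0 := by ring
    rw [this]
    refine norm_sub_le_of_le ?_ ?_
    · rw [norm_mul]
      exact (mul_le_of_le_one_left (norm_nonneg _) (hk 0 0)).trans h11
    · rw [norm_mul]
      exact (mul_le_of_le_one_left (norm_nonneg _) (norm_add_le_of_le (hk 0 1) ht)).trans h10
  rw [charExt_eq_one le_rfl (by rw [norm_div, hu, div_one]; exact hdet) hd1,
    h2.charExt_eq_one hu, one_mul]

variable (p) in
/-- The Atkin-Lehner element `(0 1; p ^ n 0)`. -/
noncomputable def atkinLehner (n : ℕ) : G p :=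
  Matrix.GeneralLinearGroup.mkOfDetNeZero !![0, 1; (p : ℚ_[p]) ^ n, 0]
    (by simpa [Matrix.det_fin_two_of] using fun h => absurd h (Fact.out : p.Prime).ne_zero)

theorem coe_atkinLehner (n : ℕ) : (atkinLehner p n : Matrix (Fin 2) (Fin 2) ℚ_[p]) =
    !![0, 1; (p : ℚ_[p]) ^ n, 0] := rfl

/-- Conjugation by the Atkin-Lehner element interchanges the diagonal entries of `k`, so the
congruence `k 1 1 ≡ 1` moves to the upper left corner, where `χ₂` acts; `χ₁` sees only units. -/
theorem bigCellFun_atkinLehner_K1_fixed {χ₁ χ₂ : UnitaryChar p} (h1 : IsUnramified χ₁)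
    (h2 : 1 ≤ charConductorExponent χ₂) {k : G p} (hk : k ∈ K1 p (charConductorExponent χ₂))
    (g : G p) : bigCellFun χ₁ χ₂ (g * k * atkinLehner p (charConductorExponent χ₂)) =
      bigCellFun χ₁ χ₂ (g * atkinLehner p (charConductorExponent χ₂)) := by
  set n := charConductorExponent χ₂ with hn
  set η := atkinLehner p n with hη
  have hp : (p : ℚ_[p]) ^ n ≠ 0 := pow_ne_zero _ prime_padic_ne_zero
  have hpn : ‖(p : ℚ_[p]) ^ n‖ = (p : ℝ) ^ (-(n : ℤ)) := by
    rw [← zpow_natCast, norm_prime_zpow]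
  obtain ⟨hk, hdet, h10, h11⟩ := hk
  have hlt := neg_zpow_lt_one (p := p) h2
  obtain ⟨k', hk'⟩ : ∃ k', k * η = η * k' := ⟨η⁻¹ * (k * η), by group⟩
  have ent : ∀ i j, (k * η) i j = (η * k') i j := fun i j => by rw [hk']
  have e00 : k' 1 0 = k 0 1 * (p : ℚ_[p]) ^ n := by
    have := ent 0 0
    simp [mul_entry, hη, coe_atkinLehner] at this
    exact this.symm
  have e01 : k' 1 1 = k 0 0 := by
    have := ent 0 1
    simp [mul_entry, hη, coe_atkinLehner] at this
    exact this.symm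
  have e10 : k' 0 0 = k 1 1 := by
    have := ent 1 0
    simp [mul_entry, hη, coe_atkinLehner] at this
    exact (mul_left_cancel₀ hp (by rw [← this, mul_comm]))
  have e11 : k' 0 1 = k 1 0 / (p : ℚ_[p]) ^ n := by
    have := ent 1 1
    simp [mul_entry, hη, coe_atkinLehner] at this
    rw [this, mul_div_cancel_left₀ _ hp]
  have hdet' : gdet k' = gdet k := by
    rw [gdet_eq, gdet_eq, e00, e01, e10, e11]
    field_simp
  have h10' : ‖k' 1 0‖ ≤ (p : ℝ) ^ (-(n : ℤ)) := by
    rw [e00, norm_mul, hpn]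
    exact mul_le_of_le_one_left (zpow_prime_pos _).le (hk 0 1)
  rw [mul_assoc, hk', ← mul_assoc]
  refine bigCellFun_mul ?_ (by rw [hdet']; exact hdet) (h10'.trans_lt hlt) (fun t ht => ?_) _
  · intro i j
    fin_cases i <;> fin_cases j
    · exact e10 ▸ hk 1 1
    · change ‖k' 0 1‖ ≤ 1
      rw [e11, norm_div, hpn]
      exact div_le_one_of_le₀ h10 (zpow_prime_pos _).le
    · exact h10'.trans hlt.le
    · exact e01 ▸ hk 0 0
  · have hu1 : ‖k' 0 0 + t * k' 1 0 - 1‖ ≤ (p : ℝ) ^ (-(n : ℤ)) := by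
      rw [add_sub_right_comm, e10]
      refine norm_add_le_of_le h11 ?_
      rw [norm_mul]
      exact (mul_le_of_le_one_left (norm_nonneg _) ht).trans h10'
    have hu : ‖k' 0 0 + t * k' 1 0‖ = 1 := norm_eq_one_of_sub_one_lt (hu1.trans_lt hlt)
    rw [h1.charExt_eq_one (by rw [norm_div, hu, div_one, hdet']; exact hdet),
      charExt_eq_one hn.ge hu hu1, one_mul]

/-! ### The spherical vector -/

/-- The bottom row function defining the spherical vector. -/
noncomputable def sphericalRow (χ : UnitaryChar p) (c d : ℚ_[p]) : ℂ :=
  if ‖d‖ ≤ ‖c‖ then charExt χ c * (‖c‖ : ℂ)⁻¹ else charExt χ d * (‖d‖ : ℂ)⁻¹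

theorem sphericalRow_homogeneous (χ : UnitaryChar p) : IsRowHomogeneous χ (sphericalRow χ) := by
  intro t c d
  have ht := norm_pos_iff.2 t.ne_zero
  simp only [sphericalRow, norm_mul, mul_le_mul_iff_right₀ ht]
  split_ifs <;>
  · rw [map_mul]
    push_cast
    rw [mul_inv]
    ring

theorem sphericalRow_eq {χ : UnitaryChar p} (hχ : IsUnramified χ) {c d e : ℚ_[p]}
    (h : ‖e‖ = max ‖c‖ ‖d‖) : sphericalRow χ c d = charExt χ e * (‖e‖ : ℂ)⁻¹ := by
  rw [sphericalRow]
  split_ifs with hcd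
  · rw [max_eq_left hcd] at h
    rw [h, hχ.charExt_eq h]
  · rw [max_eq_right (not_le.1 hcd).le] at h
    rw [h, hχ.charExt_eq h]

theorem sphericalRow_congr {χ : UnitaryChar p} (hχ : IsUnramified χ) {c d c' d' : ℚ_[p]}
    (h : max ‖c‖ ‖d‖ = max ‖c'‖ ‖d'‖) : sphericalRow χ c d = sphericalRow χ c' d' := by
  obtain ⟨e, he⟩ : ∃ e : ℚ_[p], ‖e‖ = max ‖c‖ ‖d‖ := by
    rcases max_choice ‖c‖ ‖d‖ with h | h <;> rw [h]
    · exact ⟨c, rfl⟩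
    · exact ⟨d, rfl⟩
  rw [sphericalRow_eq hχ he, sphericalRow_eq hχ (he.trans h)]

theorem max_norm_row_mul_le {k : G p} (hk : ∀ i j, ‖k i j‖ ≤ 1) (c d : ℚ_[p]) :
    max ‖c * k 0 0 + d * k 1 0‖ ‖c * k 0 1 + d * k 1 1‖ ≤ max ‖c‖ ‖d‖ := by
  refine max_le ?_ ?_ <;>
  · refine norm_add_le_of_le ?_ ?_ <;> rw [norm_mul]
    · exact (mul_le_of_le_one_right (norm_nonneg _) (hk _ _)).trans (le_max_left _ _)
    · exact (mul_le_of_le_one_right (norm_nonneg _) (hk _ _)).trans (le_max_right _ _)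

/-- The reverse inequality uses the adjugate of `k`, which is integral and recovers `c` and `d` up
to the unit `det k`. -/
theorem max_norm_row_mul {k : G p} (hk : ∀ i j, ‖k i j‖ ≤ 1) (hdet : ‖gdet k‖ = 1)
    (c d : ℚ_[p]) :
    max ‖c * k 0 0 + d * k 1 0‖ ‖c * k 0 1 + d * k 1 1‖ = max ‖c‖ ‖d‖ := by
  refine le_antisymm (max_norm_row_mul_le hk c d) ?_
  set X := c * k 0 0 + d * k 1 0 with hX
  set Y := c * k 0 1 + d * k 1 1 with hY
  have hc : ‖c‖ = ‖k 1 1 * X - k 1 0 * Y‖ := by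
    rw [← mul_one ‖c‖, ← hdet, ← norm_mul, gdet_eq, hX, hY]
    congr 1
    ring
  have hd : ‖d‖ = ‖k 0 0 * Y - k 0 1 * X‖ := by
    rw [← mul_one ‖d‖, ← hdet, ← norm_mul, gdet_eq, hX, hY]
    congr 1
    ring
  rw [hc, hd]
  refine max_le ?_ ?_ <;> refine norm_sub_le_of_le ?_ ?_ <;> rw [norm_mul] <;>
    refine (mul_le_of_le_one_left (norm_nonneg _) (hk _ _)).trans ?_ <;> simp

/-- The spherical vector of an unramified principal series. -/
noncomputable def sphericalFun (χ₁ χ₂ : UnitaryChar p) : G p → ℂ :=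
  rowFun χ₁ (sphericalRow (χ₂ * χ₁⁻¹))

theorem isUnramified_mul_inv {χ₁ χ₂ : UnitaryChar p} (h1 : IsUnramified χ₁)
    (h2 : IsUnramified χ₂) : IsUnramified (χ₂ * χ₁⁻¹) := fun u hu => by
  rw [ContinuousMonoidHom.mul_apply, inv_unitaryChar_apply, h1 u hu, h2 u hu]
  simp

theorem sphericalFun_mul {χ₁ χ₂ : UnitaryChar p} (h1 : IsUnramified χ₁) (h2 : IsUnramified χ₂)
    {k : G p} (hk : ∀ i j, ‖k i j‖ ≤ 1) (hdet : ‖gdet k‖ = 1) (g : G p) :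
    sphericalFun χ₁ χ₂ (g * k) = sphericalFun χ₁ χ₂ g := by
  rw [sphericalFun, rowFun_mul g k hdet, h1.charExt_eq_one hdet, one_mul,
    sphericalRow_congr (isUnramified_mul_inv h1 h2) (max_norm_row_mul hk hdet _ _), rowFun]

theorem sphericalFun_mem {χ₁ χ₂ : UnitaryChar p} (h1 : IsUnramified χ₁) (h2 : IsUnramified χ₂) :
    sphericalFun χ₁ χ₂ ∈ principalSeriesSpace χ₁ χ₂ :=
  rowFun_mem (sphericalRow_homogeneous _) (K1_mem_nhds 0)
    fun _ hk g => sphericalFun_mul h1 h2 hk.1 hk.2.1 g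

/-! ### The newvector for two ramified characters -/

/-- The bottom row function defining the newvector for two ramified characters. -/
noncomputable def ramifiedRow (χ₁ χ₂ : UnitaryChar p) (c d : ℚ_[p]) : ℂ :=
  if ‖c‖ = (p : ℝ) ^ (-(charConductorExponent χ₂ : ℤ)) * ‖d‖ then
    (charExt χ₁ c)⁻¹ * charExt χ₂ d * (‖d‖ : ℂ)⁻¹ else 0

theorem ramifiedRow_homogeneous (χ₁ χ₂ : UnitaryChar p) :
    IsRowHomogeneous (χ₂ * χ₁⁻¹) (ramifiedRow χ₁ χ₂) := by
  intro t c d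
  have ht := norm_pos_iff.2 t.ne_zero
  simp only [ramifiedRow, norm_mul, mul_left_comm _ ‖(t : ℚ_[p])‖, mul_right_inj' ht.ne']
  split_ifs
  · rw [map_mul, map_mul, charExt_mul, charExt_inv, map_inv₀]
    push_cast
    rw [mul_inv, mul_inv]
    ring
  · simp

/-- The support `‖c‖ = p ^ (-c(χ₂)) ‖d‖` is the only double coset at level `c(χ₁) + c(χ₂)` that is
compatible with both conductors. On it `k` multiplies `c` by a unit `u` with `det k / u ≡ 1` modulo
`p ^ c(χ₁)` and `d` by a unit congruent to 1 modulo `p ^ c(χ₂)`. -/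
theorem ramifiedRow_mul {χ₁ χ₂ : UnitaryChar p} (h1 : 1 ≤ charConductorExponent χ₁)
    (h2 : 1 ≤ charConductorExponent χ₂) {k : G p}
    (hk : k ∈ K1 p (charConductorExponent χ₁ + charConductorExponent χ₂)) (c d : ℚ_[p]) :
    charExt χ₁ (gdet k) * ramifiedRow χ₁ χ₂ (c * k 0 0 + d * k 1 0) (c * k 0 1 + d * k 1 1) =
      ramifiedRow χ₁ χ₂ c d := by
  obtain ⟨hk, hdet, h10, h11⟩ := hk
  set c₁ := charConductorExponent χ₁
  set c₂ := charConductorExponent χ₂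
  have hlt := neg_zpow_lt_one (p := p) (n := c₁ + c₂) (by omega)
  have hlt1 := neg_zpow_lt_one (p := p) h1
  have hlt2 := neg_zpow_lt_one (p := p) h2
  obtain ⟨k00, k11⟩ := norm_diag_of_integral hk hdet (h10.trans_lt hlt)
  have hsplit : (p : ℝ) ^ (-((c₁ + c₂ : ℕ) : ℤ)) = (p : ℝ) ^ (-(c₁ : ℤ)) * (p : ℝ) ^ (-(c₂ : ℤ)) := by
    rw [← zpow_add₀ prime_cast_pos.ne']
    congr 1
    push_cast
    ring
  have hmul_lt : ∀ x : ℚ_[p], x ≠ 0 → ‖x * k 1 0‖ < (p : ℝ) ^ (-(c₂ : ℤ)) * ‖x‖ := fun x hx => by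
    have hx' := norm_pos_iff.2 hx
    rw [norm_mul, mul_comm]
    refine mul_lt_mul_of_pos_right (h10.trans_lt ?_) hx'
    rw [zpow_prime_lt_iff]
    omega
  have hmul_le : ∀ x : ℚ_[p], ‖x * k 0 1‖ ≤ ‖x‖ := fun x => by
    rw [norm_mul]
    exact mul_le_of_le_one_right (norm_nonneg _) (hk 0 1)
  have aux : ∀ x y : ℝ, 0 < x → y ≤ x → x ≠ (p : ℝ) ^ (-(c₂ : ℤ)) * y := fun x y hx hy h => by
    have a1 := mul_le_mul_of_nonneg_left hy (zpow_prime_pos (p := p) (-(c₂ : ℤ))).le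
    have a2 := mul_lt_of_lt_one_left hx hlt2
    linarith
  by_cases hd : d = 0
  · subst hd
    by_cases hc : c = 0
    · simp [hc, ramifiedRow]
    · have hc' := norm_pos_iff.2 hc
      have h0 : ¬ ‖c‖ = (p : ℝ) ^ (-(c₂ : ℤ)) * ‖(0 : ℚ_[p])‖ := by simp [hc]
      have h0' : ¬ ‖c * k 0 0 + 0 * k 1 0‖ =
          (p : ℝ) ^ (-(c₂ : ℤ)) * ‖c * k 0 1 + 0 * k 1 1‖ := by
        rw [zero_mul, zero_mul, add_zero, add_zero, norm_mul, k00, mul_one]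
        exact aux _ _ hc' (hmul_le c)
      rw [ramifiedRow, ramifiedRow, if_neg h0, if_neg h0', mul_zero]
  have hd' := norm_pos_iff.2 hd
  by_cases h : ‖c‖ = (p : ℝ) ^ (-(c₂ : ℤ)) * ‖d‖
  · have hc' : 0 < ‖c‖ := h ▸ mul_pos (zpow_prime_pos _) hd'
    have hc := norm_pos_iff.1 hc'
    have hu : ‖d / c * k 1 0‖ ≤ (p : ℝ) ^ (-(c₁ : ℤ)) := by
      rw [norm_mul, norm_div, h]
      have : ‖d‖ / ((p : ℝ) ^ (-(c₂ : ℤ)) * ‖d‖) = ((p : ℝ) ^ (-(c₂ : ℤ)))⁻¹ := by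
        field_simp
      rw [this, inv_mul_le_iff₀ (zpow_prime_pos _), mul_comm, ← hsplit]
      exact h10
    have hv : ‖c / d * k 0 1‖ ≤ (p : ℝ) ^ (-(c₂ : ℤ)) := by
      rw [norm_mul, norm_div, h, mul_div_cancel_right₀ _ hd'.ne']
      exact mul_le_of_le_one_right (zpow_prime_pos _).le (hk 0 1)
    have e1 : c * k 0 0 + d * k 1 0 = c * (k 0 0 + d / c * k 1 0) := by field_simp
    have e2 : c * k 0 1 + d * k 1 1 = d * (k 1 1 + c / d * k 0 1) := by field_simp; ring
    have n1 : ‖k 0 0 + d / c * k 1 0‖ = 1 := by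
      rw [norm_add_eq_left, k00]
      rw [k00]
      exact hu.trans_lt hlt1
    have n2 : ‖k 1 1 + c / d * k 0 1‖ = 1 := by
      rw [norm_add_eq_left, k11]
      rw [k11]
      exact hv.trans_lt hlt2
    have hu0 : k 0 0 + d / c * k 1 0 ≠ 0 := norm_ne_zero_iff.1 (by rw [n1]; exact one_ne_zero)
    have q1 : charExt χ₁ (gdet k / (k 0 0 + d / c * k 1 0)) = 1 := by
      refine charExt_eq_one le_rfl (by rw [norm_div, n1, div_one]; exact hdet) ?_
      rw [div_sub_one hu0, norm_div, n1, div_one, gdet_eq]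
      have : k 0 0 * k 1 1 - k 0 1 * k 1 0 - (k 0 0 + d / c * k 1 0) =
        k 0 0 * (k 1 1 - 1) - k 0 1 * k 1 0 - d / c * k 1 0 := by ring
      rw [this]
      have hle : (p : ℝ) ^ (-((c₁ + c₂ : ℕ) : ℤ)) ≤ (p : ℝ) ^ (-(c₁ : ℤ)) := by
        rw [zpow_prime_le_iff]
        omega
      refine norm_sub_le_of_le (norm_sub_le_of_le ?_ ?_) hu
      · rw [norm_mul, k00, one_mul]
        exact h11.trans hle
      · rw [norm_mul]
        exact (mul_le_of_le_one_left (norm_nonneg _) (hk 0 1)).trans (h10.trans hle)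
    have q2 : charExt χ₂ (k 1 1 + c / d * k 0 1) = 1 := by
      refine charExt_eq_one le_rfl n2 ?_
      rw [add_sub_right_comm]
      refine norm_add_le_of_le (h11.trans ?_) hv
      rw [zpow_prime_le_iff]
      omega
    rw [map_div₀] at q1
    rw [ramifiedRow, ramifiedRow, if_pos h, if_pos, e1, e2, map_mul, map_mul, q2, norm_mul, n2,
      mul_one, mul_one, mul_inv, ← mul_one ((charExt χ₁ c)⁻¹ * charExt χ₂ d), ← q1]
    · ring
    · rw [e1, e2, norm_mul, norm_mul, n1, n2, mul_one, mul_one, h]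
  -- The complement of the support is stable too. If `‖c‖ ≥ ‖d‖`, the first new entry has norm `‖c‖`
  -- and the second is no larger. If `‖c‖ < ‖d‖`, the second keeps the norm `‖d‖`, and `d * k 1 0`
  -- is too small to bring the first to the norm `p ^ (-c₂) ‖d‖`.
  · rw [ramifiedRow, ramifiedRow, if_neg h, if_neg, mul_zero]
    intro h'
    rcases lt_or_ge ‖d‖ ‖c‖ with hcd | hcd
    · have hc : c ≠ 0 := norm_pos_iff.1 (hd'.trans hcd)
      have a1 : ‖c * k 0 0 + d * k 1 0‖ = ‖c‖ := by
        rw [norm_add_eq_left, norm_mul, k00, mul_one]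
        rw [norm_mul, norm_mul, k00, mul_one]
        exact (mul_le_of_le_one_right (norm_nonneg _) (hk 1 0)).trans_lt hcd
      have a2 : ‖c * k 0 1 + d * k 1 1‖ ≤ ‖c‖ :=
        norm_add_le_of_le (hmul_le c) (by rw [norm_mul, k11, mul_one]; exact hcd.le)
      rw [a1] at h'
      exact aux _ _ (norm_pos_iff.2 hc) a2 h'
    · rcases eq_or_lt_of_le hcd with hcd | hcd
      · have hc : c ≠ 0 := norm_pos_iff.1 (hcd ▸ hd')
        have a1 : ‖c * k 0 0 + d * k 1 0‖ = ‖c‖ := by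
          rw [norm_add_eq_left, norm_mul, k00, mul_one]
          rw [norm_mul, norm_mul, k00, mul_one, hcd]
          exact mul_lt_of_lt_one_right hd' (h10.trans_lt hlt)
        have a2 : ‖c * k 0 1 + d * k 1 1‖ ≤ ‖c‖ :=
          norm_add_le_of_le (hmul_le c) (by rw [norm_mul, k11, mul_one]; exact hcd.ge)
        rw [a1] at h'
        exact aux _ _ (norm_pos_iff.2 hc) a2 h'
      · have a2 : ‖c * k 0 1 + d * k 1 1‖ = ‖d‖ := by
          rw [add_comm, norm_add_eq_left, norm_mul, k11, mul_one]
          rw [norm_mul d, k11, mul_one]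
          exact (hmul_le c).trans_lt hcd
        rw [a2] at h'
        apply h
        have a3 : c * k 0 0 = (c * k 0 0 + d * k 1 0) - d * k 1 0 := by ring
        have a4 := hmul_lt d hd
        rw [← h', ← norm_neg (d * k 1 0)] at a4
        have a5 := norm_add_eq_left a4
        rw [← sub_eq_add_neg, ← a3, norm_mul, k00, mul_one] at a5
        rw [a5, h']

/-- The newvector for two ramified characters. -/
noncomputable def ramifiedFun (χ₁ χ₂ : UnitaryChar p) : G p → ℂ :=
  rowFun χ₁ (ramifiedRow χ₁ χ₂)

theorem ramifiedFun_mul {χ₁ χ₂ : UnitaryChar p} (h1 : 1 ≤ charConductorExponent χ₁)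
    (h2 : 1 ≤ charConductorExponent χ₂) {k : G p}
    (hk : k ∈ K1 p (charConductorExponent χ₁ + charConductorExponent χ₂)) (g : G p) :
    ramifiedFun χ₁ χ₂ (g * k) = ramifiedFun χ₁ χ₂ g := by
  rw [ramifiedFun, rowFun_mul g k hk.2.1, ramifiedRow_mul h1 h2 hk, rowFun]

theorem ramifiedFun_mem {χ₁ χ₂ : UnitaryChar p} (h1 : 1 ≤ charConductorExponent χ₁)
    (h2 : 1 ≤ charConductorExponent χ₂) : ramifiedFun χ₁ χ₂ ∈ principalSeriesSpace χ₁ χ₂ :=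
  rowFun_mem (ramifiedRow_homogeneous _ _) (K1_mem_nhds _) fun _ hk g => ramifiedFun_mul h1 h2 hk g

end LocalWhittaker

namespace LocalWhittaker

variable {p : ℕ} [Fact p.Prime] {χ₁ χ₂ : UnitaryChar p}

/-! ### Vectors fixed by `K₁(p ^ n)` in the principal series -/

theorem principalSeries_apply (g x : G p) (f : principalSeriesSpace χ₁ χ₂) :
    (principalSeries χ₁ χ₂ g f).1 x = f.1 (x * g) := rfl

theorem isK1Fixed_iff {n : ℕ} {f : principalSeriesSpace χ₁ χ₂} :
    IsK1Fixed (principalSeries χ₁ χ₂) n f ↔ ∀ k ∈ K1 p n, ∀ g, f.1 (g * k) = f.1 g :=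
  forall₂_congr fun _ _ => Subtype.ext_iff.trans funext_iff

theorem apply_upper_mul (f : principalSeriesSpace χ₁ χ₂) (a d : ℚ_[p]ˣ) (b : ℚ_[p]) (g : G p) :
    f.1 (upper a b d * g) =
      (χ₁ a : ℂ) * (χ₂ d : ℂ) * (Real.sqrt ‖(a : ℚ_[p]) / (d : ℚ_[p])‖ : ℂ) * f.1 g :=
  f.2.2 a d b g

theorem principalSeries_ext {f f' : principalSeriesSpace χ₁ χ₂}
    (h : ∀ t : ℚ_[p], ‖t‖ ≤ 1 → f.1 (weyl p * unip t) = f'.1 (weyl p * unip t))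
    (h' : ∀ z : ℚ_[p], ‖z‖ < 1 → f.1 (lower z) = f'.1 (lower z)) : f = f' := by
  refine Subtype.ext (funext fun g => ?_)
  rcases eq_upper_mul_weyl_or_lower g with ⟨a, b, d, t, ht, rfl⟩ | ⟨a, b, d, z, hz, rfl⟩
  · rw [apply_upper_mul, apply_upper_mul, h t ht]
  · rw [apply_upper_mul, apply_upper_mul, h' z hz]

theorem upper_mem_K1 {n : ℕ} {a d : ℚ_[p]ˣ} {b : ℚ_[p]} (ha : ‖(a : ℚ_[p])‖ = 1) (hb : ‖b‖ ≤ 1)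
    (hd : ‖(d : ℚ_[p])‖ = 1) (hd1 : ‖(d : ℚ_[p]) - 1‖ ≤ (p : ℝ) ^ (-(n : ℤ))) :
    upper a b d ∈ K1 p n := by
  refine ⟨fun i j => ?_, ?_, ?_, ?_⟩
  · fin_cases i <;> fin_cases j <;> simp [coe_upper, ha, hb, hd]
  · simp [coe_upper, ha, hd]
  · simp [coe_upper]
  · simpa [coe_upper] using hd1

theorem upper_mul_lower_mem_K1 {n : ℕ} {a : ℚ_[p]ˣ} {z : ℚ_[p]} (ha : ‖(a : ℚ_[p])‖ = 1)
    (hz : ‖z‖ ≤ (p : ℝ) ^ (-(n : ℤ))) : upper a 0 1 * lower z ∈ K1 p n := by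
  have hz1 := hz.trans (neg_zpow_le_one n)
  refine ⟨fun i j => ?_, ?_, ?_, ?_⟩
  · fin_cases i <;> fin_cases j <;> simp [mul_entry, coe_upper, coe_lower, ha, hz1]
  · change ‖gdet _‖ = 1
    rw [gdet_mul, gdet_upper, gdet_lower]
    simp [ha]
  · simpa [mul_entry, coe_upper, coe_lower] using hz
  · simp [mul_entry, coe_upper, coe_lower]

theorem upper_one_one : upper 1 (0 : ℚ_[p]) 1 = 1 := unip_zero

theorem lower_mem_K1 {n : ℕ} {z : ℚ_[p]} (hz : ‖z‖ ≤ (p : ℝ) ^ (-(n : ℤ))) : lower z ∈ K1 p n := by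
  simpa [upper_one_one] using upper_mul_lower_mem_K1 (a := 1) (by simp) hz

/-- The support criterion: a fixed vector can be nonzero at `γ` only if the inducing character is
trivial on the part of the Borel subgroup that lies in `γ K₁ γ⁻¹`. The modulus factor disappears
because `a` and `d` are units. -/
theorem apply_mul_apply_eq_one {n : ℕ} {f : principalSeriesSpace χ₁ χ₂}
    (hf : IsK1Fixed (principalSeries χ₁ χ₂) n f) {γ k : G p} (hγ : f.1 γ ≠ 0) {a d : ℚ_[p]ˣ}
    {b : ℚ_[p]} (ha : ‖(a : ℚ_[p])‖ = 1) (hd : ‖(d : ℚ_[p])‖ = 1) (hk : k ∈ K1 p n)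
    (h : upper a b d * γ = γ * k) : χ₁ a * χ₂ d = 1 := by
  have h1 := apply_upper_mul f a d b γ
  rw [h, isK1Fixed_iff.1 hf k hk, norm_div, ha, hd, div_one, Real.sqrt_one, Complex.ofReal_one,
    mul_one] at h1
  exact Circle.ext (by simpa using (mul_eq_right₀ hγ).1 h1.symm)

theorem apply_weyl_mul_unip {n : ℕ} {f : principalSeriesSpace χ₁ χ₂}
    (hf : IsK1Fixed (principalSeries χ₁ χ₂) n f) {t : ℚ_[p]} (ht : ‖t‖ ≤ 1) :
    f.1 (weyl p * unip t) = f.1 (weyl p) :=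
  isK1Fixed_iff.1 hf _ (upper_mem_K1 (by simp) ht (by simp) (by simp)) _

theorem apply_lower {n : ℕ} {f : principalSeriesSpace χ₁ χ₂}
    (hf : IsK1Fixed (principalSeries χ₁ χ₂) n f) {z : ℚ_[p]} (hz : ‖z‖ ≤ (p : ℝ) ^ (-(n : ℤ))) :
    f.1 (lower z) = f.1 1 := by
  simpa using isK1Fixed_iff.1 hf _ (lower_mem_K1 hz) 1

theorem conductors_of_apply_weyl {n : ℕ} {f : principalSeriesSpace χ₁ χ₂}
    (hf : IsK1Fixed (principalSeries χ₁ χ₂) n f) (h : f.1 (weyl p) ≠ 0) :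
    charConductorExponent χ₁ ≤ n ∧ charConductorExponent χ₂ = 0 := by
  have key : ∀ a d : ℚ_[p]ˣ, upper d (0 : ℚ_[p]) a * weyl p = weyl p * upper a 0 d := fun a d => by
    apply gl_ext <;> simp [mul_entry, coe_upper, coe_weyl]
  constructor
  · refine charConductorExponent_le fun u hu hu1 => ?_
    have := apply_mul_apply_eq_one hf h hu (d := 1) (by simp)
      (upper_mem_K1 (by simp) (by simp) hu hu1) (key 1 u)
    simpa using this
  · refine Nat.le_zero.1 (charConductorExponent_le fun u hu _ => ?_)
    have := apply_mul_apply_eq_one hf h (a := 1) (by simp) hu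
      (upper_mem_K1 hu (by simp) (by simp) (by simp)) (key u 1)
    simpa using this

theorem conductors_of_apply_one {n : ℕ} {f : principalSeriesSpace χ₁ χ₂}
    (hf : IsK1Fixed (principalSeries χ₁ χ₂) n f) (h : f.1 1 ≠ 0) :
    charConductorExponent χ₁ = 0 ∧ charConductorExponent χ₂ ≤ n := by
  constructor
  · refine Nat.le_zero.1 (charConductorExponent_le fun u hu _ => ?_)
    have := apply_mul_apply_eq_one hf h hu (d := 1) (b := 0) (by simp)
      (upper_mem_K1 hu (b := 0) (d := 1) (by simp) (by simp) (by simp))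
      (by rw [mul_one, one_mul])
    simpa using this
  · refine charConductorExponent_le fun u hu hu1 => ?_
    have := apply_mul_apply_eq_one hf h (a := 1) (b := 0) (by simp) hu
      (upper_mem_K1 (a := 1) (b := 0) (by simp) (by simp) hu hu1) (by rw [mul_one, one_mul])
    simpa using this

/-- Two families of elements of the Borel subgroup test the characters separately. Moving `diag(u,
1)` past `lower z` creates the lower left entry `z (1 - u)`, divisible by `p ^ n` for `u ≡ 1` modulo
`p ^ (n - j)`. Moving `(1 b; 0 u)` with `b = (u - 1) / z` past it gives `(u b; 0 1)`, integral for
`u ≡ 1` modulo `p ^ j`. -/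
theorem conductors_of_apply_lower {n j : ℕ} {f : principalSeriesSpace χ₁ χ₂}
    (hf : IsK1Fixed (principalSeries χ₁ χ₂) n f) {z : ℚ_[p]} (hz : ‖z‖ = (p : ℝ) ^ (-(j : ℤ)))
    (hj : j ≤ n) (h : f.1 (lower z) ≠ 0) :
    charConductorExponent χ₁ ≤ n - j ∧ charConductorExponent χ₂ ≤ j := by
  have hz0 : z ≠ 0 := norm_pos_iff.1 (hz ▸ zpow_prime_pos _)
  constructor
  · refine charConductorExponent_le fun u hu hu1 => ?_
    have := apply_mul_apply_eq_one hf h hu (d := 1) (b := 0) (by simp)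
      (upper_mul_lower_mem_K1 (z := z * (1 - (u : ℚ_[p]))) hu (by
        rw [norm_mul, hz, norm_sub_rev]
        calc _ ≤ (p : ℝ) ^ (-(j : ℤ)) * (p : ℝ) ^ (-((n - j : ℕ) : ℤ)) := by gcongr
          _ = _ := by
            rw [← zpow_add₀ prime_cast_pos.ne']
            congr 1
            omega)) (by
        apply gl_ext <;> simp [mul_entry, coe_upper, coe_lower]
        ring)
    simpa using this
  · refine charConductorExponent_le fun u hu hu1 => ?_
    have := apply_mul_apply_eq_one hf h (a := 1) (b := (u - 1) / z) (by simp) hu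
      (upper_mem_K1 (n := n) (a := u) (b := (u - 1) / z) (d := 1) hu (by
        rw [norm_div, hz]
        exact div_le_one_of_le₀ hu1 (zpow_prime_pos _).le) (by simp) (by simp)) (by
        apply gl_ext <;> simp [mul_entry, coe_upper, coe_lower, hz0]
        · field_simp
        · field_simp
          ring)
    simpa using this

theorem exists_norm_eq_neg_zpow {z : ℚ_[p]} (hz0 : z ≠ 0) (hz : ‖z‖ < 1) :
    ∃ j : ℕ, 1 ≤ j ∧ ‖z‖ = (p : ℝ) ^ (-(j : ℤ)) := by
  obtain ⟨k, hk⟩ := exists_norm_eq_zpow hz0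
  rw [hk, ← zpow_zero (p : ℝ), zpow_prime_lt_iff] at hz
  exact ⟨(-k).toNat, by omega, by rw [hk]; congr 1; omega⟩

/-- A value different from `f(1)` means that `z` is not divisible by `p ^ n`, so its valuation is
some `j < n`; this gives the strict bound for `c(χ₂)`. -/
theorem conductors_of_apply_lower_ne_zero {n : ℕ} {f : principalSeriesSpace χ₁ χ₂}
    (hf : IsK1Fixed (principalSeries χ₁ χ₂) n f) {z : ℚ_[p]} (hz : ‖z‖ < 1)
    (h : f.1 (lower z) ≠ 0) (h1 : f.1 (lower z) ≠ f.1 1) :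
    charConductorExponent χ₁ + charConductorExponent χ₂ ≤ n ∧ charConductorExponent χ₂ < n := by
  have hz0 : z ≠ 0 := by
    rintro rfl
    exact h1 (by rw [lower_zero])
  obtain ⟨j, -, hj⟩ := exists_norm_eq_neg_zpow hz0 hz
  have hjn : j < n := by
    by_contra! hjn
    exact h1 (apply_lower hf (by rw [hj, zpow_prime_le_iff]; omega))
  have := conductors_of_apply_lower hf hj hjn.le h
  omega

theorem conductors_le_of_isK1Fixed {n : ℕ} {f : principalSeriesSpace χ₁ χ₂} (hf0 : f ≠ 0)
    (hf : IsK1Fixed (principalSeries χ₁ χ₂) n f) :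
    charConductorExponent χ₁ + charConductorExponent χ₂ ≤ n := by
  by_contra! hn
  apply hf0
  have h1 : f.1 1 = 0 := by
    by_contra h
    have := conductors_of_apply_one hf h
    omega
  refine principalSeries_ext (fun t ht => ?_) fun z hz => ?_
  · rw [apply_weyl_mul_unip hf ht]
    by_contra h
    have := conductors_of_apply_weyl hf h
    omega
  · by_contra h
    have := conductors_of_apply_lower_ne_zero hf hz h (by rwa [h1])
    omega

/-- The vectors fixed by `K₁(p ^ c(χ₂))` are determined by their value
at `1`. -/
theorem eq_of_apply_one_eq {f f' : principalSeriesSpace χ₁ χ₂}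
    (hf : IsK1Fixed (principalSeries χ₁ χ₂) (charConductorExponent χ₂) f)
    (hf' : IsK1Fixed (principalSeries χ₁ χ₂) (charConductorExponent χ₂) f')
    (h : f.1 1 = f'.1 1) : f = f' := by
  have key : ∀ f : principalSeriesSpace χ₁ χ₂,
      IsK1Fixed (principalSeries χ₁ χ₂) (charConductorExponent χ₂) f →
      f.1 1 = 0 → f = 0 := fun f hf h => by
    refine principalSeries_ext (fun t ht => ?_) fun z hz => ?_
    · rw [apply_weyl_mul_unip hf ht]
      by_contra hw
      -- A nonzero value at `w` forces `χ₂` to be unramified. The level is then 0, so `w` itself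
      -- lies in `K₁(1)` and `f(w) = f(1) = 0`.
      have h2 := (conductors_of_apply_weyl hf hw).2
      apply hw
      change f.1 (weyl p) = 0
      rw [← h, ← isK1Fixed_iff.1 hf (weyl p) ?_ 1, one_mul]
      rw [h2]
      refine ⟨fun i j => ?_, ?_, ?_, ?_⟩
      · fin_cases i <;> fin_cases j <;> simp [coe_weyl]
      · simp [coe_weyl]
      · simp [coe_weyl]
      · simp [coe_weyl]
    · by_contra hz'
      have := conductors_of_apply_lower_ne_zero hf hz hz' (by rwa [h])
      omega
  refine sub_eq_zero.1 (key _ (fun k hk => ?_) (sub_eq_zero.2 h))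
  rw [map_sub, hf k hk, hf' k hk]

/-- The vectors fixed by `K₁(p ^ c(χ₁))` for ramified `χ₁` and unramified `χ₂` are determined by
their value at the Weyl element. -/
theorem eq_of_apply_weyl_eq (h1 : 1 ≤ charConductorExponent χ₁)
    {f f' : principalSeriesSpace χ₁ χ₂}
    (hf : IsK1Fixed (principalSeries χ₁ χ₂) (charConductorExponent χ₁) f)
    (hf' : IsK1Fixed (principalSeries χ₁ χ₂) (charConductorExponent χ₁) f')
    (h : f.1 (weyl p) = f'.1 (weyl p)) : f = f' := by
  have key : ∀ f : principalSeriesSpace χ₁ χ₂,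
      IsK1Fixed (principalSeries χ₁ χ₂) (charConductorExponent χ₁) f →
      f.1 (weyl p) = 0 → f = 0 := fun f hf h => by
    have h0 : f.1 1 = 0 := by
      by_contra h0
      have := conductors_of_apply_one hf h0
      omega
    refine principalSeries_ext (fun t ht => ?_) fun z hz => ?_
    · rw [apply_weyl_mul_unip hf ht]
      exact h
    · by_contra hz'
      change ¬ f.1 (lower z) = 0 at hz'
      rcases eq_or_ne z 0 with rfl | hz0
      · rw [lower_zero] at hz'
        exact hz' h0
      · obtain ⟨j, hj1, hj⟩ := exists_norm_eq_neg_zpow hz0 hz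
        have hjn : j ≤ charConductorExponent χ₁ := by
          by_contra! hjn
          exact hz' ((apply_lower hf (by rw [hj, zpow_prime_le_iff]; omega)).trans h0)
        -- The resulting bound `c(χ₁) ≤ c(χ₁) - j` contradicts `1 ≤ j ≤ c(χ₁)`.
        have := conductors_of_apply_lower hf hj hjn hz'
        omega
  refine sub_eq_zero.1 (key _ (fun k hk => ?_) (sub_eq_zero.2 h))
  rw [map_sub, hf k hk, hf' k hk]

variable (χ₁ χ₂) in
/-- `bigCellFun` as a vector of the principal series. -/
noncomputable def bigCellVec : principalSeriesSpace χ₁ χ₂ := ⟨_, bigCellFun_mem χ₁ χ₂⟩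

theorem bigCellVec_apply (g : G p) :
    (bigCellVec χ₁ χ₂).1 g = rowFun χ₁ (bigCellRow (χ₂ * χ₁⁻¹)) g := rfl

theorem isK1Fixed_bigCellVec (h2 : IsUnramified χ₂) (h1 : 1 ≤ charConductorExponent χ₁) :
    IsK1Fixed (principalSeries χ₁ χ₂) (charConductorExponent χ₁) (bigCellVec χ₁ χ₂) :=
  isK1Fixed_iff.2 fun _ hk g => bigCellFun_K1_fixed h2 h1 hk g

theorem isK1Fixed_atkinLehner_bigCellVec (h1 : IsUnramified χ₁)
    (h2 : 1 ≤ charConductorExponent χ₂) :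
    IsK1Fixed (principalSeries χ₁ χ₂) (charConductorExponent χ₂)
      (principalSeries χ₁ χ₂ (atkinLehner p (charConductorExponent χ₂)) (bigCellVec χ₁ χ₂)) :=
  isK1Fixed_iff.2 fun _ hk g => bigCellFun_atkinLehner_K1_fixed h1 h2 hk g

theorem rowFun_ne_zero {χ : UnitaryChar p} {Q : ℚ_[p] → ℚ_[p] → ℂ} {g : G p}
    (h : Q (g 1 0) (g 1 1) ≠ 0) : rowFun χ Q g ≠ 0 := by
  have h0 := gdet_ne_zero g
  refine mul_ne_zero (mul_ne_zero (charExt_ne_zero _ h0) ?_) h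
  exact_mod_cast (Real.sqrt_pos.2 (norm_pos_iff.2 h0)).ne'

theorem bigCellVec_weyl_ne_zero : (bigCellVec χ₁ χ₂).1 (weyl p) ≠ 0 :=
  rowFun_ne_zero (by simp [bigCellRow, coe_weyl])

theorem bigCellVec_atkinLehner_ne_zero (n : ℕ) :
    (principalSeries χ₁ χ₂ (atkinLehner p n) (bigCellVec χ₁ χ₂)).1 1 ≠ 0 := by
  rw [principalSeries_apply, one_mul]
  refine rowFun_ne_zero ?_
  simp only [coe_atkinLehner, bigCellRow]
  simpa using fun h => absurd h (Fact.out : p.Prime).ne_zero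

theorem sphericalFun_one : sphericalFun χ₁ χ₂ 1 = 1 := by
  simp [sphericalFun, rowFun, sphericalRow, gdet, zero_lt_one.not_ge]

/-- There is one explicit vector for each ramification type: the spherical vector, the Atkin-Lehner
translate of the big cell vector, the big cell vector itself, and `ramifiedFun`. -/
theorem exists_isK1Fixed (χ₁ χ₂ : UnitaryChar p) : ∃ f : principalSeriesSpace χ₁ χ₂, f ≠ 0 ∧
    IsK1Fixed (principalSeries χ₁ χ₂) (charConductorExponent χ₁ + charConductorExponent χ₂) f := by
  have ne_of : ∀ (f : principalSeriesSpace χ₁ χ₂) (g : G p), f.1 g ≠ 0 → f ≠ 0 :=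
    fun f g h hf => h (by rw [hf]; rfl)
  rcases Nat.eq_zero_or_pos (charConductorExponent χ₁) with h1 | h1 <;>
    rcases Nat.eq_zero_or_pos (charConductorExponent χ₂) with h2 | h2
  · have h1' := isUnramified_iff.2 h1
    have h2' := isUnramified_iff.2 h2
    refine ⟨⟨_, sphericalFun_mem h1' h2'⟩, ne_of _ 1 ?_, isK1Fixed_iff.2 fun k hk g =>
      sphericalFun_mul h1' h2' hk.1 hk.2.1 g⟩
    change sphericalFun χ₁ χ₂ 1 ≠ 0
    rw [sphericalFun_one]
    exact one_ne_zero
  · rw [h1, zero_add]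
    exact ⟨_, ne_of _ 1 (bigCellVec_atkinLehner_ne_zero _),
      isK1Fixed_atkinLehner_bigCellVec (isUnramified_iff.2 h1) h2⟩
  · rw [h2, add_zero]
    exact ⟨_, ne_of _ _ bigCellVec_weyl_ne_zero,
      isK1Fixed_bigCellVec (isUnramified_iff.2 h2) h1⟩
  · refine ⟨⟨_, ramifiedFun_mem h1 h2⟩,
      ne_of _ (lower ((p : ℚ_[p]) ^ charConductorExponent χ₂)) ?_,
      isK1Fixed_iff.2 fun k hk g => ramifiedFun_mul h1 h2 hk g⟩
    refine rowFun_ne_zero ?_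
    rw [ramifiedRow, if_pos (by simp [coe_lower])]
    refine mul_ne_zero (mul_ne_zero (inv_ne_zero (charExt_ne_zero _ ?_)) (charExt_ne_zero _ ?_)) ?_
    · simpa [coe_lower] using fun h => absurd h (Fact.out : p.Prime).ne_zero
    · simp [coe_lower]
    · simp [coe_lower]

theorem conductorExponent_principalSeries (χ₁ χ₂ : UnitaryChar p) :
    conductorExponent (principalSeries χ₁ χ₂) =
      charConductorExponent χ₁ + charConductorExponent χ₂ := by
  apply le_antisymm
  · exact Nat.sInf_le (exists_isK1Fixed χ₁ χ₂)
  · exact le_csInf ⟨_, exists_isK1Fixed χ₁ χ₂⟩ fun n ⟨f, hf0, hf⟩ =>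
      conductors_le_of_isK1Fixed hf0 hf

/-! ### Twist-minimality -/

/-- Multiplication by `η(det g)⁻¹` carries `χ₁η ⊞ χ₂η` to the twist and preserves invariance under
`K₁`, so a fixed vector of the former can be transported. -/
theorem conductorExponent_twist_le (η χ₁ χ₂ : UnitaryChar p) :
    conductorExponent (twist η (principalSeries χ₁ χ₂)) ≤
      charConductorExponent (χ₁ * η) + charConductorExponent (χ₂ * η) := by
  obtain ⟨f, hf0, hf⟩ := exists_isK1Fixed (χ₁ * η) (χ₂ * η)
  have hmem : (fun g => (charExt η (gdet g))⁻¹ * f.1 g) ∈ principalSeriesSpace χ₁ χ₂ := by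
    have key : ∀ k : G p, ‖gdet k - 1‖ ≤ (p : ℝ) ^ (-(charConductorExponent η + 1 : ℕ) : ℤ) →
        charExt η (gdet k) = 1 := fun k hk =>
      charExt_eq_one (Nat.le_succ _) (norm_eq_one_of_sub_one_lt
        (hk.trans_lt (neg_zpow_lt_one (by omega)))) hk
    obtain ⟨U, hU, h⟩ := f.2.1
    refine ⟨⟨U ∩ {k | ‖gdet k - 1‖ ≤ (p : ℝ) ^ (-(charConductorExponent η + 1 : ℕ) : ℤ)},
      inter_mem hU ?_, fun k hk g => ?_⟩, fun a d b g => ?_⟩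
    · have h1 : Tendsto (fun k : G p => gdet k) (𝓝 1) (𝓝 (gdet 1)) :=
        (Units.continuous_val.matrix_det.tendsto 1)
      rw [show gdet (1 : G p) = 1 by simp [gdet]] at h1
      filter_upwards [h1.eventually (closedBall_mem_nhds _ (zpow_prime_pos (p := p) _))] with k hk
      rwa [← dist_eq_norm]
    · simp only
      rw [gdet_mul, map_mul, key k hk.2, mul_one, h k hk.1]
    · simp only
      have ha := charExt_ne_zero η a.ne_zero
      have hd := charExt_ne_zero η d.ne_zero
      rw [apply_upper_mul, gdet_mul, gdet_upper, map_mul, map_mul, ContinuousMonoidHom.mul_apply,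
        ContinuousMonoidHom.mul_apply, Circle.coe_mul, Circle.coe_mul, ← charExt_units η,
        ← charExt_units η]
      field_simp
  refine Nat.sInf_le ⟨⟨_, hmem⟩, ?_, fun k hk => Subtype.ext (funext fun g => ?_)⟩
  · intro h
    apply hf0
    refine Subtype.ext (funext fun g => ?_)
    have := congrFun (congrArg Subtype.val h) g
    exact (mul_eq_zero.1 this).resolve_left (inv_ne_zero (charExt_ne_zero _ (gdet_ne_zero g)))
  · change (η (Matrix.GeneralLinearGroup.det k) : ℂ) * ((charExt η (gdet (g * k)))⁻¹ * f.1 (g * k)) =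
      (charExt η (gdet g))⁻¹ * f.1 g
    have h1 : (η (Matrix.GeneralLinearGroup.det k) : ℂ) = charExt η (gdet k) :=
      (charExt_units η _).symm
    have h2 := charExt_ne_zero η (gdet_ne_zero k)
    rw [isK1Fixed_iff.1 hf k hk, h1, gdet_mul, map_mul]
    field_simp

/-- The twist by `χ₁⁻¹` has conductor exponent at most `c(χ₂ χ₁⁻¹) ≤ max(c(χ₁), c(χ₂))`. Minimality
then gives `c(χ₁) + c(χ₂) ≤ max(c(χ₁), c(χ₂))`, so one of the two is zero. -/
theorem isUnramified_or_of_isTwistMinimal (h : IsTwistMinimal (principalSeries χ₁ χ₂)) :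
    IsUnramified χ₁ ∨ IsUnramified χ₂ := by
  have h1 := (h χ₁⁻¹).trans (conductorExponent_twist_le χ₁⁻¹ χ₁ χ₂)
  have h2 := charConductorExponent_mul_le χ₂ χ₁⁻¹
  have h3 : charConductorExponent (χ₁ * χ₁⁻¹) = 0 := by
    rw [mul_inv_cancel]
    exact isUnramified_iff.1 fun u _ => rfl
  rw [charConductorExponent_inv] at h2
  rw [conductorExponent_principalSeries, h3] at h1
  rw [isUnramified_iff, isUnramified_iff]
  omega

end LocalWhittaker

namespace LocalWhittaker

variable {p : ℕ} [Fact p.Prime] {χ₁ χ₂ : UnitaryChar p}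

/-! ### Restriction to the big cell -/

theorem unip_eq_weyl_mul_lower (x : ℚ_[p]) : unip x = weyl p * lower x * weyl p := by
  apply gl_ext <;> simp [mul_entry, coe_unip, coe_weyl, coe_lower]

theorem continuous_unip : Continuous (unip : ℚ_[p] → G p) := by
  have : (unip : ℚ_[p] → G p) = fun x => weyl p * lower x * weyl p :=
    funext unip_eq_weyl_mul_lower
  rw [this]
  exact (continuous_const.mul continuous_lower).mul continuous_const

/-- A vector of the principal series, as a function on the coordinate of the big cell. -/
noncomputable def cellFun (f : principalSeriesSpace χ₁ χ₂) (x : ℚ_[p]) : ℂ :=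
  f.1 (weyl p * unip x)

theorem cellFun_add (f f' : principalSeriesSpace χ₁ χ₂) (x : ℚ_[p]) :
    cellFun (f + f') x = cellFun f x + cellFun f' x := rfl

theorem cellFun_sub (f f' : principalSeriesSpace χ₁ χ₂) (x : ℚ_[p]) :
    cellFun (f - f') x = cellFun f x - cellFun f' x := rfl

theorem cellFun_smul (a : ℂ) (f : principalSeriesSpace χ₁ χ₂) (x : ℚ_[p]) :
    cellFun (a • f) x = a * cellFun f x := rfl

theorem cellFun_principalSeries (g : G p) (f : principalSeriesSpace χ₁ χ₂) (x : ℚ_[p]) :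
    cellFun (principalSeries χ₁ χ₂ g f) x = f.1 (weyl p * unip x * g) := rfl

theorem cellFun_unip (t : ℚ_[p]) (f : principalSeriesSpace χ₁ χ₂) (x : ℚ_[p]) :
    cellFun (principalSeries χ₁ χ₂ (unip t) f) x = cellFun f (x + t) := by
  rw [cellFun_principalSeries, cellFun, unip_add, mul_assoc]

theorem exists_cellFun_add_eq (f : principalSeriesSpace χ₁ χ₂) :
    ∃ m : ℕ, ∀ x v : ℚ_[p], ‖v‖ ≤ (p : ℝ) ^ (-(m : ℤ)) → cellFun f (x + v) = cellFun f x := by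
  obtain ⟨U, hU, h⟩ := f.2.1
  have h1 : unip ⁻¹' U ∈ 𝓝 (0 : ℚ_[p]) :=
    continuous_unip.continuousAt.preimage_mem_nhds (by rwa [unip_zero])
  obtain ⟨ε, hε, h1⟩ := Metric.mem_nhds_iff.1 h1
  obtain ⟨m, hm⟩ := exists_pow_lt_of_lt_one hε (inv_lt_one_of_one_lt₀ (one_lt_prime_cast (p := p)))
  refine ⟨m, fun x v hv => ?_⟩
  rw [cellFun, unip_add, ← mul_assoc]
  refine h _ (h1 ?_) _
  rw [mem_ball, dist_zero_right]
  refine hv.trans_lt ?_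
  rwa [zpow_neg, zpow_natCast, ← inv_pow]

theorem continuous_cellFun (f : principalSeriesSpace χ₁ χ₂) : Continuous (cellFun f) := by
  obtain ⟨m, hm⟩ := exists_cellFun_add_eq f
  refine continuous_iff_continuousAt.2 fun x => ?_
  refine (continuousAt_const (y := cellFun f x)).congr ?_
  filter_upwards [closedBall_mem_nhds x (zpow_prime_pos (p := p) (-(m : ℤ)))] with y hy
  rw [mem_closedBall, dist_eq_norm] at hy
  rw [← hm x _ hy, add_sub_cancel]

/-- By `weyl_mul_unip` the value at `x` is governed by `f(lower x⁻¹)`, which equals `f(1)` once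
`lower x⁻¹` enters the stabilizer of `f`. Consequently `f(1) = 0` means compact support on the big
cell. -/
theorem exists_cellFun_eq (f : principalSeriesSpace χ₁ χ₂) : ∃ N : ℤ, ∀ x : ℚ_[p],
    (p : ℝ) ^ N < ‖x‖ →
      cellFun f x = charExt χ₁ (-x⁻¹) * charExt χ₂ x * (‖x‖ : ℂ)⁻¹ * f.1 1 := by
  obtain ⟨U, hU, h⟩ := f.2.1
  have h1 : lower ⁻¹' U ∈ 𝓝 (0 : ℚ_[p]) :=
    continuous_lower.continuousAt.preimage_mem_nhds (by rwa [lower_zero])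
  obtain ⟨ε, hε, h1⟩ := Metric.mem_nhds_iff.1 h1
  obtain ⟨m, hm⟩ := exists_pow_lt_of_lt_one hε (inv_lt_one_of_one_lt₀ (one_lt_prime_cast (p := p)))
  refine ⟨m, fun x hx => ?_⟩
  have hx0 : x ≠ 0 := norm_pos_iff.1 ((zpow_prime_pos _).trans hx)
  have h2 : f.1 (lower x⁻¹) = f.1 1 := by
    rw [← h (lower x⁻¹) (h1 ?_) 1, one_mul]
    rw [mem_ball, dist_zero_right, norm_inv]
    refine lt_trans (inv_strictAnti₀ (zpow_prime_pos _) hx) ?_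
    rwa [zpow_natCast, ← inv_pow]
  have h3 : Real.sqrt (‖x‖⁻¹ / ‖x‖) = ‖x‖⁻¹ := by
    rw [div_eq_mul_inv, Real.sqrt_mul_self (by positivity)]
  rw [cellFun, weyl_mul_unip hx0, apply_upper_mul, h2, ← charExt_units, ← charExt_units]
  simp only [Units.val_neg, Units.val_inv_eq_inv_val, Units.val_mk0, norm_div, norm_neg, norm_inv,
    h3, Complex.ofReal_inv]

theorem apply_unip (f : principalSeriesSpace χ₁ χ₂) (x : ℚ_[p]) : f.1 (unip x) = f.1 1 := by
  have := apply_upper_mul f 1 1 x 1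
  simpa [unip] using this

/-- The partial integrals that define the Whittaker functional. -/
noncomputable def cellIntegral (ψ : AddChar ℚ_[p] Circle) (f : principalSeriesSpace χ₁ χ₂)
    (n : ℤ) : ℂ :=
  ∫ x in closedBall (0 : ℚ_[p]) ((p : ℝ) ^ n), cellFun f x * ψ (-x)

section Functional

variable {ψ : AddChar ℚ_[p] Circle}

theorem continuous_cellFun_mul (hψ : IsUnramifiedAdd ψ) (f : principalSeriesSpace χ₁ χ₂) :
    Continuous fun x => cellFun f x * (ψ (-x) : ℂ) :=
  (continuous_cellFun f).mul (continuous_subtype_val.comp (hψ.1.comp continuous_neg))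

theorem integrableOn_cellFun_mul (hψ : IsUnramifiedAdd ψ) (f : principalSeriesSpace χ₁ χ₂) (r : ℝ) :
    IntegrableOn (fun x => cellFun f x * (ψ (-x) : ℂ)) (closedBall 0 r) :=
  (continuous_cellFun_mul hψ f).continuousOn.integrableOn_compact (isCompact_closedBall _ _)

theorem cellIntegral_add (hψ : IsUnramifiedAdd ψ) (f f' : principalSeriesSpace χ₁ χ₂) (n : ℤ) :
    cellIntegral ψ (f + f') n = cellIntegral ψ f n + cellIntegral ψ f' n := by
  simp only [cellIntegral, cellFun_add, add_mul]
  exact integral_add (integrableOn_cellFun_mul hψ f _) (integrableOn_cellFun_mul hψ f' _)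

theorem cellIntegral_smul (a : ℂ) (f : principalSeriesSpace χ₁ χ₂) (n : ℤ) :
    cellIntegral ψ (a • f) n = a * cellIntegral ψ f n := by
  simp only [cellIntegral, cellFun_smul, mul_assoc]
  exact integral_const_mul _ _

/-- The ball is a group containing `t`, so translation by `t` is a change of variable that preserves
the domain of integration. -/
theorem cellIntegral_unip (f : principalSeriesSpace χ₁ χ₂) {n : ℤ} {t : ℚ_[p]}
    (ht : ‖t‖ ≤ (p : ℝ) ^ n) :
    cellIntegral ψ (principalSeries χ₁ χ₂ (unip t) f) n = ψ t * cellIntegral ψ f n := by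
  rw [cellIntegral, cellIntegral, ← integral_closedBall_add (fun x => cellFun f x * (ψ (-x) : ℂ)) ht,
    ← integral_const_mul]
  congr 1 with x
  rw [cellFun_unip, neg_add, AddChar.map_add_eq_mul, Circle.coe_mul]
  have : (ψ t : ℂ) * ψ (-t) = 1 := by
    rw [← Circle.coe_mul, ← AddChar.map_add_eq_mul, add_neg_cancel, AddChar.map_zero_eq_one,
      Circle.coe_one]
  linear_combination (-(cellFun f (x + t) * (ψ (-x) : ℂ))) * this

theorem eventually_norm_le_zpow (x : ℚ_[p]) : ∀ᶠ n : ℤ in atTop, ‖x‖ ≤ (p : ℝ) ^ n := by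
  rcases eq_or_ne x 0 with rfl | hx
  · exact Eventually.of_forall fun n => by simpa using (zpow_prime_pos (p := p) n).le
  · obtain ⟨k, hk⟩ := exists_norm_eq_zpow hx
    filter_upwards [eventually_ge_atTop k] with n hn
    rwa [hk, zpow_prime_le_iff]

theorem cellIntegral_eq_of_apply_one (f : principalSeriesSpace χ₁ χ₂) (h1 : f.1 1 = 0) :
    ∃ N : ℤ, ∀ n, N ≤ n → cellIntegral ψ f n = ∫ x, cellFun f x * ψ (-x) := by
  obtain ⟨N, hN⟩ := exists_cellFun_eq f
  refine ⟨N, fun n hn => setIntegral_eq_integral_of_forall_compl_eq_zero fun x hx => ?_⟩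
  rw [mem_closedBall, dist_zero_right, not_le] at hx
  rw [hN x ((zpow_prime_le_iff.2 hn).trans_lt hx), h1]
  simp

/-- The value of the Whittaker functional, expressed by an integral with compact support. -/
noncomputable def whittakerValue (ψ : AddChar ℚ_[p] Circle) (x₀ : ℚ_[p])
    (f : principalSeriesSpace χ₁ χ₂) : ℂ :=
  ((ψ x₀ : ℂ) - 1)⁻¹ *
    ∫ x, cellFun (principalSeries χ₁ χ₂ (unip x₀) f - f) x * ψ (-x)

/-- The difference `n(x₀) f - f` vanishes at 1, so its truncated integrals are eventually constant.
They equal `ψ(x₀) - 1` times those of `f` as soon as the ball contains `x₀`; dividing by this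
nonzero number stabilises the integrals of `f`. -/
theorem eventually_whittakerValue_eq (hψ : IsUnramifiedAdd ψ) {x₀ : ℚ_[p]} (hx₀ : ψ x₀ ≠ 1)
    (f : principalSeriesSpace χ₁ χ₂) :
    ∀ᶠ n : ℤ in atTop, whittakerValue ψ x₀ f = cellIntegral ψ f n := by
  have h1 : (principalSeries χ₁ χ₂ (unip x₀) f - f).1 1 = 0 := by
    change f.1 (1 * unip x₀) - f.1 1 = 0
    rw [one_mul, apply_unip, sub_self]
  obtain ⟨N, hN⟩ := cellIntegral_eq_of_apply_one (ψ := ψ) _ h1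
  filter_upwards [eventually_ge_atTop N, eventually_norm_le_zpow x₀] with n hn hx
  have h2 : (ψ x₀ : ℂ) - 1 ≠ 0 := by
    rw [sub_ne_zero]
    exact fun h => hx₀ (Circle.ext (by simpa using h))
  have h3 : principalSeries χ₁ χ₂ (unip x₀) f - f =
      principalSeries χ₁ χ₂ (unip x₀) f + (-1 : ℂ) • f := by
    module
  rw [whittakerValue, ← hN n hn, h3, cellIntegral_add hψ,
    cellIntegral_smul, cellIntegral_unip f hx, inv_mul_eq_iff_eq_mul₀ h2]
  ring

/-- The Whittaker functional on a principal series. -/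
noncomputable def whittakerFunctional (hψ : IsUnramifiedAdd ψ) {x₀ : ℚ_[p]} (hx₀ : ψ x₀ ≠ 1)
    (χ₁ χ₂ : UnitaryChar p) : principalSeriesSpace χ₁ χ₂ →ₗ[ℂ] ℂ where
  toFun := whittakerValue ψ x₀
  map_add' f f' := by
    obtain ⟨n, h1, h2, h3⟩ := ((eventually_whittakerValue_eq hψ hx₀ f).and
      ((eventually_whittakerValue_eq hψ hx₀ f').and
        (eventually_whittakerValue_eq hψ hx₀ (f + f')))).exists
    rw [h1, h2, h3, cellIntegral_add hψ]
  map_smul' a f := by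
    obtain ⟨n, h1, h2⟩ := ((eventually_whittakerValue_eq hψ hx₀ f).and
      (eventually_whittakerValue_eq hψ hx₀ (a • f))).exists
    rw [h1, h2, cellIntegral_smul, RingHom.id_apply, smul_eq_mul]

variable (hψ : IsUnramifiedAdd ψ) {x₀ : ℚ_[p]} (hx₀ : ψ x₀ ≠ 1)

theorem eventually_whittakerFunctional_eq (f : principalSeriesSpace χ₁ χ₂) :
    ∀ᶠ n : ℤ in atTop, whittakerFunctional hψ hx₀ χ₁ χ₂ f = cellIntegral ψ f n :=
  eventually_whittakerValue_eq hψ hx₀ f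

theorem whittakerFunctional_unip (t : ℚ_[p]) (f : principalSeriesSpace χ₁ χ₂) :
    whittakerFunctional hψ hx₀ χ₁ χ₂ (principalSeries χ₁ χ₂ (unip t) f) =
      ψ t * whittakerFunctional hψ hx₀ χ₁ χ₂ f := by
  obtain ⟨n, h1, h2, h3⟩ := ((eventually_whittakerFunctional_eq hψ hx₀ f).and
    ((eventually_whittakerFunctional_eq hψ hx₀ (principalSeries χ₁ χ₂ (unip t) f)).and
      (eventually_norm_le_zpow t))).exists
  rw [h1, h2, cellIntegral_unip f h3]

/-! ### Injectivity of the Whittaker model -/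

/-- For large `x` one has `|f(1)| = ‖x‖ |f(w n(x))|`; if the second factor is constant, comparing
two radii forces it to vanish. -/
theorem norm_apply_eq_zero_of_cellFun_const (f : principalSeriesSpace χ₁ χ₂)
    (h : ∀ x, cellFun f x = cellFun f 0) : f.1 1 = 0 := by
  obtain ⟨N, hN⟩ := exists_cellFun_eq f
  have key : ∀ n : ℤ, N < n → ‖f.1 1‖ = (p : ℝ) ^ n * ‖cellFun f 0‖ := fun n hn => by
    have hx : ‖(p : ℚ_[p]) ^ (-n)‖ = (p : ℝ) ^ n := by rw [norm_prime_zpow, neg_neg]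
    have hx0 : (p : ℚ_[p]) ^ (-n) ≠ 0 := zpow_ne_zero _ prime_padic_ne_zero
    have h1 := hN _ (by rw [hx]; exact zpow_prime_lt_iff.2 hn)
    rw [h] at h1
    rw [h1, norm_mul, norm_mul, norm_mul, norm_charExt _ hx0,
      norm_charExt _ (neg_ne_zero.2 (inv_ne_zero hx0)), hx, norm_inv, Complex.norm_real,
      Real.norm_of_nonneg (zpow_prime_pos n).le, one_mul, one_mul, mul_inv_cancel_left₀ (zpow_prime_pos _).ne']
  have h1 := key (N + 1) (by omega)
  have h2 := key (N + 2) (by omega)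
  have h3 : ‖cellFun f 0‖ = 0 := by
    by_contra h3
    rw [h1, mul_left_inj' h3] at h2
    exact (zpow_prime_lt_iff.2 (by omega : N + 1 < N + 2)).ne h2
  rw [h3, mul_zero] at h1
  exact norm_eq_zero.1 h1

/-- A geometric sum of `p ^ N`-th roots of unity. The multiples `i + 1` run over `1, …, p ^ N`
rather than `0, …, p ^ N - 1`, so that every frequency is nonzero and can be reached by the torus.
-/
theorem sum_addChar (m : ℕ) (N : ℕ) (x : ℚ_[p]) (hψ : IsUnramifiedAdd ψ)
    (hx : ‖x‖ ≤ (p : ℝ) ^ (-(m : ℤ) + N)) :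
    ∑ i ∈ Finset.range (p ^ N), (ψ (-(((i + 1 : ℕ) : ℚ_[p]) * (p : ℚ_[p]) ^ (-(m : ℤ)) * x)) : ℂ) =
      if ‖x‖ ≤ (p : ℝ) ^ (-(m : ℤ)) then (p : ℂ) ^ N else 0 := by
  set y := -((p : ℚ_[p]) ^ (-(m : ℤ)) * x) with hy
  have h1 : ∀ i : ℕ, (ψ (-(((i + 1 : ℕ) : ℚ_[p]) * (p : ℚ_[p]) ^ (-(m : ℤ)) * x)) : ℂ) =
      (ψ y : ℂ) * (ψ y : ℂ) ^ i := fun i => by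
    rw [← pow_succ', ← Circle.coe_pow, ← AddChar.map_nsmul_eq_pow, hy, nsmul_eq_mul]
    congr 3
    ring
  simp_rw [h1]
  rw [← Finset.mul_sum]
  have hyn : ‖y‖ = (p : ℝ) ^ (m : ℤ) * ‖x‖ := by
    rw [hy, norm_neg, norm_mul, norm_prime_zpow, neg_neg]
  have h2 : ‖x‖ ≤ (p : ℝ) ^ (-(m : ℤ)) ↔ (ψ y : ℂ) = 1 := by
    rw [← Circle.coe_one, Circle.coe_inj, hψ.eq_one_iff, hyn, zpow_neg,
      mul_comm, ← le_div_iff₀ (zpow_prime_pos _), one_div]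
  simp_rw [h2]
  split_ifs with h
  · simp [h]
  · have h3 : (ψ y : ℂ) ^ p ^ N = 1 := by
      rw [← Circle.coe_pow, ← AddChar.map_nsmul_eq_pow, hψ.eq_one, Circle.coe_one]
      rw [nsmul_eq_mul, norm_mul, hyn, Nat.cast_pow, ← zpow_natCast, norm_prime_zpow]
      calc _ ≤ (p : ℝ) ^ (-(N : ℤ)) * ((p : ℝ) ^ (m : ℤ) * (p : ℝ) ^ (-(m : ℤ) + N)) := by
            gcongr
        _ = 1 := by
            rw [← zpow_add₀ prime_cast_pos.ne', ← zpow_add₀ prime_cast_pos.ne']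
            simp
    have h4 := mul_geom_sum (ψ y : ℂ) (p ^ N)
    rw [h3, sub_self] at h4
    rw [(mul_eq_zero.1 h4).resolve_left (sub_ne_zero.2 h), mul_zero]

theorem cellFun_upper (f : principalSeriesSpace χ₁ χ₂) (y : ℚ_[p]ˣ) (x : ℚ_[p]) :
    cellFun (principalSeries χ₁ χ₂ (upper y 0 1) f) x =
      (χ₂ y : ℂ) * (Real.sqrt ‖(y : ℚ_[p])⁻¹‖ : ℂ) * cellFun f (x / y) := by
  rw [cellFun_principalSeries, weyl_mul_unip_mul_upper, apply_upper_mul, cellFun]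
  simp

/-- Fourier inversion: translating by the torus shows that the Fourier transform of the compactly
supported `cellFun f` vanishes at every nonzero frequency. Summing over the finitely many
frequencies of `sum_addChar` isolates the integral over a ball around 0 on which `cellFun f` is
constant. -/
theorem cellFun_zero_of_whittaker_eq_zero (f : principalSeriesSpace χ₁ χ₂) (h1 : f.1 1 = 0)
    (h : ∀ g, whittakerFunctional hψ hx₀ χ₁ χ₂ (principalSeries χ₁ χ₂ g f) = 0) :
    cellFun f 0 = 0 := by
  obtain ⟨N₀, hN₀⟩ := exists_cellFun_eq f
  have hsupp : ∀ x, (p : ℝ) ^ N₀ < ‖x‖ → cellFun f x = 0 := fun x hx => by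
    rw [hN₀ x hx, h1, mul_zero]
  -- The functional at `diag(y, 1) f` becomes, after replacing `x` by `y x`, a nonzero multiple of
  -- the Fourier coefficient of `cellFun f` at `y`.
  have hint : ∀ y : ℚ_[p]ˣ, ∫ x, cellFun f x * (ψ (-(y * x)) : ℂ) = 0 := fun y => by
    have h2 : (principalSeries χ₁ χ₂ (upper y 0 1) f).1 1 = 0 := by
      rw [principalSeries_apply, one_mul, ← mul_one (upper y 0 1), apply_upper_mul, h1, mul_zero]
    obtain ⟨N, hN⟩ := cellIntegral_eq_of_apply_one (ψ := ψ) _ h2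
    obtain ⟨n, h3, h4⟩ := ((eventually_whittakerFunctional_eq hψ hx₀
      (principalSeries χ₁ χ₂ (upper y 0 1) f)).and (eventually_ge_atTop N)).exists
    rw [h, hN n h4] at h3
    have h5 := integral_comp_mul_left y.ne_zero
      (fun x => cellFun (principalSeries χ₁ χ₂ (upper y 0 1) f) x * (ψ (-x) : ℂ))
    rw [← h3, mul_zero] at h5
    simp_rw [cellFun_upper, mul_div_cancel_left₀ _ y.ne_zero, mul_assoc] at h5
    rw [integral_const_mul, integral_const_mul] at h5
    refine ((mul_eq_zero.1 ((mul_eq_zero.1 h5).resolve_left (Circle.coe_ne_zero _))).resolve_left ?_)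
    exact_mod_cast (Real.sqrt_pos.2 (norm_pos_iff.2 (inv_ne_zero y.ne_zero))).ne'
  obtain ⟨m, hm⟩ := exists_cellFun_add_eq f
  obtain ⟨N, hN⟩ : ∃ N : ℕ, N₀ ≤ -(m : ℤ) + N := ⟨(N₀ + m).toNat, by omega⟩
  have hp := prime_padic_ne_zero (p := p)
  have hsum : ∑ i ∈ Finset.range (p ^ N), ∫ x, cellFun f x *
      (ψ (-(((i + 1 : ℕ) : ℚ_[p]) * (p : ℚ_[p]) ^ (-(m : ℤ)) * x)) : ℂ) = 0 := by
    refine Finset.sum_eq_zero fun i _ => ?_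
    have h0 : ((i + 1 : ℕ) : ℚ_[p]) * (p : ℚ_[p]) ^ (-(m : ℤ)) ≠ 0 :=
      mul_ne_zero (by exact_mod_cast Nat.succ_ne_zero i) (zpow_ne_zero _ hp)
    exact hint (Units.mk0 _ h0)
  have hcs : HasCompactSupport (cellFun f) :=
    HasCompactSupport.intro (isCompact_closedBall 0 ((p : ℝ) ^ N₀)) fun x hx => hsupp x (by
      rwa [mem_closedBall, dist_zero_right, not_le] at hx)
  rw [← integral_finsetSum] at hsum
  · have h6 : ∀ x, ∑ i ∈ Finset.range (p ^ N), cellFun f x *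
        (ψ (-(((i + 1 : ℕ) : ℚ_[p]) * (p : ℚ_[p]) ^ (-(m : ℤ)) * x)) : ℂ) =
        (closedBall (0 : ℚ_[p]) ((p : ℝ) ^ (-(m : ℤ)))).indicator
          (fun _ => (p : ℂ) ^ N * cellFun f 0) x := fun x => by
      rw [← Finset.mul_sum]
      rcases le_or_gt ‖x‖ ((p : ℝ) ^ (-(m : ℤ) + N)) with hx | hx
      · rw [sum_addChar m N x hψ hx]
        split_ifs with hxm
        · rw [Set.indicator_of_mem (by rwa [mem_closedBall, dist_zero_right]), ← hm 0 x hxm,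
            zero_add, mul_comm]
        · rw [Set.indicator_of_notMem (by rwa [mem_closedBall, dist_zero_right]), mul_zero]
      · rw [hsupp x ((zpow_prime_le_iff.2 hN).trans_lt hx), zero_mul, Set.indicator_of_notMem]
        rw [mem_closedBall, dist_zero_right, not_le]
        exact (zpow_prime_le_iff.2 (by omega)).trans_lt hx
    simp_rw [h6] at hsum
    rw [integral_indicator measurableSet_closedBall, setIntegral_const,
      volume_real_closedBall_zpow, Complex.real_smul] at hsum
    have hpc : (p : ℂ) ≠ 0 := by exact_mod_cast (Fact.out : p.Prime).ne_zero
    refine (mul_eq_zero.1 ((mul_eq_zero.1 hsum).resolve_left ?_)).resolve_left (pow_ne_zero _ hpc)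
    exact_mod_cast (zpow_prime_pos (p := p) _).ne'
  · intro i _
    refine Continuous.integrable_of_hasCompactSupport ?_ hcs.mul_right
    exact (continuous_cellFun f).mul
      (continuous_subtype_val.comp (hψ.1.comp (by fun_prop)))

/-- The differences `n(x) f - f` vanish at 1, so the compactly supported case makes `cellFun f`
constant, and decay at infinity gives `f(1) = 0`. Applied to all translates of `f`, this gives `f =
0`. -/
theorem eq_zero_of_whittaker_eq_zero (f : principalSeriesSpace χ₁ χ₂)
    (h : ∀ g, whittakerFunctional hψ hx₀ χ₁ χ₂ (principalSeries χ₁ χ₂ g f) = 0) : f = 0 := by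
  have key : ∀ f : principalSeriesSpace χ₁ χ₂,
      (∀ g, whittakerFunctional hψ hx₀ χ₁ χ₂ (principalSeries χ₁ χ₂ g f) = 0) → f.1 1 = 0 := by
    intro f h
    refine norm_apply_eq_zero_of_cellFun_const f fun x => ?_
    have h1 : (principalSeries χ₁ χ₂ (unip x) f - f).1 1 = 0 := by
      change f.1 (1 * unip x) - f.1 1 = 0
      rw [one_mul, apply_unip, sub_self]
    have h2 := cellFun_zero_of_whittaker_eq_zero hψ hx₀ _ h1 fun g => by
      rw [map_sub, map_sub, h, sub_zero, ← Module.End.mul_apply, ← map_mul, h]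
    rwa [cellFun_sub, cellFun_unip, zero_add, sub_eq_zero] at h2
  refine Subtype.ext (funext fun g => ?_)
  have := key (principalSeries χ₁ χ₂ g f) fun g' => by
    rw [← Module.End.mul_apply, ← map_mul, h]
  rwa [principalSeries_apply, one_mul] at this

/-! ### Uniqueness of the Whittaker functional -/

/-- Only the Borel subgroup lies outside the big cell, and there the value is governed by `f(1)`,
which decay at infinity determines. -/
theorem eq_of_cellFun_eq {f f' : principalSeriesSpace χ₁ χ₂} (h : ∀ x, cellFun f x = cellFun f' x) :
    f = f' := by
  rw [← sub_eq_zero]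
  set e := f - f'
  have he : ∀ x, cellFun e x = 0 := fun x => by rw [cellFun_sub, h, sub_self]
  have h1 : e.1 1 = 0 := norm_apply_eq_zero_of_cellFun_const e fun x => by rw [he, he]
  refine principalSeries_ext (fun t _ => he t) fun z _ => ?_
  change e.1 (lower z) = 0
  rcases eq_or_ne z 0 with rfl | hz
  · rwa [lower_zero]
  · obtain ⟨a, b, d, hg⟩ := exists_upper_mul_weyl (g := lower z) (by simpa [coe_lower] using hz)
    rw [hg, apply_upper_mul]
    exact mul_eq_zero_of_right _ (he _)

theorem cellFun_sum {ι : Type*} (s : Finset ι) (f : ι → principalSeriesSpace χ₁ χ₂) (x : ℚ_[p]) :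
    cellFun (∑ i ∈ s, f i) x = ∑ i ∈ s, cellFun (f i) x := by
  let L : principalSeriesSpace χ₁ χ₂ →+ ℂ :=
    { toFun := fun f => cellFun f x
      map_zero' := rfl
      map_add' := fun f f' => cellFun_add f f' x }
  exact map_sum L f s

theorem cellFun_bigCellVec (x : ℚ_[p]) :
    cellFun (bigCellVec χ₁ χ₂) x = if ‖x‖ ≤ 1 then charExt χ₁ (-1) else 0 := by
  rw [cellFun, bigCellVec_apply, rowFun, gdet_mul, gdet_weyl, gdet_unip]
  simp [mul_entry, coe_weyl, coe_unip, bigCellRow]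

variable (χ₁ χ₂) in
/-- A vector supported on the ball of radius `p ^ (-m)` of the big cell. -/
noncomputable def smallBallVec (m : ℕ) : principalSeriesSpace χ₁ χ₂ :=
  principalSeries χ₁ χ₂ (upper (Units.mk0 ((p : ℚ_[p]) ^ m) (pow_ne_zero _ prime_padic_ne_zero)) 0 1)
    (bigCellVec χ₁ χ₂)

variable (χ₁ χ₂) in
theorem exists_cellFun_smallBallVec (m : ℕ) : ∃ A : ℂ, A ≠ 0 ∧ ∀ x,
    cellFun (smallBallVec χ₁ χ₂ m) x = if ‖x‖ ≤ (p : ℝ) ^ (-(m : ℤ)) then A else 0 := by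
  have h0 : (p : ℚ_[p]) ^ m ≠ 0 := pow_ne_zero _ prime_padic_ne_zero
  have h1 : ‖(p : ℚ_[p]) ^ m‖ = (p : ℝ) ^ (-(m : ℤ)) := by
    rw [← zpow_natCast, norm_prime_zpow]
  refine ⟨_, mul_ne_zero (mul_ne_zero (Circle.coe_ne_zero (χ₂ (Units.mk0 _ h0)))
    (b := (Real.sqrt ‖((p : ℚ_[p]) ^ m)⁻¹‖ : ℂ)) ?_)
      (charExt_ne_zero χ₁ (neg_ne_zero.2 one_ne_zero)), fun x => ?_⟩
  · exact_mod_cast (Real.sqrt_pos.2 (norm_pos_iff.2 (inv_ne_zero h0))).ne'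
  · have h2 : ‖x / (p : ℚ_[p]) ^ m‖ ≤ 1 ↔ ‖x‖ ≤ (p : ℝ) ^ (-(m : ℤ)) := by
      rw [norm_div, h1, div_le_one (zpow_prime_pos _)]
    rw [smallBallVec, cellFun_upper, cellFun_bigCellVec, Units.val_mk0]
    simp_rw [h2]
    split_ifs <;> simp

theorem eq_sum_smallBallVec (f : principalSeriesSpace χ₁ χ₂) (m N : ℕ)
    (hm : ∀ x v : ℚ_[p], ‖v‖ ≤ (p : ℝ) ^ (-(m : ℤ)) → cellFun f (x + v) = cellFun f x)
    (hN : ∀ x, (p : ℝ) ^ (-(m : ℤ) + N) < ‖x‖ → cellFun f x = 0) {A : ℂ} (hA : A ≠ 0)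
    (hA' : ∀ x, cellFun (smallBallVec χ₁ χ₂ m) x =
      if ‖x‖ ≤ (p : ℝ) ^ (-(m : ℤ)) then A else 0) :
    f = ∑ i ∈ Finset.range (p ^ N),
      (cellFun f (i * (p : ℚ_[p]) ^ (-(-(m : ℤ) + N))) / A) •
        principalSeries χ₁ χ₂ (unip (-(i * (p : ℚ_[p]) ^ (-(-(m : ℤ) + N)))))
          (smallBallVec χ₁ χ₂ m) := by
  refine eq_of_cellFun_eq fun x => ?_
  rw [cellFun_sum]
  simp_rw [cellFun_smul, cellFun_unip, hA', ← sub_eq_add_neg]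
  rcases le_or_gt ‖x‖ ((p : ℝ) ^ (-(m : ℤ) + N)) with hx | hx
  · obtain ⟨i, ⟨hi, hi'⟩, huniq⟩ := exists_unique_digits (-(m : ℤ)) N hx
    rw [Finset.sum_eq_single i]
    · rw [if_pos hi', div_mul_cancel₀ _ hA, ← hm (i * (p : ℚ_[p]) ^ (-(-(m : ℤ) + N))) _ hi', add_sub_cancel]
    · intro j hj hji
      rw [if_neg, mul_zero]
      exact fun h => hji (huniq j ⟨Finset.mem_range.1 hj, h⟩)
    · exact fun h => absurd (Finset.mem_range.2 hi) h
  · rw [hN x hx, Finset.sum_eq_zero]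
    intro i _
    rw [if_neg, mul_zero]
    intro h
    have h2 : ‖(i : ℚ_[p]) * (p : ℚ_[p]) ^ (-(-(m : ℤ) + N))‖ ≤ (p : ℝ) ^ (-(m : ℤ) + N) := by
      rw [norm_mul, norm_prime_zpow, neg_neg]
      exact mul_le_of_le_one_left (zpow_prime_pos _).le (Padic.norm_int_le_one i)
    have h3 := norm_add_le_of_le (h.trans (zpow_prime_le_iff.2 (by omega))) h2
    rw [sub_add_cancel] at h3
    exact hx.not_ge h3

/-- The indicator of `ℤ_p` is a sum of `p ^ m` integral translates of that of `p ^ m ℤ_p`. All these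
translates have the same value under `l` because `ψ` is trivial on `ℤ_p`, so `l` kills the smaller
indicators as well. They and their translates span the vectors with `f(1) = 0`, and `n(x₀) f - f`
with `ψ(x₀) ≠ 1` handles the rest. -/
theorem whittaker_functional_eq_zero (hψ : IsUnramifiedAdd ψ)
    (l : principalSeriesSpace χ₁ χ₂ →ₗ[ℂ] ℂ)
    (hl : ∀ t f, l (principalSeries χ₁ χ₂ (unip t) f) = ψ t * l f)
    (h0 : l (bigCellVec χ₁ χ₂) = 0) : l = 0 := by
  have hp : (p : ℂ) ≠ 0 := by exact_mod_cast (Fact.out : p.Prime).ne_zero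
  have hsmall : ∀ m, l (smallBallVec χ₁ χ₂ m) = 0 := fun m => by
    obtain ⟨A, hA, hA'⟩ := exists_cellFun_smallBallVec χ₁ χ₂ m
    have h1 := eq_sum_smallBallVec (bigCellVec χ₁ χ₂) m m (fun x v hv => ?_) (fun x hx => ?_) hA hA'
    · have hi : ∀ i : ℕ, ‖(i : ℚ_[p])‖ ≤ 1 := fun i => Padic.norm_int_le_one i
      have hψi : ∀ i : ℕ, ψ (-(i : ℚ_[p])) = 1 := fun i => hψ.eq_one (by rw [norm_neg]; exact hi i)
      rw [h1, map_sum] at h0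
      simp_rw [map_smul, hl, neg_add_cancel, neg_zero, zpow_zero, mul_one, cellFun_bigCellVec,
        if_pos (hi _), hψi, Circle.coe_one, one_mul] at h0
      rw [Finset.sum_const, Finset.card_range, nsmul_eq_mul, smul_eq_mul] at h0
      have h2 := (mul_eq_zero.1 h0).resolve_left (by exact_mod_cast pow_ne_zero m hp)
      exact (mul_eq_zero.1 h2).resolve_left
        (div_ne_zero (charExt_ne_zero χ₁ (neg_ne_zero.2 one_ne_zero)) hA)
    · rw [cellFun_bigCellVec, cellFun_bigCellVec]
      have hv1 := hv.trans (neg_zpow_le_one m)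
      have : ‖x + v‖ ≤ 1 ↔ ‖x‖ ≤ 1 :=
        ⟨fun h => by simpa using norm_sub_le_of_le h hv1, fun h => norm_add_le_of_le h hv1⟩
      simp_rw [this]
    · rw [neg_add_cancel, zpow_zero] at hx
      rw [cellFun_bigCellVec, if_neg hx.not_ge]
  have hcell : ∀ f : principalSeriesSpace χ₁ χ₂, f.1 1 = 0 → l f = 0 := fun f hf => by
    obtain ⟨m, hm⟩ := exists_cellFun_add_eq f
    obtain ⟨N₀, hN₀⟩ := exists_cellFun_eq f
    obtain ⟨N, hN⟩ : ∃ N : ℕ, N₀ ≤ -(m : ℤ) + N := ⟨(N₀ + m).toNat, by omega⟩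
    obtain ⟨A, hA, hA'⟩ := exists_cellFun_smallBallVec χ₁ χ₂ m
    rw [eq_sum_smallBallVec f m N hm (fun x hx => by
      rw [hN₀ x ((zpow_prime_le_iff.2 hN).trans_lt hx), hf, mul_zero]) hA hA', map_sum]
    refine Finset.sum_eq_zero fun i _ => ?_
    rw [map_smul, hl, hsmall, mul_zero, smul_zero]
  obtain ⟨x₀, -, hx₀⟩ := hψ.2.2
  ext f
  have h2 := hcell (principalSeries χ₁ χ₂ (unip x₀) f - f) (by
    change f.1 (1 * unip x₀) - f.1 1 = 0
    rw [one_mul, apply_unip, sub_self])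
  rw [map_sub, hl, ← sub_one_mul] at h2
  exact (mul_eq_zero.1 h2).resolve_left (sub_ne_zero.2 fun h => hx₀ (Circle.ext (by simpa using h)))

theorem whittakerFunctional_bigCellVec :
    whittakerFunctional hψ hx₀ χ₁ χ₂ (bigCellVec χ₁ χ₂) = charExt χ₁ (-1) := by
  obtain ⟨n, h1, h2⟩ := ((eventually_whittakerFunctional_eq hψ hx₀ (bigCellVec χ₁ χ₂)).and
    (eventually_ge_atTop 0)).exists
  have h3 : ∀ x, cellFun (bigCellVec χ₁ χ₂) x * (ψ (-x) : ℂ) =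
      (closedBall (0 : ℚ_[p]) 1).indicator (fun _ => charExt χ₁ (-1)) x := fun x => by
    rw [cellFun_bigCellVec]
    split_ifs with h
    · rw [Set.indicator_of_mem (by rwa [mem_closedBall, dist_zero_right]),
        hψ.eq_one (by rwa [norm_neg]), Circle.coe_one, mul_one]
    · rw [Set.indicator_of_notMem (by rwa [mem_closedBall, dist_zero_right]), zero_mul]
  have h4 : closedBall (0 : ℚ_[p]) 1 ⊆ closedBall 0 ((p : ℝ) ^ n) :=
    closedBall_subset_closedBall (by rw [← zpow_zero (p : ℝ)]; exact zpow_prime_le_iff.2 h2)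
  rw [h1, cellIntegral]
  simp_rw [h3]
  rw [setIntegral_indicator measurableSet_closedBall, Set.inter_eq_self_of_subset_right h4,
    setIntegral_const, measureReal_def, volume_closedBall_one]
  simp

theorem exists_eq_mul_whittakerFunctional (l : principalSeriesSpace χ₁ χ₂ →ₗ[ℂ] ℂ)
    (hl : ∀ t f, l (principalSeries χ₁ χ₂ (unip t) f) = ψ t * l f) :
    ∃ C : ℂ, ∀ f, l f = C * whittakerFunctional hψ hx₀ χ₁ χ₂ f := by
  have h0 := charExt_ne_zero χ₁ (neg_ne_zero.2 one_ne_zero)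
  set C := l (bigCellVec χ₁ χ₂) / charExt χ₁ (-1) with hC
  refine ⟨C, fun f => ?_⟩
  have := whittaker_functional_eq_zero hψ (l - C • whittakerFunctional hψ hx₀ χ₁ χ₂)
    (fun t f => ?_) ?_
  · have h1 := LinearMap.congr_fun this f
    simpa [sub_eq_zero] using h1
  · simp only [LinearMap.sub_apply, LinearMap.smul_apply, hl, whittakerFunctional_unip, smul_eq_mul]
    ring
  · rw [LinearMap.sub_apply, LinearMap.smul_apply, whittakerFunctional_bigCellVec, smul_eq_mul, hC,
      div_mul_cancel₀ _ h0, sub_self]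

/-- The embedding of a principal series in its Whittaker model. -/
noncomputable def whittakerEmbedding (χ₁ χ₂ : UnitaryChar p) :
    principalSeriesSpace χ₁ χ₂ →ₗ[ℂ] (G p → ℂ) :=
  LinearMap.pi fun g => whittakerFunctional hψ hx₀ χ₁ χ₂ ∘ₗ principalSeries χ₁ χ₂ g

theorem whittakerEmbedding_apply (f : principalSeriesSpace χ₁ χ₂) (g : G p) :
    whittakerEmbedding hψ hx₀ χ₁ χ₂ f g =
      whittakerFunctional hψ hx₀ χ₁ χ₂ (principalSeries χ₁ χ₂ g f) := rfl

theorem isWhittakerEmbedding_whittakerEmbedding (χ₁ χ₂ : UnitaryChar p) :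
    IsWhittakerEmbedding (principalSeries χ₁ χ₂) ψ (whittakerEmbedding hψ hx₀ χ₁ χ₂) where
  injective := by
    rw [injective_iff_map_eq_zero]
    exact fun f hf => eq_zero_of_whittaker_eq_zero hψ hx₀ f fun g => congrFun hf g
  equivariant g h v := by
    rw [whittakerEmbedding_apply, whittakerEmbedding_apply, map_mul, Module.End.mul_apply]
  whittaker x g v := by
    rw [whittakerEmbedding_apply, whittakerEmbedding_apply, map_mul, Module.End.mul_apply,
      whittakerFunctional_unip]

end Functional

end LocalWhittaker

namespace LocalWhittaker

variable {p : ℕ} [Fact p.Prime] {ψ : AddChar ℚ_[p] Circle} {χ : UnitaryChar p}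

/-! ### Integrals of products of additive and multiplicative characters -/

theorem setIntegral_comp_add (f : ℚ_[p] → ℂ) {S : Set ℚ_[p]} (hS : MeasurableSet S) {v : ℚ_[p]}
    (hv : ∀ x, x + v ∈ S ↔ x ∈ S) : ∫ x in S, f (x + v) = ∫ x in S, f x := by
  rw [← integral_indicator hS, ← integral_indicator hS,
    ← integral_add_right_eq_self (S.indicator f) v]
  congr 1 with x
  by_cases hx : x ∈ S
  · rw [Set.indicator_of_mem hx, Set.indicator_of_mem ((hv x).2 hx)]
  · rw [Set.indicator_of_notMem hx, Set.indicator_of_notMem (fun h => hx ((hv x).1 h))]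

theorem setIntegral_comp_mul (f : ℚ_[p] → ℂ) {S T : Set ℚ_[p]} (hS : MeasurableSet S)
    (hT : MeasurableSet T) {u : ℚ_[p]} (hu : u ≠ 0) (h : ∀ x, u * x ∈ T ↔ x ∈ S) :
    ∫ x in S, f (u * x) = (‖u‖ : ℂ)⁻¹ * ∫ x in T, f x := by
  rw [← integral_indicator hS, ← integral_indicator hT, ← integral_comp_mul_left hu]
  congr 1 with x
  by_cases hx : x ∈ S
  · rw [Set.indicator_of_mem hx, Set.indicator_of_mem ((h x).2 hx)]
  · rw [Set.indicator_of_notMem hx, Set.indicator_of_notMem (fun h' => hx ((h x).1 h'))]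

theorem setIntegral_comp_mul_unit (f : ℚ_[p] → ℂ) {S : Set ℚ_[p]} (hS : MeasurableSet S)
    {u : ℚ_[p]} (hu : ‖u‖ = 1) (h : ∀ x, u * x ∈ S ↔ x ∈ S) :
    ∫ x in S, f (u * x) = ∫ x in S, f x := by
  rw [setIntegral_comp_mul f hS hS (norm_ne_zero_iff.1 (by rw [hu]; exact one_ne_zero)) h, hu]
  simp

theorem norm_addChar_coe (x : ℚ_[p]) : ‖(ψ x : ℂ)‖ = 1 := Circle.norm_coe _

theorem conj_addChar (x : ℚ_[p]) : (starRingEnd ℂ) (ψ x : ℂ) = ψ (-x) := by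
  rw [AddChar.map_neg_eq_inv, Circle.coe_inv_eq_conj]

theorem eq_zero_of_eq_mul_self {a z : ℂ} (ha : a ≠ 1) (h : z = a * z) : z = 0 := by
  have : (1 - a) * z = 0 := by linear_combination h
  exact (mul_eq_zero.1 this).resolve_left (sub_ne_zero.2 ha.symm)

theorem addChar_coe_ne_one {x : ℚ_[p]} (h : ψ x ≠ 1) : (ψ x : ℂ) ≠ 1 :=
  fun h' => h (Circle.ext (by simpa using h'))

theorem integrable_prod_restrict {S T : Set ℚ_[p]} (hS : volume S ≠ ⊤) (hT : volume T ≠ ⊤)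
    {f : ℚ_[p] × ℚ_[p] → ℂ} (hf : Measurable f) (hf1 : ∀ q, ‖f q‖ ≤ 1) :
    Integrable f ((volume.restrict S).prod (volume.restrict T)) := by
  have : IsFiniteMeasure (volume.restrict S) := ⟨by simpa using hS.lt_top⟩
  have : IsFiniteMeasure (volume.restrict T) := ⟨by simpa using hT.lt_top⟩
  exact Integrable.of_bound hf.aestronglyMeasurable 1 (Eventually.of_forall hf1)

/-! #### The integral at a lower triangular unipotent matrix -/

/-- The integral that computes the Whittaker function at a lower triangular unipotent matrix. -/
noncomputable def unitIntegral (ψ : AddChar ℚ_[p] Circle) (χ : UnitaryChar p) (z y : ℚ_[p]) : ℂ :=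
  ∫ t in closedBall (0 : ℚ_[p]) 1, charExt χ (1 + t * z) * ψ (-(y * t))

theorem measurable_addChar_comp (hψ : IsUnramifiedAdd ψ) {α : Type*} [MeasurableSpace α]
    {f : α → ℚ_[p]} (hf : Measurable f) : Measurable fun x => (ψ (f x) : ℂ) :=
  hψ.measurable.comp hf

theorem measurable_charExt_comp (χ : UnitaryChar p) {α : Type*} [MeasurableSpace α]
    {f : α → ℚ_[p]} (hf : Measurable f) : Measurable fun x => charExt χ (f x) :=
  (measurable_charExt χ).comp hf

theorem norm_charExt_mul_addChar_le (x y : ℚ_[p]) : ‖charExt χ x * (ψ y : ℂ)‖ ≤ 1 := by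
  rw [norm_mul, norm_addChar_coe, mul_one]
  exact norm_charExt_le _ _

theorem norm_unitIntegral_le_one (z y : ℚ_[p]) : ‖unitIntegral ψ χ z y‖ ≤ 1 := by
  refine (norm_setIntegral_le_of_norm_le_const (C := 1)
    (isCompact_closedBall _ _).measure_lt_top fun x _ => norm_charExt_mul_addChar_le _ _).trans ?_
  rw [measureReal_def, volume_closedBall_one]
  simp

theorem norm_one_add_mul {t z : ℚ_[p]} (ht : ‖t‖ ≤ 1) (hz : ‖z‖ < 1) : ‖1 + t * z‖ = 1 := by
  rw [norm_add_eq_left, norm_one]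
  rw [norm_one, norm_mul]
  exact (mul_le_of_le_one_left (norm_nonneg _) ht).trans_lt hz

/-- Writing `|F|²` as a double integral and substituting so that the factors `χ(1 + t z)` cancel
leaves `t` only in `ψ(t y s z)`. The integral over `t` restricts `s` to `‖s‖ ≤ (‖y‖ ‖z‖)⁻¹`, a ball
whose volume is the bound. -/
theorem norm_sq_unitIntegral_le (hψ : IsUnramifiedAdd ψ) (χ : UnitaryChar p) {z y : ℚ_[p]}
    (hz : ‖z‖ < 1) (hz0 : z ≠ 0) (hy : y ≠ 0) :
    ‖unitIntegral ψ χ z y‖ ^ 2 ≤ (‖y‖ * ‖z‖)⁻¹ := by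
  set F := unitIntegral ψ χ z y with hF
  set B := closedBall (0 : ℚ_[p]) 1 with hB
  have hBm : MeasurableSet B := measurableSet_closedBall
  have hBv : volume B ≠ ⊤ := (isCompact_closedBall _ _).measure_lt_top.ne
  -- The variable is replaced by `t + (1 + t z) s`, a measure-preserving bijection of `ℤ_p` in `s`,
  -- for which `1 + (t + (1 + t z) s) z = (1 + t z)(1 + s z)`.
  have hconj : ∀ t ∈ B, (starRingEnd ℂ) F =
      ∫ s in B, charExt χ ((1 + t * z) * (1 + s * z))⁻¹ * ψ (y * (t + (1 + t * z) * s)) := by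
    intro t ht
    rw [hB, mem_closedBall, dist_zero_right] at ht
    have hu := norm_one_add_mul ht hz
    rw [hF, unitIntegral, ← integral_conj,
      ← setIntegral_comp_add _ hBm (v := t) (fun x => ?_),
      ← setIntegral_comp_mul_unit _ hBm hu (fun x => ?_)]
    · congr 1 with s
      rw [map_mul, conj_charExt, conj_addChar, neg_neg]
      congr 3
      · ring
      · congr 1
        ring
    · simp only [hB, mem_closedBall, dist_zero_right, norm_mul, hu, one_mul]
    · simp only [hB, mem_closedBall, dist_zero_right]
      exact ⟨fun h => by simpa using norm_sub_le_of_le h ht, fun h => norm_add_le_of_le h ht⟩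
  have h1 : F * (starRingEnd ℂ) F =
      ∫ t in B, ∫ s in B, charExt χ (1 + s * z)⁻¹ * ψ (y * s) * ψ (t * (y * s * z)) := by
    have h0 : ∀ w, F * w = ∫ t in B, charExt χ (1 + t * z) * ψ (-(y * t)) * w :=
      fun w => (integral_mul_const w _).symm
    rw [h0]
    refine setIntegral_congr_fun hBm fun t ht => ?_
    rw [hconj t ht, ← integral_const_mul]
    refine integral_congr_ae (Eventually.of_forall fun s => ?_)
    simp only
    rw [hB, mem_closedBall, dist_zero_right] at ht
    have hne : charExt χ (1 + t * z) ≠ 0 := charExt_ne_zero _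
      (norm_ne_zero_iff.1 (by rw [norm_one_add_mul ht hz]; exact one_ne_zero))
    have e1 : y * (t + (1 + t * z) * s) = y * t + (y * s + t * (y * s * z)) := by ring
    have e2 : (ψ (-(y * t)) : ℂ) * ψ (y * t) = 1 := by
      rw [← Circle.coe_mul, ← AddChar.map_add_eq_mul, neg_add_cancel, AddChar.map_zero_eq_one,
        Circle.coe_one]
    rw [mul_inv, map_mul, e1, AddChar.map_add_eq_mul, AddChar.map_add_eq_mul, Circle.coe_mul,
      Circle.coe_mul, map_inv₀ (charExt χ) (1 + t * z)]
    linear_combination (charExt χ (1 + s * z)⁻¹ * ψ (y * s) * ψ (t * (y * s * z))) *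
      (e2 + (ψ (-(y * t)) : ℂ) * ψ (y * t) * mul_inv_cancel₀ hne)
  rw [integral_integral_swap (integrable_prod_restrict hBv hBv ?_ fun q => ?_)] at h1
  · have hinner : ∀ s : ℚ_[p],
        ∫ t in B, charExt χ (1 + s * z)⁻¹ * ψ (y * s) * (ψ (t * (y * s * z)) : ℂ) =
        if ‖y * s * z‖ ≤ 1 then charExt χ (1 + s * z)⁻¹ * ψ (y * s) else 0 := fun s => by
      have := integral_addChar hψ (y * s * z) 0
      simp only [zpow_zero, neg_zero] at this
      rw [integral_const_mul, this]
      split_ifs <;> simp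
    simp_rw [hinner] at h1
    obtain ⟨k, hk⟩ := exists_norm_eq_zpow (mul_ne_zero hy hz0)
    have h2 : ‖F‖ ^ 2 = ‖∫ s in B, if ‖y * s * z‖ ≤ 1 then charExt χ (1 + s * z)⁻¹ * (ψ (y * s) : ℂ)
        else 0‖ := by
      rw [← h1, norm_mul, RCLike.norm_conj, sq]
    have h3 : ∀ s : ℚ_[p], (if ‖y * s * z‖ ≤ 1 then charExt χ (1 + s * z)⁻¹ * (ψ (y * s) : ℂ)
        else 0) = (closedBall (0 : ℚ_[p]) ((p : ℝ) ^ (-k))).indicator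
          (fun s => charExt χ (1 + s * z)⁻¹ * (ψ (y * s) : ℂ)) s := fun s => by
      have h4 : ‖y * s * z‖ ≤ 1 ↔ s ∈ closedBall (0 : ℚ_[p]) ((p : ℝ) ^ (-k)) := by
        rw [mem_closedBall, dist_zero_right, mul_right_comm, norm_mul, hk, zpow_neg, mul_comm,
          ← le_div_iff₀ (zpow_prime_pos k), one_div]
      by_cases h5 : ‖y * s * z‖ ≤ 1
      · rw [if_pos h5, Set.indicator_of_mem (h4.1 h5)]
      · rw [if_neg h5, Set.indicator_of_notMem (fun h => h5 (h4.2 h))]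
    simp_rw [h3] at h2
    rw [h2, ← norm_mul, hk, setIntegral_indicator measurableSet_closedBall]
    refine (norm_setIntegral_le_of_norm_le_const (C := 1) ?_
      fun x _ => norm_charExt_mul_addChar_le _ _).trans ?_
    · exact (measure_mono Set.inter_subset_left).trans_lt hBv.lt_top
    · rw [one_mul, ← zpow_neg]
      exact (measureReal_mono Set.inter_subset_right
        (isCompact_closedBall _ _).measure_lt_top.ne).trans_eq (volume_real_closedBall_zpow _)
  · exact ((measurable_charExt_comp χ (by fun_prop)).mul
      (measurable_addChar_comp hψ (by fun_prop))).mul (measurable_addChar_comp hψ (by fun_prop))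
  · change ‖charExt χ (1 + q.2 * z)⁻¹ * ψ (y * q.2) * (ψ (q.1 * (y * q.2 * z)) : ℂ)‖ ≤ 1
    rw [norm_mul, norm_addChar_coe, mul_one]
    exact norm_charExt_mul_addChar_le _ _

/-- A shift of `t` by `s` of norm `p ^ (j - c)` changes `1 + t z` by a factor in `1 + p ^ c ℤ_p`,
invisible to `χ`, but multiplies the additive character by `ψ(-y s) ≠ 1`. -/
theorem unitIntegral_eq_zero (hψ : IsUnramifiedAdd ψ) {j : ℕ} (hj : j ≤ charConductorExponent χ)
    {z y : ℚ_[p]} (hz : ‖z‖ < 1) (hzj : ‖z‖ ≤ (p : ℝ) ^ (-(j : ℤ)))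
    (hy : (p : ℝ) ^ ((charConductorExponent χ : ℤ) - j) < ‖y‖) : unitIntegral ψ χ z y = 0 := by
  set c := charConductorExponent χ with hc
  set s : ℚ_[p] := (p : ℚ_[p]) ^ ((c : ℤ) - j) with hs
  have hsn : ‖s‖ = (p : ℝ) ^ ((j : ℤ) - c) := by rw [hs, norm_prime_zpow]; congr 1; ring
  have hs1 : ‖s‖ ≤ 1 := by
    rw [hsn, ← zpow_zero (p : ℝ), zpow_prime_le_iff]
    omega
  have hψs : ψ (-(y * s)) ≠ 1 := by
    rw [Ne, hψ.eq_one_iff, norm_neg, norm_mul, hsn, not_le]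
    calc 1 = (p : ℝ) ^ ((c : ℤ) - j) * (p : ℝ) ^ ((j : ℤ) - c) := by
          rw [← zpow_add₀ prime_cast_pos.ne']; simp
      _ < _ := by gcongr; exact zpow_prime_pos _
  refine eq_zero_of_eq_mul_self (addChar_coe_ne_one hψs) ?_
  have hmem : ∀ x, x + s ∈ closedBall (0 : ℚ_[p]) 1 ↔ x ∈ closedBall (0 : ℚ_[p]) 1 := fun x => by
    simp only [mem_closedBall, dist_zero_right]
    exact ⟨fun h => by simpa using norm_sub_le_of_le h hs1, fun h => norm_add_le_of_le h hs1⟩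
  have h1 := setIntegral_comp_add (fun t => charExt χ (1 + t * z) * (ψ (-(y * t)) : ℂ))
    measurableSet_closedBall hmem
  refine h1.symm.trans (Eq.trans ?_ (integral_const_mul _ _))
  · refine setIntegral_congr_fun measurableSet_closedBall fun t ht => ?_
    rw [mem_closedBall, dist_zero_right] at ht
    have hu := norm_one_add_mul ht hz
    have hu0 : 1 + t * z ≠ 0 := norm_ne_zero_iff.1 (by rw [hu]; exact one_ne_zero)
    have hsz : ‖s * z / (1 + t * z)‖ ≤ (p : ℝ) ^ (-(c : ℤ)) := by
      rw [norm_div, hu, div_one, norm_mul, hsn]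
      calc _ ≤ (p : ℝ) ^ ((j : ℤ) - c) * (p : ℝ) ^ (-(j : ℤ)) := by
            gcongr
        _ = _ := by rw [← zpow_add₀ prime_cast_pos.ne']; congr 1; ring
    have hsz' : ‖s * z / (1 + t * z)‖ < 1 := by
      rw [norm_div, hu, div_one, norm_mul]
      exact (mul_le_of_le_one_left (norm_nonneg _) hs1).trans_lt hz
    have e1 : 1 + (t + s) * z = (1 + t * z) * (1 + s * z / (1 + t * z)) := by
      field_simp
      ring
    have e2 : charExt χ (1 + s * z / (1 + t * z)) = 1 :=
      charExt_eq_one hc.ge (norm_eq_one_of_sub_one_lt (by simpa using hsz')) (by simpa using hsz)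
    rw [e1, map_mul, e2, mul_one, mul_add, neg_add, AddChar.map_add_eq_mul, Circle.coe_mul]
    ring

/-- For `‖z‖ = p ^ (-j)` with `j < c`, the quantity is at most `p ^ j` by the autocorrelation bound
and at most `p ^ (c - j)` by the vanishing range together with `|F| ≤ 1`. One of `j` and `c - j` is
at most `⌊c/2⌋`. -/
theorem norm_mul_sq_unitIntegral_le (hψ : IsUnramifiedAdd ψ) (χ : UnitaryChar p) {z y : ℚ_[p]}
    (hz : ‖z‖ < 1) (hy : y ≠ 0) :
    ‖y‖ * ‖unitIntegral ψ χ z y‖ ^ 2 ≤ (p : ℝ) ^ (charConductorExponent χ / 2) := by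
  set c := charConductorExponent χ with hc
  have hle : ‖y‖ * ‖unitIntegral ψ χ z y‖ ^ 2 ≤ ‖y‖ :=
    mul_le_of_le_one_right (norm_nonneg _)
      (pow_le_one₀ (norm_nonneg _) (norm_unitIntegral_le_one z y))
  have hone : (1 : ℝ) ≤ (p : ℝ) ^ (c / 2) := one_le_pow₀ one_lt_prime_cast.le
  rcases le_or_gt ‖z‖ ((p : ℝ) ^ (-(c : ℤ))) with hzc | hzc
  · rcases le_or_gt ‖y‖ 1 with hy1 | hy1
    · linarith
    · rw [unitIntegral_eq_zero hψ hc.le hz hzc (by rwa [sub_self, zpow_zero]), norm_zero, zero_pow two_ne_zero, mul_zero]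
      positivity
  · have hz0 : z ≠ 0 := norm_pos_iff.1 ((zpow_prime_pos _).trans hzc)
    obtain ⟨j, hj1, hj⟩ := exists_norm_eq_neg_zpow hz0 hz
    rw [hj, zpow_prime_lt_iff] at hzc
    rcases le_or_gt ‖y‖ ((p : ℝ) ^ ((c : ℤ) - j)) with hy1 | hy1
    · have hyp := norm_pos_iff.2 hy
      have h1 : ‖y‖ * ‖unitIntegral ψ χ z y‖ ^ 2 ≤ (p : ℝ) ^ (j : ℤ) := by
        have := mul_le_mul_of_nonneg_left (norm_sq_unitIntegral_le hψ χ hz hz0 hy) hyp.le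
        refine this.trans_eq ?_
        rw [mul_inv, mul_inv_cancel_left₀ hyp.ne', hj, zpow_neg, inv_inv]
      rw [← zpow_natCast]
      rcases le_or_gt j (c / 2) with h | h
      · exact h1.trans (zpow_prime_le_iff.2 (show (j : ℤ) ≤ ((c / 2 : ℕ) : ℤ) by omega))
      · exact (hle.trans hy1).trans
          (zpow_prime_le_iff.2 (show (c : ℤ) - j ≤ ((c / 2 : ℕ) : ℤ) by omega))
    · rw [unitIntegral_eq_zero hψ (by omega) hz hj.le hy1, norm_zero, zero_pow two_ne_zero, mul_zero]
      positivity

theorem norm_natCast_le_one (n : ℕ) : ‖(n : ℚ_[p])‖ ≤ 1 := by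
  exact_mod_cast Padic.norm_int_le_one (n : ℤ)

/-- On a small subgroup, a multiplicative character agrees with an additive character. -/
theorem exists_charExt_eq_addChar (hψ : IsUnramifiedAdd ψ) {m j : ℕ} (hm : 1 ≤ m) (hmj : m ≤ j)
    (hc : charConductorExponent χ = m + j) : ∃ y : ℚ_[p], ‖y‖ = (p : ℝ) ^ m ∧
      ∀ t : ℚ_[p], ‖t‖ ≤ 1 → charExt χ (1 + t * (p : ℚ_[p]) ^ j) = ψ (y * t) := by
  set z : ℚ_[p] := (p : ℚ_[p]) ^ j with hz
  have hzn : ‖z‖ = (p : ℝ) ^ (-(j : ℤ)) := by rw [hz, ← zpow_natCast, norm_prime_zpow]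
  have hz1 : ‖z‖ < 1 := by rw [hzn]; exact neg_zpow_lt_one (by omega)
  have hz0 : z ≠ 0 := pow_ne_zero _ prime_padic_ne_zero
  -- The error in treating `1 + t z` as additive is the term `t s z²`, of norm at most `p ^ (-2 j)`;
  -- since `m ≤ j`, it lies below the conductor `p ^ (m + j)`.
  have hadd : ∀ t s : ℚ_[p], ‖t‖ ≤ 1 → ‖s‖ ≤ 1 →
      charExt χ (1 + (t + s) * z) = charExt χ (1 + t * z) * charExt χ (1 + s * z) := by
    intro t s ht hs
    have hu := norm_one_add_mul (norm_add_le_of_le ht hs) hz1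
    have hu0 : 1 + (t + s) * z ≠ 0 := norm_ne_zero_iff.1 (by rw [hu]; exact one_ne_zero)
    have e1 : (1 + t * z) * (1 + s * z) =
        (1 + (t + s) * z) * (1 + t * s * z * z / (1 + (t + s) * z)) := by
      have : (1 + (t + s) * z) * (t * s * z * z / (1 + (t + s) * z)) = t * s * z * z := by
        field_simp
      linear_combination -this
    have e2 : ‖t * s * z * z / (1 + (t + s) * z)‖ ≤ (p : ℝ) ^ (-((m + j : ℕ) : ℤ)) := by
      rw [norm_div, hu, div_one, norm_mul, norm_mul, norm_mul, hzn]
      calc _ ≤ 1 * 1 * (p : ℝ) ^ (-(j : ℤ)) * (p : ℝ) ^ (-(j : ℤ)) := by gcongr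
        _ = (p : ℝ) ^ (-(j : ℤ) + -(j : ℤ)) := by
          rw [zpow_add₀ prime_cast_pos.ne']
          ring
        _ ≤ _ := zpow_prime_le_iff.2 (by push_cast; omega)
    have e3 : charExt χ (1 + t * s * z * z / (1 + (t + s) * z)) = 1 :=
      charExt_eq_one hc.le (norm_eq_one_of_sub_one_lt (by
        rw [add_sub_cancel_left]
        exact e2.trans_lt (neg_zpow_lt_one (by omega)))) (by rwa [add_sub_cancel_left])
    rw [← map_mul, e1, map_mul, e3, mul_one]
  have hnat : ∀ n : ℕ, charExt χ (1 + (n : ℚ_[p]) * z) = charExt χ (1 + z) ^ n := by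
    intro n
    induction n with
    | zero => simp
    | succ n ih =>
      rw [Nat.cast_succ, hadd _ _ (norm_natCast_le_one n) (by simp), ih, one_mul, pow_succ]
  have htriv : ∀ t : ℚ_[p], ‖t‖ ≤ (p : ℝ) ^ (-(m : ℤ)) → charExt χ (1 + t * z) = 1 := by
    intro t ht
    have h1 : ‖t * z‖ ≤ (p : ℝ) ^ (-((m + j : ℕ) : ℤ)) := by
      rw [norm_mul, hzn]
      calc _ ≤ (p : ℝ) ^ (-(m : ℤ)) * (p : ℝ) ^ (-(j : ℤ)) := by gcongr
        _ = _ := by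
          rw [← zpow_add₀ prime_cast_pos.ne']
          congr 1
          push_cast
          ring
    exact charExt_eq_one hc.le (norm_one_add_mul (ht.trans (neg_zpow_le_one m)) hz1)
      (by rwa [add_sub_cancel_left])
  -- Both `ψ(p ^ (-m))` and `χ(1 + z)` are `p ^ m`-th roots of unity, and the first is primitive. So
  -- `χ(1 + z) = ψ(p ^ (-m)) ^ i`, and `y = i p ^ (-m)` is the required frequency.
  have hroot : IsPrimitiveRoot (ψ ((p : ℚ_[p]) ^ (-(m : ℤ))) : ℂ) (p ^ m) := by
    have hk : ∀ k : ℕ, (ψ ((p : ℚ_[p]) ^ (-(m : ℤ))) : ℂ) ^ k = 1 ↔ p ^ m ∣ k := by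
      intro k
      rw [← Circle.coe_pow, ← AddChar.map_nsmul_eq_pow, ← Circle.coe_one, Circle.coe_inj,
        hψ.eq_one_iff, nsmul_eq_mul, norm_mul, norm_prime_zpow, neg_neg,
        ← le_div_iff₀ (zpow_prime_pos _), one_div, ← zpow_neg]
      have := Padic.norm_int_le_pow_iff_dvd (p := p) (k : ℤ) m
      rw [Int.cast_natCast] at this
      rw [this]
      exact_mod_cast Iff.rfl
    exact ⟨(hk _).2 dvd_rfl, fun l hl => (hk l).1 hl⟩
  have : NeZero (p ^ m) := ⟨pow_ne_zero _ (Fact.out : p.Prime).ne_zero⟩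
  obtain ⟨i, -, hi⟩ := hroot.eq_pow_of_pow_eq_one (ξ := charExt χ (1 + z)) (by
    rw [← hnat, htriv]
    rw [Nat.cast_pow, ← zpow_natCast, norm_prime_zpow])
  set y : ℚ_[p] := i * (p : ℚ_[p]) ^ (-(m : ℤ)) with hy
  have hyn : ‖y‖ ≤ (p : ℝ) ^ (m : ℤ) := by
    rw [hy, norm_mul, norm_prime_zpow, neg_neg]
    exact mul_le_of_le_one_left (zpow_prime_pos _).le (norm_natCast_le_one i)
  have key : ∀ t : ℚ_[p], ‖t‖ ≤ 1 → charExt χ (1 + t * z) = ψ (y * t) := by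
    intro t ht
    obtain ⟨n, ⟨-, hn⟩, -⟩ := exists_unique_digits (p := p) (-(m : ℤ)) m (x := t) (by simpa using ht)
    simp only [neg_add_cancel, neg_zero, zpow_zero, mul_one] at hn
    have e1 : t = n + (t - n) := by ring
    have e2 : ψ (y * (t - n)) = 1 := hψ.eq_one (by
      rw [norm_mul]
      calc _ ≤ (p : ℝ) ^ (m : ℤ) * (p : ℝ) ^ (-(m : ℤ)) := by gcongr
        _ = 1 := by rw [← zpow_add₀ prime_cast_pos.ne']; simp)
    have e3 : y * (n : ℚ_[p]) = (i * n) • (p : ℚ_[p]) ^ (-(m : ℤ)) := by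
      rw [hy, nsmul_eq_mul]
      push_cast
      ring
    conv_lhs => rw [e1]
    conv_rhs => rw [e1, mul_add, AddChar.map_add_eq_mul, e2, mul_one, e3,
      AddChar.map_nsmul_eq_pow, Circle.coe_pow, pow_mul, hi]
    rw [hadd _ _ (norm_natCast_le_one n) (hn.trans (neg_zpow_le_one m)), htriv _ hn, mul_one, hnat]
  refine ⟨y, le_antisymm (by exact_mod_cast hyn) ?_, key⟩
  -- A smaller `y` would make `ψ(y t)` trivial for `‖t‖ ≤ p ^ (1 - m)`, and hence `χ` trivial on `1
  -- + p ^ (m + j - 1) ℤ_p`, against the exactness of the conductor.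
  by_contra! hlt
  rw [← zpow_natCast, norm_lt_zpow_iff] at hlt
  obtain ⟨u, hu, hu1, hne⟩ := exists_apply_ne_one (χ := χ) (n := m + j - 1) (by omega)
  have ht : ‖((u : ℚ_[p]) - 1) / z‖ ≤ (p : ℝ) ^ (-((m : ℤ) - 1)) := by
    rw [norm_div, hzn, div_le_iff₀ (zpow_prime_pos _), ← zpow_add₀ prime_cast_pos.ne']
    rwa [show -((m : ℤ) - 1) + -(j : ℤ) = -((m + j - 1 : ℕ) : ℤ) by omega]
  have h1 := key _ (ht.trans (by
    rw [← zpow_zero (p : ℝ), zpow_prime_le_iff]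
    omega))
  rw [div_mul_cancel₀ _ hz0, add_sub_cancel, hψ.eq_one, Circle.coe_one, charExt_units] at h1
  · exact hne (Circle.ext (by simpa using h1))
  · rw [norm_mul]
    calc _ ≤ (p : ℝ) ^ ((m : ℤ) - 1) * (p : ℝ) ^ (-((m : ℤ) - 1)) := by gcongr
      _ = 1 := by rw [← zpow_add₀ prime_cast_pos.ne']; simp

theorem unitIntegral_eq_one {z y : ℚ_[p]}
    (h : ∀ t : ℚ_[p], ‖t‖ ≤ 1 → charExt χ (1 + t * z) = ψ (y * t)) :
    unitIntegral ψ χ z y = 1 := by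
  rw [unitIntegral, setIntegral_congr_fun (g := fun _ => (1 : ℂ)) measurableSet_closedBall]
  · rw [setIntegral_const, measureReal_def, volume_closedBall_one]
    simp
  · intro t ht
    rw [mem_closedBall, dist_zero_right] at ht
    simp only
    rw [h t ht, ← Circle.coe_mul, ← AddChar.map_add_eq_mul, add_neg_cancel,
      AddChar.map_zero_eq_one, Circle.coe_one]

end LocalWhittaker

namespace LocalWhittaker

variable {p : ℕ} [Fact p.Prime] {ψ : AddChar ℚ_[p] Circle} {χ : UnitaryChar p}

/-! #### Gauss sums: integrals over spheres -/

/-- The integral of a product of characters over the sphere of radius `p ^ k`. -/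
noncomputable def sphereIntegral (ψ : AddChar ℚ_[p] Circle) (χ : UnitaryChar p) (k : ℤ) : ℂ :=
  ∫ x in sphere (0 : ℚ_[p]) ((p : ℝ) ^ k), charExt χ x * ψ (-x)

theorem measurableSet_sphere (r : ℝ) : MeasurableSet (sphere (0 : ℚ_[p]) r) :=
  isClosed_sphere.measurableSet

theorem volume_sphere_ne_top (r : ℝ) : volume (sphere (0 : ℚ_[p]) r) ≠ ⊤ :=
  (isCompact_sphere _ _).measure_lt_top.ne

theorem closedBall_eq_union_sphere (k : ℤ) : closedBall (0 : ℚ_[p]) ((p : ℝ) ^ k) =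
    sphere 0 ((p : ℝ) ^ k) ∪ closedBall 0 ((p : ℝ) ^ (k - 1)) := by
  ext x
  simp only [Set.mem_union, mem_closedBall, mem_sphere, dist_zero_right]
  rw [← norm_lt_zpow_iff, le_iff_eq_or_lt]

theorem disjoint_sphere_closedBall (k : ℤ) :
    Disjoint (sphere (0 : ℚ_[p]) ((p : ℝ) ^ k)) (closedBall 0 ((p : ℝ) ^ (k - 1))) := by
  refine Set.disjoint_left.2 fun x hx hx' => ?_
  rw [mem_sphere, dist_zero_right] at hx
  rw [mem_closedBall, dist_zero_right, hx, zpow_prime_le_iff] at hx'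
  omega

theorem setIntegral_sphere {f : ℚ_[p] → ℂ} (k : ℤ)
    (hf : IntegrableOn f (closedBall (0 : ℚ_[p]) ((p : ℝ) ^ k))) :
    ∫ x in sphere (0 : ℚ_[p]) ((p : ℝ) ^ k), f x =
      (∫ x in closedBall (0 : ℚ_[p]) ((p : ℝ) ^ k), f x) -
        ∫ x in closedBall (0 : ℚ_[p]) ((p : ℝ) ^ (k - 1)), f x := by
  rw [closedBall_eq_union_sphere k] at hf
  rw [closedBall_eq_union_sphere k, setIntegral_union (disjoint_sphere_closedBall k)
    measurableSet_closedBall (hf.mono_set Set.subset_union_left)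
    (hf.mono_set Set.subset_union_right), add_sub_cancel_right]

/-- Below the conductor, multiplication by a unit `u ≡ 1` modulo `p ^ (c - 1)` with `χ(u) ≠ 1`
leaves `ψ` unchanged. Above it, translation by an element of norm `p` leaves `χ` unchanged and
changes `ψ`. -/
theorem sphereIntegral_eq_zero (hψ : IsUnramifiedAdd ψ) (hc : 1 ≤ charConductorExponent χ) {k : ℤ}
    (hk : k ≠ charConductorExponent χ) : sphereIntegral ψ χ k = 0 := by
  set c := charConductorExponent χ with hcdef
  rcases lt_or_gt_of_ne hk with hk | hk
  · obtain ⟨u, hu, hu1, hne⟩ := exists_apply_ne_one (χ := χ) (n := c - 1) (by omega)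
    have hne' : (χ u : ℂ) ≠ 1 := fun h => hne (Circle.ext (by simpa using h))
    have h1 := setIntegral_comp_mul_unit (fun x => charExt χ x * (ψ (-x) : ℂ))
      (measurableSet_sphere ((p : ℝ) ^ k)) hu (fun x => by
        simp only [mem_sphere, dist_zero_right, norm_mul, hu, one_mul])
    refine eq_zero_of_eq_mul_self hne' (h1.symm.trans (Eq.trans ?_ (integral_const_mul _ _)))
    refine setIntegral_congr_fun (measurableSet_sphere _) fun x hx => ?_
    rw [mem_sphere, dist_zero_right] at hx
    have e1 : -(u * x) = -x + -((u - 1) * x) := by ring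
    have e2 : ψ (-(((u : ℚ_[p]) - 1) * x)) = 1 := hψ.eq_one (by
      rw [norm_neg, norm_mul, hx]
      calc _ ≤ (p : ℝ) ^ (-((c - 1 : ℕ) : ℤ)) * (p : ℝ) ^ k := by gcongr
        _ = (p : ℝ) ^ (-((c - 1 : ℕ) : ℤ) + k) := by rw [zpow_add₀ prime_cast_pos.ne']
        _ ≤ (p : ℝ) ^ (0 : ℤ) := zpow_prime_le_iff.2 (by omega)
        _ = 1 := zpow_zero _)
    rw [map_mul, charExt_units, e1, AddChar.map_add_eq_mul, e2, mul_one, mul_assoc]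
  · set v : ℚ_[p] := (p : ℚ_[p]) ^ (-1 : ℤ) with hv
    have hvn : ‖v‖ = (p : ℝ) ^ (1 : ℤ) := by rw [hv, norm_prime_zpow, neg_neg]
    have hne : ψ (-v) ≠ 1 := by
      rw [Ne, hψ.eq_one_iff, norm_neg, hvn, not_le, zpow_one]
      exact one_lt_prime_cast
    have hmem : ∀ x, x + v ∈ sphere (0 : ℚ_[p]) ((p : ℝ) ^ k) ↔
        x ∈ sphere (0 : ℚ_[p]) ((p : ℝ) ^ k) := fun x => by
      simp only [mem_sphere, dist_zero_right]
      have hlt : ‖v‖ < (p : ℝ) ^ k := by rw [hvn, zpow_prime_lt_iff]; omega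
      constructor
      · intro h
        have := norm_add_eq_left (x := x + v) (y := -v) (by rwa [norm_neg, h])
        rw [add_neg_cancel_right] at this
        rw [this, h]
      · intro h
        rw [norm_add_eq_left (by rwa [h]), h]
    have h1 := setIntegral_comp_add (fun x => charExt χ x * (ψ (-x) : ℂ))
      (measurableSet_sphere ((p : ℝ) ^ k)) hmem
    refine eq_zero_of_eq_mul_self (addChar_coe_ne_one hne)
      (h1.symm.trans (Eq.trans ?_ (integral_const_mul _ _)))
    refine setIntegral_congr_fun (measurableSet_sphere _) fun x hx => ?_
    rw [mem_sphere, dist_zero_right] at hx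
    have hx0 : x ≠ 0 := norm_pos_iff.1 (hx ▸ zpow_prime_pos k)
    have e1 : x + v = x * (1 + v / x) := by field_simp
    have e2 : ‖v / x‖ ≤ (p : ℝ) ^ (-(c : ℤ)) := by
      rw [norm_div, hvn, hx, ← zpow_sub₀ prime_cast_pos.ne', zpow_prime_le_iff]
      omega
    have e3 : charExt χ (1 + v / x) = 1 := charExt_eq_one hcdef.ge
      (norm_eq_one_of_sub_one_lt (by
        rw [add_sub_cancel_left]
        exact e2.trans_lt (neg_zpow_lt_one hc))) (by rwa [add_sub_cancel_left])
    rw [neg_add, AddChar.map_add_eq_mul, Circle.coe_mul, e1, map_mul, e3, mul_one]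
    ring

theorem integral_sphere_addChar (hψ : IsUnramifiedAdd ψ) (v : ℚ_[p]) (k : ℤ) :
    ∫ x in sphere (0 : ℚ_[p]) ((p : ℝ) ^ k), (ψ (x * v) : ℂ) =
      (if ‖v‖ ≤ (p : ℝ) ^ (-k) then (p : ℂ) ^ k else 0) -
        if ‖v‖ ≤ (p : ℝ) ^ (-(k - 1)) then (p : ℂ) ^ (k - 1) else 0 := by
  rw [setIntegral_sphere k, integral_addChar hψ, integral_addChar hψ]
  exact integrableOn_closedBall (measurable_addChar_comp hψ (by fun_prop))
    (fun x => (norm_addChar_coe _).le) _ _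

/-- The classical computation of `|Gauss sum|²`: substituting `x u` for the second variable cancels
`χ(x)`, and the integral of `ψ(x (u - 1))` over the sphere is a difference of multiples of the
indicators of `1 + p ^ c ℤ_p` and `1 + p ^ (c - 1) ℤ_p`. Only the first survives. -/
theorem norm_sq_sphereIntegral (hψ : IsUnramifiedAdd ψ) (hc : 1 ≤ charConductorExponent χ) :
    ‖sphereIntegral ψ χ (charConductorExponent χ)‖ ^ 2 = (p : ℝ) ^ (charConductorExponent χ) := by
  set c := charConductorExponent χ with hcdef
  set T := sphereIntegral ψ χ c with hT
  set S := sphere (0 : ℚ_[p]) ((p : ℝ) ^ (c : ℤ)) with hS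
  set U := sphere (0 : ℚ_[p]) 1 with hU
  have hSm : MeasurableSet S := measurableSet_sphere _
  have hUm : MeasurableSet U := measurableSet_sphere _
  have hpc : (p : ℂ) ≠ 0 := by exact_mod_cast (Fact.out : p.Prime).ne_zero
  have hconj : ∀ x ∈ S, (starRingEnd ℂ) T =
      (p : ℂ) ^ (c : ℤ) * ∫ u in U, charExt χ (x * u)⁻¹ * ψ (x * u) := by
    intro x hx
    rw [hS, mem_sphere, dist_zero_right] at hx
    have hx0 : x ≠ 0 := norm_pos_iff.1 (hx ▸ zpow_prime_pos _)
    rw [setIntegral_comp_mul (fun y => charExt χ y⁻¹ * (ψ y : ℂ)) hUm hSm hx0 fun u => ?_, hx,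
      Complex.ofReal_zpow, Complex.ofReal_natCast, mul_inv_cancel_left₀ (zpow_ne_zero _ hpc), hT,
      sphereIntegral, ← integral_conj]
    · congr 1 with y
      rw [map_mul, conj_charExt, conj_addChar, neg_neg]
    · simp only [hS, hU, mem_sphere, dist_zero_right, norm_mul, hx]
      exact mul_eq_left₀ (zpow_prime_pos _).ne'
  have h1 : T * (starRingEnd ℂ) T =
      ∫ x in S, ∫ u in U, (p : ℂ) ^ (c : ℤ) * (charExt χ u⁻¹ * ψ (x * (u - 1))) := by
    have h0 : ∀ w, T * w = ∫ x in S, charExt χ x * ψ (-x) * w :=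
      fun w => (integral_mul_const w _).symm
    rw [h0]
    refine setIntegral_congr_fun hSm fun x hx => ?_
    rw [hconj x hx, integral_const_mul, ← mul_assoc, mul_comm _ ((p : ℂ) ^ (c : ℤ)), mul_assoc,
      ← integral_const_mul]
    congr 1
    refine integral_congr_ae (Eventually.of_forall fun u => ?_)
    simp only
    rw [hS, mem_sphere, dist_zero_right] at hx
    have hne : charExt χ x ≠ 0 := charExt_ne_zero _ (norm_pos_iff.1 (hx ▸ zpow_prime_pos _))
    have e1 : x * (u - 1) = -x + x * u := by ring
    rw [e1, AddChar.map_add_eq_mul, Circle.coe_mul, mul_inv, map_mul, map_inv₀ (charExt χ) x]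
    linear_combination (charExt χ u⁻¹ * ψ (-x) * ψ (x * u)) * mul_inv_cancel₀ hne
  simp_rw [integral_const_mul] at h1
  rw [integral_integral_swap (integrable_prod_restrict (volume_sphere_ne_top _)
    (volume_sphere_ne_top _) ?_ fun q => ?_)] at h1
  · have hinner : ∀ u : ℚ_[p], ∫ x in S, charExt χ u⁻¹ * (ψ (x * (u - 1)) : ℂ) =
        (closedBall (1 : ℚ_[p]) ((p : ℝ) ^ (-(c : ℤ)))).indicator
          (fun u => (p : ℂ) ^ (c : ℤ) * charExt χ u⁻¹) u -
        (closedBall (1 : ℚ_[p]) ((p : ℝ) ^ (-((c : ℤ) - 1)))).indicator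
          (fun u => (p : ℂ) ^ ((c : ℤ) - 1) * charExt χ u⁻¹) u := fun u => by
      rw [integral_const_mul, hS, integral_sphere_addChar hψ, mul_sub]
      congr 1 <;>
      · split_ifs with h
        · rw [Set.indicator_of_mem (by rwa [mem_closedBall, dist_eq_norm]), mul_comm]
        · rw [Set.indicator_of_notMem (by rwa [mem_closedBall, dist_eq_norm]), mul_zero]
    have hmE : Measurable fun u : ℚ_[p] => charExt χ u⁻¹ := by
      simp_rw [map_inv₀]
      exact (measurable_charExt χ).inv
    have hint : ∀ (a : ℂ) (r : ℝ), IntegrableOn ((closedBall (1 : ℚ_[p]) r).indicator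
        (fun u => a * charExt χ u⁻¹)) U := fun a r => by
      refine Measure.integrableOn_of_bounded (volume_sphere_ne_top _) (M := ‖a‖)
        ((hmE.const_mul a).indicator measurableSet_closedBall).aestronglyMeasurable
        (Eventually.of_forall fun u => ?_)
      refine (norm_indicator_le_norm_self _ _).trans ?_
      rw [norm_mul]
      exact mul_le_of_le_one_right (norm_nonneg _) (norm_charExt_le _ _)
    have hsmall : closedBall (1 : ℚ_[p]) ((p : ℝ) ^ (-(c : ℤ))) ⊆ U := fun u hu => by
      rw [mem_closedBall, dist_eq_norm] at hu
      rw [hU, mem_sphere, dist_zero_right]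
      exact norm_eq_one_of_sub_one_lt (hu.trans_lt (neg_zpow_lt_one hc))
    have hfirst : ∫ u in closedBall (1 : ℚ_[p]) ((p : ℝ) ^ (-(c : ℤ))),
        (p : ℂ) ^ (c : ℤ) * charExt χ u⁻¹ = 1 := by
      rw [setIntegral_congr_fun (g := fun _ => (p : ℂ) ^ (c : ℤ)) measurableSet_closedBall]
      · rw [setIntegral_const, measureReal_def, Measure.addHaar_closedBall_center,
          ← measureReal_def, volume_real_closedBall_zpow, Complex.real_smul, Complex.ofReal_zpow,
          Complex.ofReal_natCast, ← zpow_add₀ hpc, neg_add_cancel, zpow_zero]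
      · intro u hu
        have hu1 := hsmall hu
        rw [mem_closedBall, dist_eq_norm] at hu
        rw [hU, mem_sphere, dist_zero_right] at hu1
        simp only
        rw [map_inv₀, charExt_eq_one hcdef.ge hu1 hu, inv_one, mul_one]
    -- By exactness of the conductor `χ` is nontrivial on this set, which is a group. The
    -- intersection with `U` matters for `c = 1`, where the ball is all of `ℤ_p`.
    have hsecond : ∫ u in U ∩ closedBall (1 : ℚ_[p]) ((p : ℝ) ^ (-((c : ℤ) - 1))),
        (p : ℂ) ^ ((c : ℤ) - 1) * charExt χ u⁻¹ = 0 := by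
      obtain ⟨u₀, hu, hu1, hne⟩ := exists_apply_ne_one (χ := χ) (n := c - 1) (by omega)
      rw [show -((c - 1 : ℕ) : ℤ) = -((c : ℤ) - 1) by omega] at hu1
      have hmem : ∀ x, (u₀ : ℚ_[p]) * x ∈ U ∩ closedBall (1 : ℚ_[p]) ((p : ℝ) ^ (-((c : ℤ) - 1))) ↔
          x ∈ U ∩ closedBall (1 : ℚ_[p]) ((p : ℝ) ^ (-((c : ℤ) - 1))) := fun x => by
        simp only [hU, Set.mem_inter_iff, mem_sphere, mem_closedBall, dist_eq_norm, sub_zero,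
          norm_mul, hu, one_mul]
        refine and_congr_right fun _ => ⟨fun h => ?_, fun h => ?_⟩
        · have e1 : (u₀ : ℚ_[p]) * (x - 1) = (u₀ * x - 1) - (u₀ - 1) := by ring
          have := norm_sub_le_of_le h hu1
          rwa [← e1, norm_mul, hu, one_mul] at this
        · exact norm_mul_sub_one_le hu hu1 h
      have h3 := setIntegral_comp_mul_unit (fun u => (p : ℂ) ^ ((c : ℤ) - 1) * charExt χ u⁻¹)
        (hUm.inter measurableSet_closedBall) hu hmem
      have hne' : (χ u₀ : ℂ)⁻¹ ≠ 1 := fun h => hne (Circle.ext (by simpa using h))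
      refine eq_zero_of_eq_mul_self hne' (h3.symm.trans (Eq.trans ?_ (integral_const_mul _ _)))
      refine integral_congr_ae (Eventually.of_forall fun u => ?_)
      simp only
      rw [mul_inv, map_mul, map_inv₀ (charExt χ) (u₀ : ℚ_[p]), charExt_units]
      ring
    replace h1 := h1.trans (congrArg ((p : ℂ) ^ (c : ℤ) * ·)
      (integral_congr_ae (Eventually.of_forall hinner)))
    rw [integral_sub (hint _ _) (hint _ _), setIntegral_indicator measurableSet_closedBall,
      setIntegral_indicator measurableSet_closedBall, hsecond,
      Set.inter_eq_self_of_subset_right hsmall, hfirst, sub_zero, mul_one] at h1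
    have h2 := congrArg norm h1
    rw [norm_mul, RCLike.norm_conj, ← sq] at h2
    rw [h2]
    simp
  · refine Measurable.mul ?_ (measurable_addChar_comp hψ (by fun_prop))
    have : (fun q : ℚ_[p] × ℚ_[p] => charExt χ q.2⁻¹) = fun q => (charExt χ q.2)⁻¹ :=
      funext fun q => map_inv₀ _ _
    rw [this]
    exact (measurable_charExt_comp χ measurable_snd).inv
  · exact norm_charExt_mul_addChar_le _ _

/-- The integral over an annulus only sees the sphere at the conductor. -/
theorem integral_annulus (hψ : IsUnramifiedAdd ψ) (hc : 1 ≤ charConductorExponent χ) (r n : ℤ)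
    (hn : (charConductorExponent χ : ℤ) ≤ n) :
    ∫ x in closedBall (0 : ℚ_[p]) ((p : ℝ) ^ n),
      (if (p : ℝ) ^ r ≤ ‖x‖ then charExt χ x * (‖x‖ : ℂ)⁻¹ else 0) * (ψ (-x) : ℂ) =
      if r ≤ charConductorExponent χ then
        (p : ℂ) ^ (-(charConductorExponent χ : ℤ)) * sphereIntegral ψ χ (charConductorExponent χ)
      else 0 := by
  set c := charConductorExponent χ with hcdef
  have hcongr : ∀ k : ℤ, Set.EqOn
      (fun x : ℚ_[p] => (if (p : ℝ) ^ r ≤ ‖x‖ then charExt χ x * (‖x‖ : ℂ)⁻¹ else 0) * (ψ (-x) : ℂ))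
      (fun x => (if r ≤ k then (p : ℂ) ^ (-k) else 0) * (charExt χ x * ψ (-x)))
      (sphere (0 : ℚ_[p]) ((p : ℝ) ^ k)) := fun k x hx => by
    rw [mem_sphere, dist_zero_right] at hx
    simp only [hx, zpow_prime_le_iff]
    split_ifs
    · rw [Complex.ofReal_zpow, Complex.ofReal_natCast, zpow_neg]
      ring
    · rw [zero_mul, zero_mul]
  have hbase : ∀ k : ℤ, k < r → ∫ x in closedBall (0 : ℚ_[p]) ((p : ℝ) ^ k),
      (if (p : ℝ) ^ r ≤ ‖x‖ then charExt χ x * (‖x‖ : ℂ)⁻¹ else 0) * (ψ (-x) : ℂ) = 0 := by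
    intro k hk
    refine setIntegral_eq_zero_of_forall_eq_zero fun x hx => ?_
    rw [mem_closedBall, dist_zero_right] at hx
    rw [if_neg, zero_mul]
    exact not_le.2 (hx.trans_lt (zpow_prime_lt_iff.2 hk))
  have hmeas : Measurable fun x : ℚ_[p] =>
      (if (p : ℝ) ^ r ≤ ‖x‖ then charExt χ x * (‖x‖ : ℂ)⁻¹ else 0) * (ψ (-x) : ℂ) := by
    refine Measurable.mul (Measurable.ite (measurableSet_le measurable_const measurable_norm) ?_
      measurable_const) (measurable_addChar_comp hψ (by fun_prop))
    exact (measurable_charExt χ).mul (Complex.measurable_ofReal.comp measurable_norm).inv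
  have hbound : ∀ x : ℚ_[p], ‖(if (p : ℝ) ^ r ≤ ‖x‖ then charExt χ x * (‖x‖ : ℂ)⁻¹ else 0) *
      (ψ (-x) : ℂ)‖ ≤ ((p : ℝ) ^ r)⁻¹ := fun x => by
    rw [norm_mul, norm_addChar_coe, mul_one]
    split_ifs with h
    · rw [norm_mul, norm_inv, Complex.norm_real, norm_norm]
      calc _ ≤ 1 * ‖x‖⁻¹ := by gcongr; exact norm_charExt_le _ _
        _ ≤ _ := by rw [one_mul]; exact inv_anti₀ (zpow_prime_pos r) h
    · rw [norm_zero]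
      exact (inv_pos.2 (zpow_prime_pos r)).le
  -- Induction on the radius, adding one sphere at a time. It starts at `r - 1`, where the integrand
  -- is still zero, and only the sphere of radius `p ^ c` contributes.
  have key : ∀ k : ℤ, r - 1 ≤ k → ∫ x in closedBall (0 : ℚ_[p]) ((p : ℝ) ^ k),
      (if (p : ℝ) ^ r ≤ ‖x‖ then charExt χ x * (‖x‖ : ℂ)⁻¹ else 0) * (ψ (-x) : ℂ) =
      if r ≤ c ∧ (c : ℤ) ≤ k then (p : ℂ) ^ (-(c : ℤ)) * sphereIntegral ψ χ c else 0 := by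
    intro k hk
    induction k, hk using Int.leInduction with
    | base => rw [hbase _ (by omega), if_neg (by omega)]
    | succ k hk ih =>
      have h1 := setIntegral_sphere (k + 1) (integrableOn_closedBall hmeas hbound 0 _)
      rw [add_sub_cancel_right, ih, setIntegral_congr_fun (measurableSet_sphere _) (hcongr _),
        integral_const_mul, if_pos (by omega : r ≤ k + 1)] at h1
      rw [sub_eq_iff_eq_add.1 h1.symm]
      change (p : ℂ) ^ (-(k + 1)) * sphereIntegral ψ χ (k + 1) + _ = _
      rcases eq_or_ne (k + 1) (c : ℤ) with hkc | hkc
      · rw [hkc, if_neg (by omega), if_pos (by omega), add_zero]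
      · rw [sphereIntegral_eq_zero hψ hc hkc, mul_zero, zero_add]
        congr 1
        exact propext (by omega)
  rcases le_or_gt (r - 1) n with h | h
  · rw [key n h]
    simp only [hn, and_true]
  · rw [hbase n (by omega), if_neg (by omega)]

end LocalWhittaker

namespace LocalWhittaker

variable {p : ℕ} [Fact p.Prime] {χ₁ χ₂ : UnitaryChar p}

/-! ### Values of the Whittaker function of the vector supported on the big cell -/

theorem principalSeries_scalar (d : ℚ_[p]ˣ) (f : principalSeriesSpace χ₁ χ₂) :
    principalSeries χ₁ χ₂ (upper d 0 d) f = ((χ₁ d : ℂ) * (χ₂ d : ℂ)) • f := by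
  refine Subtype.ext (funext fun g => ?_)
  change f.1 (g * upper d 0 d) = _ * f.1 g
  rw [← upper_scalar_mul_comm, apply_upper_mul, div_self d.ne_zero]
  simp

theorem principalSeries_unip_bigCellVec {t : ℚ_[p]} (ht : ‖t‖ ≤ 1) :
    principalSeries χ₁ χ₂ (unip t) (bigCellVec χ₁ χ₂) = bigCellVec χ₁ χ₂ := by
  refine eq_of_cellFun_eq fun x => ?_
  have h : ‖x + t‖ ≤ 1 ↔ ‖x‖ ≤ 1 :=
    ⟨fun h => by simpa using norm_sub_le_of_le h ht, fun h => norm_add_le_of_le h ht⟩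
  simp only [cellFun_unip, cellFun_bigCellVec, h]

section Values

variable {ψ : AddChar ℚ_[p] Circle} (hψ : IsUnramifiedAdd ψ) {x₀ : ℚ_[p]} (hx₀ : ψ x₀ ≠ 1)

theorem norm_whittaker_scalar_mul (f : principalSeriesSpace χ₁ χ₂) (d : ℚ_[p]ˣ) (g : G p) :
    ‖whittakerFunctional hψ hx₀ χ₁ χ₂ (principalSeries χ₁ χ₂ (upper d 0 d * g) f)‖ =
      ‖whittakerFunctional hψ hx₀ χ₁ χ₂ (principalSeries χ₁ χ₂ g f)‖ := by
  rw [map_mul, Module.End.mul_apply, principalSeries_scalar, map_smul, norm_smul, norm_mul,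
    Circle.norm_coe, Circle.norm_coe, one_mul, one_mul]

theorem norm_whittaker_upper_mul (f : principalSeriesSpace χ₁ χ₂) (a d : ℚ_[p]ˣ) (b : ℚ_[p])
    (g : G p) :
    ‖whittakerFunctional hψ hx₀ χ₁ χ₂ (principalSeries χ₁ χ₂ (upper a b d * g) f)‖ =
      ‖whittakerFunctional hψ hx₀ χ₁ χ₂ (principalSeries χ₁ χ₂ (upper (a / d) 0 1 * g) f)‖ := by
  rw [upper_eq, mul_assoc, mul_assoc, map_mul, Module.End.mul_apply, whittakerFunctional_unip,
    norm_mul, Circle.norm_coe, one_mul, norm_whittaker_scalar_mul]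

theorem cellFun_bigCellVec_weyl (y : ℚ_[p]ˣ) (x : ℚ_[p]) :
    cellFun (principalSeries χ₁ χ₂ (upper y 0 1 * weyl p) (bigCellVec χ₁ χ₂)) x =
      charExt χ₁ y * (Real.sqrt ‖(y : ℚ_[p])‖ : ℂ) * bigCellRow (χ₂ * χ₁⁻¹) x y := by
  rw [cellFun_principalSeries, bigCellVec_apply, rowFun, gdet_mul, gdet_mul, gdet_mul, gdet_weyl,
    gdet_unip, gdet_upper]
  simp [mul_entry, coe_weyl, coe_unip, coe_upper]

theorem cellFun_bigCellVec_lower (y : ℚ_[p]ˣ) {z : ℚ_[p]} (hz : ‖z‖ < 1) (x : ℚ_[p]) :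
    cellFun (principalSeries χ₁ χ₂ (upper y 0 1 * lower z) (bigCellVec χ₁ χ₂)) x =
      charExt χ₁ (-y) * (Real.sqrt ‖(y : ℚ_[p])‖ : ℂ) * (‖(y : ℚ_[p])‖ : ℂ)⁻¹ *
        if ‖x‖ ≤ ‖(y : ℚ_[p])‖ then charExt (χ₂ * χ₁⁻¹) (y + x * z) else 0 := by
  rw [cellFun_principalSeries, bigCellVec_apply, rowFun, gdet_mul, gdet_mul, gdet_mul, gdet_weyl,
    gdet_unip, gdet_upper, gdet_lower]
  have e : bigCellRow (χ₂ * χ₁⁻¹) (y + x * z) x = (‖(y : ℚ_[p])‖ : ℂ)⁻¹ *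
      if ‖x‖ ≤ ‖(y : ℚ_[p])‖ then charExt (χ₂ * χ₁⁻¹) (y + x * z) else 0 := by
    have hy := norm_pos_iff.2 y.ne_zero
    rw [bigCellRow]
    rcases le_or_gt ‖x‖ ‖(y : ℚ_[p])‖ with h | h
    · have h1 : ‖(y : ℚ_[p]) + x * z‖ = ‖(y : ℚ_[p])‖ := norm_add_eq_left (by
        rw [norm_mul]
        exact (mul_le_mul_of_nonneg_right h (norm_nonneg _)).trans_lt (mul_lt_of_lt_one_right hy hz))
      rw [h1, if_pos h, if_pos h, mul_comm]
    · have h1 : ‖(y : ℚ_[p]) + x * z‖ < ‖x‖ := by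
        refine (IsUltrametricDist.norm_add_le_max _ _).trans_lt (max_lt h ?_)
        rw [norm_mul]
        exact mul_lt_of_lt_one_right (hy.trans h) hz
      rw [if_neg h1.not_ge, if_neg h.not_ge, mul_zero]
  have h10 : (weyl p * unip x * (upper y 0 1 * lower z)) 1 0 = y + x * z := by
    simp [mul_entry, coe_weyl, coe_unip, coe_upper, coe_lower]
  have h11 : (weyl p * unip x * (upper y 0 1 * lower z)) 1 1 = x := by
    simp [mul_entry, coe_weyl, coe_unip, coe_upper, coe_lower]
  rw [h10, h11, e, ← mul_assoc]
  simp

/-- The big cell function is here `χ(x) ‖x‖⁻¹` on `‖x‖ ≥ ‖y‖`, up to a factor of absolute value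
`√‖y‖`. `integral_annulus` retains the Gauss sum at radius `p ^ c`, provided that this sphere lies
in the domain. -/
theorem norm_sq_whittaker_weyl (hc : 1 ≤ charConductorExponent (χ₂ * χ₁⁻¹)) (y : ℚ_[p]ˣ) :
    ‖whittakerFunctional hψ hx₀ χ₁ χ₂ (principalSeries χ₁ χ₂ (upper y 0 1 * weyl p)
      (bigCellVec χ₁ χ₂))‖ ^ 2 =
      if ‖(y : ℚ_[p])‖ ≤ (p : ℝ) ^ (charConductorExponent (χ₂ * χ₁⁻¹) : ℤ) then
        ‖(y : ℚ_[p])‖ * (p : ℝ) ^ (-(charConductorExponent (χ₂ * χ₁⁻¹) : ℤ)) else 0 := by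
  set χ := χ₂ * χ₁⁻¹ with hχ
  set c := charConductorExponent χ with hcdef
  obtain ⟨r, hr⟩ := exists_norm_eq_zpow y.ne_zero
  obtain ⟨n, h1, h2⟩ := ((eventually_whittakerFunctional_eq hψ hx₀
    (principalSeries χ₁ χ₂ (upper y 0 1 * weyl p) (bigCellVec χ₁ χ₂))).and
    (eventually_ge_atTop (c : ℤ))).exists
  rw [h1, cellIntegral]
  simp_rw [cellFun_bigCellVec_weyl, mul_assoc]
  rw [integral_const_mul, integral_const_mul]
  simp only [bigCellRow, hr]
  rw [← hχ, integral_annulus hψ hc r n h2, norm_mul, norm_mul, norm_charExt _ y.ne_zero, one_mul,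
    Complex.norm_real, Real.norm_of_nonneg (Real.sqrt_nonneg _), mul_pow,
    Real.sq_sqrt (zpow_prime_pos r).le]
  simp only [zpow_prime_le_iff]
  split_ifs
  · rw [norm_mul, mul_pow, norm_sq_sphereIntegral hψ hc, norm_zpow, Complex.norm_natCast, ← hcdef,
      ← zpow_natCast (p : ℝ) c, sq, ← zpow_add₀ prime_cast_pos.ne', ← zpow_add₀ prime_cast_pos.ne']
    congr 2
    ring
  · simp

/-- The function is supported on `‖x‖ ≤ ‖y‖`; the substitution `x = y t` turns the integral into
`unitIntegral`, up to factors of absolute value 1 and powers of `‖y‖`. -/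
theorem norm_whittaker_lower (y : ℚ_[p]ˣ) {z : ℚ_[p]} (hz : ‖z‖ < 1) :
    ‖whittakerFunctional hψ hx₀ χ₁ χ₂ (principalSeries χ₁ χ₂ (upper y 0 1 * lower z)
      (bigCellVec χ₁ χ₂))‖ =
      Real.sqrt ‖(y : ℚ_[p])‖ * ‖unitIntegral ψ (χ₂ * χ₁⁻¹) z y‖ := by
  set χ := χ₂ * χ₁⁻¹ with hχ
  have hy := norm_pos_iff.2 y.ne_zero
  obtain ⟨n, h1, h2⟩ := ((eventually_whittakerFunctional_eq hψ hx₀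
    (principalSeries χ₁ χ₂ (upper y 0 1 * lower z) (bigCellVec χ₁ χ₂))).and
    (eventually_norm_le_zpow (y : ℚ_[p]))).exists
  have h3 : ∀ x, (if ‖x‖ ≤ ‖(y : ℚ_[p])‖ then charExt χ (y + x * z) else 0) * (ψ (-x) : ℂ) =
      (closedBall (0 : ℚ_[p]) ‖(y : ℚ_[p])‖).indicator
        (fun x => charExt χ (y + x * z) * (ψ (-x) : ℂ)) x := fun x => by
    by_cases hx : ‖x‖ ≤ ‖(y : ℚ_[p])‖
    · rw [if_pos hx, Set.indicator_of_mem (by simpa using hx)]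
    · rw [if_neg hx, zero_mul, Set.indicator_of_notMem (by simpa using hx)]
  have h4 := setIntegral_comp_mul (fun x => charExt χ ((y : ℚ_[p]) + x * z) * (ψ (-x) : ℂ))
    (measurableSet_closedBall (x := (0 : ℚ_[p])) (ε := 1))
    (measurableSet_closedBall (x := (0 : ℚ_[p])) (ε := ‖(y : ℚ_[p])‖)) y.ne_zero (fun x => by
      simp only [mem_closedBall, dist_zero_right, norm_mul]
      exact mul_le_iff_le_one_right hy)
  have h5 : ∀ t : ℚ_[p], charExt χ (y + y * t * z) * (ψ (-(y * t)) : ℂ) =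
      charExt χ y * (charExt χ (1 + t * z) * (ψ (-(y * t)) : ℂ)) := fun t => by
    rw [show (y : ℚ_[p]) + y * t * z = y * (1 + t * z) by ring, map_mul, mul_assoc]
  simp_rw [h5] at h4
  rw [integral_const_mul] at h4
  rw [h1, cellIntegral]
  simp_rw [cellFun_bigCellVec_lower y hz, mul_assoc, ← hχ, h3]
  rw [integral_const_mul, integral_const_mul, integral_const_mul,
    setIntegral_indicator measurableSet_closedBall,
    Set.inter_eq_self_of_subset_right (closedBall_subset_closedBall h2), ← h4, norm_mul, norm_mul,
    norm_mul, norm_charExt _ (neg_ne_zero.2 y.ne_zero), norm_charExt _ y.ne_zero, one_mul, one_mul,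
    Complex.norm_real, Real.norm_of_nonneg (Real.sqrt_nonneg _), unitIntegral]

/-- By the Iwasawa decomposition only two kinds of elements remain: near `w` the Gauss sum gives at
most 1, and the lower unipotent elements give the bound with `⌊c/2⌋`. -/
theorem norm_whittaker_bigCellVec_le (hc : 1 ≤ charConductorExponent (χ₂ * χ₁⁻¹)) (g : G p) :
    ‖whittakerFunctional hψ hx₀ χ₁ χ₂ (principalSeries χ₁ χ₂ g (bigCellVec χ₁ χ₂))‖ ≤
      Real.sqrt ((p : ℝ) ^ (charConductorExponent (χ₂ * χ₁⁻¹) / 2)) := by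
  apply Real.le_sqrt_of_sq_le
  rcases eq_upper_mul_weyl_or_lower g with ⟨a, b, d, t, ht, rfl⟩ | ⟨a, b, d, z, hz, rfl⟩
  · rw [← mul_assoc, map_mul, Module.End.mul_apply, principalSeries_unip_bigCellVec ht,
      norm_whittaker_upper_mul, norm_sq_whittaker_weyl hψ hx₀ hc]
    have hone : (1 : ℝ) ≤ (p : ℝ) ^ (charConductorExponent (χ₂ * χ₁⁻¹) / 2) :=
      one_le_pow₀ one_lt_prime_cast.le
    split_ifs with h
    · refine le_trans ?_ hone
      rw [zpow_neg, ← div_eq_mul_inv]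
      exact div_le_one_of_le₀ h (zpow_prime_pos _).le
    · exact zero_le_one.trans hone
  · rw [norm_whittaker_upper_mul, norm_whittaker_lower hψ hx₀ _ hz, mul_pow,
      Real.sq_sqrt (norm_nonneg _)]
    exact norm_mul_sq_unitIntegral_le hψ _ hz (Units.ne_zero _)

theorem norm_whittaker_bigCellVec_one :
    ‖whittakerFunctional hψ hx₀ χ₁ χ₂ (bigCellVec χ₁ χ₂)‖ = 1 := by
  rw [whittakerFunctional_bigCellVec, norm_charExt _ (neg_ne_zero.2 one_ne_zero)]

theorem exists_norm_whittaker_bigCellVec_eq (hc : 1 ≤ charConductorExponent (χ₂ * χ₁⁻¹)) :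
    ∃ g, ‖whittakerFunctional hψ hx₀ χ₁ χ₂ (principalSeries χ₁ χ₂ g (bigCellVec χ₁ χ₂))‖ =
      Real.sqrt ((p : ℝ) ^ (charConductorExponent (χ₂ * χ₁⁻¹) / 2)) := by
  set c := charConductorExponent (χ₂ * χ₁⁻¹) with hcdef
  rcases Nat.eq_zero_or_pos (c / 2) with h0 | h0
  · refine ⟨1, ?_⟩
    rw [map_one, Module.End.one_apply, norm_whittaker_bigCellVec_one, h0, pow_zero, Real.sqrt_one]
  -- With `j = c - ⌊c/2⌋ ≥ ⌊c/2⌋` the character is additive on `1 + p ^ j ℤ_p`, so `unitIntegral`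
  -- equals 1 there and the value is `√‖y‖`. For `⌊c/2⌋ = 0` the point `g = 1` already suffices.
  · obtain ⟨y, hy, h⟩ := exists_charExt_eq_addChar hψ (χ := χ₂ * χ₁⁻¹) (m := c / 2)
      (j := c - c / 2) h0 (by omega) (by omega)
    have hy0 : y ≠ 0 := norm_pos_iff.1 (hy ▸ pow_pos prime_cast_pos _)
    refine ⟨upper (Units.mk0 y hy0) 0 1 * lower ((p : ℚ_[p]) ^ (c - c / 2)), ?_⟩
    rw [norm_whittaker_lower, Units.val_mk0, unitIntegral_eq_one h, hy, norm_one, mul_one]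
    rw [← zpow_natCast, norm_prime_zpow]
    exact neg_zpow_lt_one (by omega)

/-- Up to a scalar matrix the Atkin-Lehner element is `diag(p ^ (-c), 1) w`, at the edge `‖y‖ = p ^
c` of the support on the coset of `w`, where the value has absolute value exactly 1. -/
theorem norm_whittaker_atkinLehner (hc : 1 ≤ charConductorExponent (χ₂ * χ₁⁻¹)) :
    ‖whittakerFunctional hψ hx₀ χ₁ χ₂ (principalSeries χ₁ χ₂
      (atkinLehner p (charConductorExponent (χ₂ * χ₁⁻¹))) (bigCellVec χ₁ χ₂))‖ = 1 := by
  set c := charConductorExponent (χ₂ * χ₁⁻¹) with hcdef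
  set q : ℚ_[p]ˣ := Units.mk0 ((p : ℚ_[p]) ^ c) (pow_ne_zero _ prime_padic_ne_zero) with hq
  have hqn : ‖((q⁻¹ : ℚ_[p]ˣ) : ℚ_[p])‖ = (p : ℝ) ^ (c : ℤ) := by
    rw [Units.val_inv_eq_inv_val, norm_inv, hq, Units.val_mk0, ← zpow_natCast, norm_prime_zpow,
      zpow_neg, inv_inv]
  have e : atkinLehner p c = upper q 0 q * (upper q⁻¹ 0 1 * weyl p) := by
    apply gl_ext <;> simp [mul_entry, coe_upper, coe_weyl, coe_atkinLehner, hq]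
  rw [e, norm_whittaker_scalar_mul, ← sq_eq_sq₀ (norm_nonneg _) zero_le_one,
    norm_sq_whittaker_weyl hψ hx₀ hc, if_pos hqn.le, hqn, ← hcdef,
    ← zpow_add₀ prime_cast_pos.ne', add_neg_cancel, zpow_zero, one_pow]

end Values

end LocalWhittaker

namespace LocalWhittaker

variable {p : ℕ} [Fact p.Prime] {χ₁ χ₂ : UnitaryChar p}

/-! ### Values of the spherical Whittaker function -/

/-- The integral that gives the spherical Whittaker function on diagonal matrices. -/
noncomputable def sphericalIntegral (ψ : AddChar ℚ_[p] Circle) (χ : UnitaryChar p) (y : ℚ_[p])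
    (n : ℤ) : ℂ :=
  ∫ x in closedBall (0 : ℚ_[p]) ((p : ℝ) ^ n), sphericalRow χ y x * ψ (-x)

section Integral

variable {ψ : AddChar ℚ_[p] Circle} {χ : UnitaryChar p}

theorem integrableOn_sphericalRow_mul (hψ : IsUnramifiedAdd ψ) {y : ℚ_[p]} (hy : y ≠ 0) (r : ℝ) :
    IntegrableOn (fun x => sphericalRow χ y x * (ψ (-x) : ℂ)) (closedBall (0 : ℚ_[p]) r) := by
  have hy' := norm_pos_iff.2 hy
  refine integrableOn_closedBall (C := ‖y‖⁻¹) (Measurable.mul (Measurable.ite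
    (measurableSet_le measurable_norm measurable_const) measurable_const
    ((measurable_charExt χ).mul (Complex.measurable_ofReal.comp measurable_norm).inv))
    (measurable_addChar_comp hψ (by fun_prop))) (fun x => ?_) _ _
  change ‖sphericalRow χ y x * (ψ (-x) : ℂ)‖ ≤ _
  rw [norm_mul, norm_addChar_coe, mul_one, sphericalRow]
  split_ifs with h <;> rw [norm_mul, norm_inv, Complex.norm_real, norm_norm]
  · exact mul_le_of_le_one_left (inv_nonneg.2 hy'.le) (norm_charExt_le _ _)
  · exact (mul_le_of_le_one_left (inv_nonneg.2 (norm_nonneg _)) (norm_charExt_le _ _)).trans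
      (inv_anti₀ hy' (not_le.1 h).le)

/-- The integrands for `p y` and `y` agree for `‖x‖ ≥ ‖y‖`. On the remaining ball `‖x‖ ≤ ‖p y‖ ≤ 1`
the character `ψ` is trivial and the two row functions differ by a constant. -/
theorem sphericalIntegral_prime_mul (hψ : IsUnramifiedAdd ψ) (hχ : IsUnramified χ) {y : ℚ_[p]}
    (hy : y ≠ 0) (hpy : ‖(p : ℚ_[p]) * y‖ ≤ 1) {n : ℤ} (hn : 0 ≤ n) :
    sphericalIntegral ψ χ (p * y) n = sphericalIntegral ψ χ y n +
      charExt χ (p * y) * (1 - (charExt χ p)⁻¹ * (p : ℂ)⁻¹) := by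
  have hp0 := prime_padic_ne_zero (p := p)
  have hpc : (p : ℂ) ≠ 0 := by exact_mod_cast (Fact.out : p.Prime).ne_zero
  obtain ⟨k, hk⟩ := exists_norm_eq_zpow hy
  have hk' : ‖(p : ℚ_[p]) * y‖ = (p : ℝ) ^ (k - 1) := by
    rw [norm_mul, hk, Padic.norm_p, zpow_sub_one₀ prime_cast_pos.ne', mul_comm]
  set D : ℂ := charExt χ (p * y) * (‖(p : ℚ_[p]) * y‖ : ℂ)⁻¹ - charExt χ y * (‖y‖ : ℂ)⁻¹ with hD
  have hkn : k - 1 ≤ n := by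
    rw [hk', ← zpow_zero (p : ℝ), zpow_prime_le_iff] at hpy
    omega
  have h1 : ∀ x, sphericalRow χ (p * y) x * (ψ (-x) : ℂ) - sphericalRow χ y x * (ψ (-x) : ℂ) =
      (closedBall (0 : ℚ_[p]) ((p : ℝ) ^ (k - 1))).indicator (fun _ => D) x := fun x => by
    rw [← sub_mul]
    by_cases hx : ‖x‖ ≤ (p : ℝ) ^ (k - 1)
    · rw [Set.indicator_of_mem (by simpa using hx), hψ.eq_one, Circle.coe_one, mul_one, sphericalRow,
        if_pos (hx.trans hk'.ge), sphericalRow, if_pos]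
      · rw [hk]
        exact (norm_lt_zpow_iff.2 hx).le
      · rw [norm_neg]
        exact (hx.trans hk'.ge).trans hpy
    · rw [Set.indicator_of_notMem (by simpa using hx), sphericalRow_congr hχ (c' := y) (d' := x),
        sub_self, zero_mul]
      rw [max_eq_right (by rw [hk']; exact (not_le.1 hx).le), max_eq_right]
      rw [← norm_lt_zpow_iff, not_lt] at hx
      exact hk.trans_le hx
  have h2 : sphericalIntegral ψ χ (p * y) n - sphericalIntegral ψ χ y n =
      D * (‖(p : ℚ_[p]) * y‖ : ℂ) := by
    rw [sphericalIntegral, sphericalIntegral,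
      ← integral_sub (integrableOn_sphericalRow_mul hψ (mul_ne_zero hp0 hy) _)
        (integrableOn_sphericalRow_mul hψ hy _)]
    simp_rw [h1]
    rw [setIntegral_indicator measurableSet_closedBall, Set.inter_eq_self_of_subset_right
      (closedBall_subset_closedBall (zpow_prime_le_iff.2 hkn)), setIntegral_const,
      volume_real_closedBall_zpow, hk', Complex.real_smul, mul_comm]
  rw [← sub_eq_iff_eq_add', h2, hD, map_mul, norm_mul, Padic.norm_p]
  have hy' : (‖y‖ : ℂ) ≠ 0 := by exact_mod_cast norm_ne_zero_iff.2 hy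
  have hz := charExt_ne_zero χ hp0
  push_cast
  field_simp

end Integral

variable {ψ : AddChar ℚ_[p] Circle} (hψ : IsUnramifiedAdd ψ) {x₀ : ℚ_[p]} (hx₀ : ψ x₀ ≠ 1)
  (h1 : IsUnramified χ₁) (h2 : IsUnramified χ₂)

/-- The spherical vector as an element of the principal series. -/
noncomputable def sphericalVec : principalSeriesSpace χ₁ χ₂ := ⟨_, sphericalFun_mem h1 h2⟩

theorem isK1Fixed_sphericalVec : IsK1Fixed (principalSeries χ₁ χ₂) 0 (sphericalVec h1 h2) :=
  isK1Fixed_iff.2 fun _ hk g => sphericalFun_mul h1 h2 hk.1 hk.2.1 g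

theorem cellIntegral_sphericalVec (y : ℚ_[p]ˣ) (n : ℤ) :
    cellIntegral ψ (principalSeries χ₁ χ₂ (upper y 0 1) (sphericalVec h1 h2)) n =
      charExt χ₁ (-y) * (Real.sqrt ‖(y : ℚ_[p])‖ : ℂ) *
        sphericalIntegral ψ (χ₂ * χ₁⁻¹) y n := by
  have h : ∀ x, cellFun (principalSeries χ₁ χ₂ (upper y 0 1) (sphericalVec h1 h2)) x =
      charExt χ₁ (-y) * (Real.sqrt ‖(y : ℚ_[p])‖ : ℂ) * sphericalRow (χ₂ * χ₁⁻¹) y x := fun x => by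
    rw [cellFun_principalSeries]
    change rowFun χ₁ (sphericalRow (χ₂ * χ₁⁻¹)) _ = _
    rw [rowFun, gdet_mul, gdet_mul, gdet_weyl, gdet_unip, gdet_upper]
    simp [mul_entry, coe_weyl, coe_unip, coe_upper]
  rw [cellIntegral, sphericalIntegral]
  simp_rw [h, mul_assoc]
  rw [integral_const_mul, integral_const_mul]

/-- Invariance under `n(1)` becomes, after conjugation by `diag(y, 1)`, invariance of the value
under multiplication by `ψ(y) ≠ 1`. -/
theorem whittaker_sphericalVec_eq_zero {y : ℚ_[p]ˣ} (hy : 1 < ‖(y : ℚ_[p])‖) :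
    whittakerFunctional hψ hx₀ χ₁ χ₂
      (principalSeries χ₁ χ₂ (upper y 0 1) (sphericalVec h1 h2)) = 0 := by
  refine eq_zero_of_eq_mul_self (addChar_coe_ne_one (x := (y : ℚ_[p]))
    (by rw [Ne, hψ.eq_one_iff]; exact hy.not_ge)) ?_
  have e : unip (y : ℚ_[p]) * upper y 0 1 = upper y 0 1 * unip 1 := by
    apply gl_ext <;> simp [mul_entry, coe_upper, coe_unip]
  have h3 := isK1Fixed_sphericalVec h1 h2 (unip 1) (upper_mem_K1 (by simp) (by simp) (by simp)
    (by simp))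
  rw [← whittakerFunctional_unip, ← Module.End.mul_apply, ← map_mul, e, map_mul,
    Module.End.mul_apply, h3]

include hψ hx₀ h1 h2 in
theorem eventually_sphericalIntegral_eq_zero {y : ℚ_[p]} (hy : 1 < ‖y‖) :
    ∀ᶠ n in atTop, sphericalIntegral ψ (χ₂ * χ₁⁻¹) y n = 0 := by
  have hy0 : y ≠ 0 := norm_pos_iff.1 (zero_lt_one.trans hy)
  filter_upwards [eventually_whittakerFunctional_eq hψ hx₀
    (principalSeries χ₁ χ₂ (upper (Units.mk0 y hy0) 0 1) (sphericalVec h1 h2))] with n hn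
  rw [whittaker_sphericalVec_eq_zero hψ hx₀ h1 h2 (by simpa using hy),
    cellIntegral_sphericalVec] at hn
  refine (mul_eq_zero.1 hn.symm).resolve_left (mul_ne_zero (charExt_ne_zero _ (by simpa using hy0)) ?_)
  exact_mod_cast (Real.sqrt_pos.2 (norm_pos_iff.2 hy0)).ne'

include hψ hx₀ h1 h2 in
-- Starting from the vanishing at `‖y‖ = p`, each multiplication of `y` by `p` adds one term of the
-- same absolute value.
theorem eventually_norm_sphericalIntegral_le (r : ℕ) : ∀ {y : ℚ_[p]},
    ‖y‖ = (p : ℝ) ^ (1 - (r : ℤ)) → ∀ᶠ n in atTop, ‖sphericalIntegral ψ (χ₂ * χ₁⁻¹) y n‖ ≤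
      r * ‖1 - (charExt (χ₂ * χ₁⁻¹) p)⁻¹ * (p : ℂ)⁻¹‖ := by
  induction r with
  | zero =>
    intro y hy
    filter_upwards [eventually_sphericalIntegral_eq_zero hψ hx₀ h1 h2 (y := y)
      (by rw [hy]; simpa using one_lt_prime_cast)] with n hn
    simp [hn]
  | succ r ih =>
    intro y hy
    have hp0 := prime_padic_ne_zero (p := p)
    have e : (p : ℚ_[p]) * (y / p) = y := mul_div_cancel₀ y hp0
    have hy0 : y ≠ 0 := norm_pos_iff.1 (hy ▸ zpow_prime_pos _)
    have hy' : ‖y / (p : ℚ_[p])‖ = (p : ℝ) ^ (1 - (r : ℤ)) := by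
      rw [norm_div, hy, Padic.norm_p, div_inv_eq_mul, ← zpow_add_one₀ prime_cast_pos.ne']
      congr 1
      push_cast
      ring
    filter_upwards [ih hy', eventually_ge_atTop 0] with n hn h0
    have h3 := sphericalIntegral_prime_mul hψ (isUnramified_mul_inv h1 h2) (div_ne_zero hy0 hp0)
      (by rw [e, hy, ← zpow_zero (p : ℝ), zpow_prime_le_iff]; push_cast; omega) h0
    rw [e] at h3
    rw [h3]
    refine (norm_add_le _ _).trans ?_
    rw [norm_mul, norm_charExt _ hy0]
    push_cast
    linarith

theorem norm_whittaker_sphericalVec_one :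
    ‖whittakerFunctional hψ hx₀ χ₁ χ₂ (sphericalVec h1 h2)‖ =
      ‖1 - (charExt (χ₂ * χ₁⁻¹) p)⁻¹ * (p : ℂ)⁻¹‖ := by
  have hp0 := prime_padic_ne_zero (p := p)
  have hpi : ‖(p : ℚ_[p])⁻¹‖ = p := by rw [norm_inv, Padic.norm_p, inv_inv]
  obtain ⟨n, h3, h4, h5⟩ := ((eventually_whittakerFunctional_eq hψ hx₀
    (principalSeries χ₁ χ₂ (upper 1 0 1) (sphericalVec h1 h2))).and
    ((eventually_sphericalIntegral_eq_zero hψ hx₀ h1 h2 (y := (p : ℚ_[p])⁻¹)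
      (by rw [hpi]; exact one_lt_prime_cast)).and (eventually_ge_atTop 0))).exists
  have h6 := sphericalIntegral_prime_mul hψ (isUnramified_mul_inv h1 h2) (inv_ne_zero hp0)
    (by rw [mul_inv_cancel₀ hp0]; simp) h5
  rw [mul_inv_cancel₀ hp0, h4, map_one, zero_add, one_mul] at h6
  rw [cellIntegral_sphericalVec, Units.val_one, h6, upper_one_one, map_one, Module.End.one_apply] at h3
  rw [h3, norm_mul, norm_mul, norm_charExt _ (neg_ne_zero.2 one_ne_zero)]
  simp

theorem whittaker_sphericalVec_ne_zero :
    whittakerFunctional hψ hx₀ χ₁ χ₂ (sphericalVec h1 h2) ≠ 0 := by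
  rw [← norm_ne_zero_iff, norm_whittaker_sphericalVec_one, norm_ne_zero_iff, sub_ne_zero]
  intro h
  have h3 := congrArg norm h
  rw [norm_mul, norm_inv, norm_charExt _ prime_padic_ne_zero, norm_one, inv_one, one_mul, norm_inv,
    Complex.norm_natCast] at h3
  exact (inv_lt_one_of_one_lt₀ (one_lt_prime_cast (p := p))).ne' h3

/-- The bound behind the condition `p ≥ 5`: already for `r = 1` it needs a base of at least 4. -/
theorem succ_sq_le_five_pow (r : ℕ) : (r + 1) ^ 2 ≤ 5 ^ r := by
  induction r with
  | zero => norm_num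
  | succ r ih =>
    rw [pow_succ 5]
    nlinarith [Nat.zero_le (r * r)]

/-- At `‖y‖ = p ^ (-r)` the ratio to the value at 1 is at most `(r + 1) p ^ (-r/2) ≤ 1`. Invariance
under `GL(2, ℤ_p)` reduces every `g` to such a diagonal matrix. -/
theorem norm_whittaker_sphericalVec_le (hp : 5 ≤ p) (g : G p) :
    ‖whittakerFunctional hψ hx₀ χ₁ χ₂ (principalSeries χ₁ χ₂ g (sphericalVec h1 h2))‖ ≤
      ‖whittakerFunctional hψ hx₀ χ₁ χ₂ (sphericalVec h1 h2)‖ := by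
  have key : ∀ y : ℚ_[p]ˣ,
      ‖whittakerFunctional hψ hx₀ χ₁ χ₂ (principalSeries χ₁ χ₂ (upper y 0 1) (sphericalVec h1 h2))‖ ≤
        ‖whittakerFunctional hψ hx₀ χ₁ χ₂ (sphericalVec h1 h2)‖ := fun y => by
    rcases lt_or_ge 1 ‖(y : ℚ_[p])‖ with hy | hy
    · rw [whittaker_sphericalVec_eq_zero hψ hx₀ h1 h2 hy, norm_zero]
      exact norm_nonneg _
    obtain ⟨k, hk⟩ := exists_norm_eq_zpow y.ne_zero
    obtain ⟨r, rfl⟩ : ∃ r : ℕ, k = -(r : ℤ) := by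
      rw [hk, ← zpow_zero (p : ℝ), zpow_prime_le_iff] at hy
      exact ⟨(-k).toNat, by omega⟩
    obtain ⟨n, h3, h4⟩ := ((eventually_whittakerFunctional_eq hψ hx₀
      (principalSeries χ₁ χ₂ (upper y 0 1) (sphericalVec h1 h2))).and
      (eventually_norm_sphericalIntegral_le hψ hx₀ h1 h2 (r + 1) (y := y)
        (by rw [hk]; congr 1; push_cast; ring))).exists
    rw [norm_whittaker_sphericalVec_one, h3, cellIntegral_sphericalVec, norm_mul, norm_mul,
      norm_charExt _ (neg_ne_zero.2 y.ne_zero), one_mul, Complex.norm_real,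
      Real.norm_of_nonneg (Real.sqrt_nonneg _)]
    refine (mul_le_mul_of_nonneg_left h4 (Real.sqrt_nonneg _)).trans ?_
    rw [← mul_assoc]
    refine mul_le_of_le_one_left (norm_nonneg _) ?_
    rw [hk, ← Real.sqrt_sq (Nat.cast_nonneg (r + 1)), ← Real.sqrt_mul (zpow_prime_pos _).le,
      Real.sqrt_le_one]
    rw [zpow_neg, zpow_natCast, inv_mul_le_one₀ (pow_pos prime_cast_pos _)]
    exact_mod_cast (succ_sq_le_five_pow r).trans (Nat.pow_le_pow_left hp r)
  have fixed : ∀ (a d : ℚ_[p]ˣ) (b : ℚ_[p]) {k : G p}, k ∈ K1 p 0 →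
      ‖whittakerFunctional hψ hx₀ χ₁ χ₂
        (principalSeries χ₁ χ₂ (upper a b d * k) (sphericalVec h1 h2))‖ ≤
        ‖whittakerFunctional hψ hx₀ χ₁ χ₂ (sphericalVec h1 h2)‖ := fun a d b k hk => by
    rw [map_mul, Module.End.mul_apply, isK1Fixed_sphericalVec h1 h2 k hk, ← mul_one (upper a b d),
      norm_whittaker_upper_mul, mul_one]
    exact key _
  rcases eq_upper_mul_weyl_or_lower g with ⟨a, b, d, t, ht, rfl⟩ | ⟨a, b, d, z, hz, rfl⟩
  · refine fixed a d b ⟨fun i j => ?_, ?_, ?_, ?_⟩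
    · fin_cases i <;> fin_cases j <;> simp [mul_entry, coe_weyl, coe_unip, ht]
    · change ‖gdet _‖ = 1
      rw [gdet_mul, gdet_weyl, gdet_unip]
      simp
    · simp [mul_entry, coe_weyl, coe_unip]
    · simpa [mul_entry, coe_weyl, coe_unip] using norm_sub_le_of_le ht (norm_one (α := ℚ_[p])).le
  · exact fixed a d b (lower_mem_K1 (by simpa using hz.le))

end LocalWhittaker

namespace LocalWhittaker

variable {p : ℕ} [Fact p.Prime] {χ₁ χ₂ : UnitaryChar p}

/-! ### The local invariant -/

theorem IsK1Fixed.smul {n : ℕ} {f : principalSeriesSpace χ₁ χ₂}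
    (hf : IsK1Fixed (principalSeries χ₁ χ₂) n f) (a : ℂ) :
    IsK1Fixed (principalSeries χ₁ χ₂) n (a • f) := fun k hk => by
  rw [map_smul, hf k hk]

section WellDefined

variable {ψ : AddChar ℚ_[p] Circle} (hψ : IsUnramifiedAdd ψ) {x₀ : ℚ_[p]} (hx₀ : ψ x₀ ≠ 1)

/-- Evaluation at 1 turns any Whittaker embedding into a Whittaker functional, hence into a multiple
of the standard one. The newvector is also unique up to a scalar, and `W(1) = 1` fixes the product
of the two scalars. -/
theorem isNormalizedNewvector_iff {f₀ : principalSeriesSpace χ₁ χ₂}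
    (hf₀ : IsNewvector (principalSeries χ₁ χ₂) f₀)
    (huniq : ∀ f, IsNewvector (principalSeries χ₁ χ₂) f → ∃ a : ℂ, f = a • f₀)
    (h0 : whittakerFunctional hψ hx₀ χ₁ χ₂ f₀ ≠ 0) (W : G p → ℂ) :
    IsNormalizedNewvector (principalSeries χ₁ χ₂) ψ W ↔
      W = fun g => (whittakerFunctional hψ hx₀ χ₁ χ₂ f₀)⁻¹ *
        whittakerFunctional hψ hx₀ χ₁ χ₂ (principalSeries χ₁ χ₂ g f₀) := by
  constructor
  · rintro ⟨⟨Φ, hΦ, f, hf, rfl⟩, hW1⟩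
    obtain ⟨a, rfl⟩ := huniq f hf
    obtain ⟨C, hC⟩ := exists_eq_mul_whittakerFunctional hψ hx₀ (LinearMap.proj (1 : G p) ∘ₗ Φ)
      fun t f => by
        change Φ (principalSeries χ₁ χ₂ (unip t) f) 1 = ψ t * Φ f 1
        rw [hΦ.equivariant, one_mul, ← hΦ.whittaker, mul_one]
    have key : ∀ g, Φ (a • f₀) g = C * a *
        whittakerFunctional hψ hx₀ χ₁ χ₂ (principalSeries χ₁ χ₂ g f₀) := fun g => by
      have h1 : Φ (principalSeries χ₁ χ₂ g (a • f₀)) 1 = _ := hC _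
      rw [hΦ.equivariant, one_mul] at h1
      rw [h1, map_smul, map_smul, smul_eq_mul, mul_assoc]
    have hCa : C * a = (whittakerFunctional hψ hx₀ χ₁ χ₂ f₀)⁻¹ := by
      rw [key, map_one, Module.End.one_apply] at hW1
      exact eq_inv_of_mul_eq_one_left hW1
    funext g
    rw [key, hCa]
  · rintro rfl
    have hinv := inv_ne_zero h0
    refine ⟨⟨whittakerEmbedding hψ hx₀ χ₁ χ₂, isWhittakerEmbedding_whittakerEmbedding hψ hx₀ χ₁ χ₂,
      (whittakerFunctional hψ hx₀ χ₁ χ₂ f₀)⁻¹ • f₀, ⟨smul_ne_zero hinv hf₀.1, hf₀.2.smul _⟩,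
      funext fun g => ?_⟩, ?_⟩
    · rw [whittakerEmbedding_apply, map_smul, map_smul, smul_eq_mul]
    · simp only [map_one, Module.End.one_apply]
      exact inv_mul_cancel₀ h0

theorem localInvariant_eq {f₀ : principalSeriesSpace χ₁ χ₂}
    (hf₀ : IsNewvector (principalSeries χ₁ χ₂) f₀)
    (huniq : ∀ f, IsNewvector (principalSeries χ₁ χ₂) f → ∃ a : ℂ, f = a • f₀)
    (h0 : whittakerFunctional hψ hx₀ χ₁ χ₂ f₀ ≠ 0) {M : ℝ}
    (hle : ∀ g, ‖whittakerFunctional hψ hx₀ χ₁ χ₂ (principalSeries χ₁ χ₂ g f₀)‖ ≤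
      ‖whittakerFunctional hψ hx₀ χ₁ χ₂ f₀‖ * M)
    (hex : ∃ g, ‖whittakerFunctional hψ hx₀ χ₁ χ₂ (principalSeries χ₁ χ₂ g f₀)‖ =
      ‖whittakerFunctional hψ hx₀ χ₁ χ₂ f₀‖ * M) :
    LocalInvariantWellDefined (principalSeries χ₁ χ₂) ψ ∧
      localInvariant (principalSeries χ₁ χ₂) ψ = M := by
  have hiff := isNormalizedNewvector_iff hψ hx₀ hf₀ huniq h0
  have hpos := norm_pos_iff.2 h0
  have hM : IsGreatest (newvectorValues (principalSeries χ₁ χ₂) ψ) M := by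
    constructor
    · obtain ⟨g, hg⟩ := hex
      refine ⟨_, (hiff _).2 rfl, g, ?_⟩
      rw [norm_mul, norm_inv, hg, inv_mul_cancel_left₀ hpos.ne']
    · rintro _ ⟨W, hW, g, rfl⟩
      rw [(hiff W).1 hW, norm_mul, norm_inv, inv_mul_le_iff₀ hpos]
      exact hle g
  have heq : localInvariant (principalSeries χ₁ χ₂) ψ = M := hM.csSup_eq
  exact ⟨⟨⟨_, (hiff _).2 rfl, fun W hW => (hiff W).1 hW⟩, by rwa [heq]⟩, heq⟩

end WellDefined

theorem exists_eq_smul_of_apply_one_ne_zero (h1 : charConductorExponent χ₁ = 0)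
    {f₀ : principalSeriesSpace χ₁ χ₂}
    (hf₀ : IsK1Fixed (principalSeries χ₁ χ₂) (charConductorExponent χ₂) f₀) (h : f₀.1 1 ≠ 0)
    {f : principalSeriesSpace χ₁ χ₂} (hf : IsNewvector (principalSeries χ₁ χ₂) f) :
    ∃ a : ℂ, f = a • f₀ := by
  have hf2 := hf.2
  rw [conductorExponent_principalSeries, h1, zero_add] at hf2
  exact ⟨f.1 1 / f₀.1 1, eq_of_apply_one_eq hf2 (hf₀.smul _) (div_mul_cancel₀ _ h).symm⟩

theorem exists_eq_smul_of_apply_weyl_ne_zero (h2 : charConductorExponent χ₂ = 0)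
    (h1 : 1 ≤ charConductorExponent χ₁) {f₀ : principalSeriesSpace χ₁ χ₂}
    (hf₀ : IsK1Fixed (principalSeries χ₁ χ₂) (charConductorExponent χ₁) f₀) (h : f₀.1 (weyl p) ≠ 0)
    {f : principalSeriesSpace χ₁ χ₂} (hf : IsNewvector (principalSeries χ₁ χ₂) f) :
    ∃ a : ℂ, f = a • f₀ := by
  have hf2 := hf.2
  rw [conductorExponent_principalSeries, h2, add_zero] at hf2
  exact ⟨f.1 (weyl p) / f₀.1 (weyl p),
    eq_of_apply_weyl_eq h1 hf2 (hf₀.smul _) (div_mul_cancel₀ _ h).symm⟩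

theorem rpow_half_mul (n : ℕ) :
    (p : ℝ) ^ ((1 / 2 : ℝ) * (n : ℝ)) = Real.sqrt ((p : ℝ) ^ n) := by
  rw [Real.sqrt_eq_rpow, ← Real.rpow_natCast, ← Real.rpow_mul prime_cast_pos.le, mul_comm]

variable {ψ : AddChar ℚ_[p] Circle}

theorem ne_zero_of_apply_ne_zero {f : principalSeriesSpace χ₁ χ₂} {g : G p} (h : f.1 g ≠ 0) :
    f ≠ 0 := by
  rintro rfl
  exact h rfl

theorem localInvariant_of_ramified_right (hψ : IsUnramifiedAdd ψ) (h1 : IsUnramified χ₁)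
    (h2 : 1 ≤ charConductorExponent χ₂) :
    LocalInvariantWellDefined (principalSeries χ₁ χ₂) ψ ∧
      localInvariant (principalSeries χ₁ χ₂) ψ =
        Real.sqrt ((p : ℝ) ^ (charConductorExponent χ₂ / 2)) := by
  obtain ⟨x₀, -, hx₀⟩ := hψ.2.2
  have h1' := isUnramified_iff.1 h1
  have h1inv : IsUnramified χ₁⁻¹ := isUnramified_iff.2 (by rw [charConductorExponent_inv, h1'])
  have hc : charConductorExponent (χ₂ * χ₁⁻¹) = charConductorExponent χ₂ :=
    charConductorExponent_mul_of_isUnramified h1inv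
  have hc1 : 1 ≤ charConductorExponent (χ₂ * χ₁⁻¹) := by rwa [hc]
  have hfix := isK1Fixed_atkinLehner_bigCellVec h1 h2
  have hne := bigCellVec_atkinLehner_ne_zero (χ₁ := χ₁) (χ₂ := χ₂) (charConductorExponent χ₂)
  have hnorm := norm_whittaker_atkinLehner hψ hx₀ hc1
  rw [hc] at hnorm
  refine localInvariant_eq hψ hx₀ ⟨ne_zero_of_apply_ne_zero hne, ?_⟩
    (fun f hf => exists_eq_smul_of_apply_one_ne_zero h1' hfix hne hf)
    (norm_ne_zero_iff.1 (by rw [hnorm]; exact one_ne_zero)) (fun g => ?_) ?_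
  · rwa [conductorExponent_principalSeries, h1', zero_add]
  · rw [hnorm, one_mul, ← Module.End.mul_apply, ← map_mul, ← hc]
    exact norm_whittaker_bigCellVec_le hψ hx₀ hc1 _
  · obtain ⟨g, hg⟩ := exists_norm_whittaker_bigCellVec_eq hψ hx₀ hc1
    -- The newvector is a translate of the big cell vector, so its maximum is attained at the point
    -- translated back.
    refine ⟨g * (atkinLehner p (charConductorExponent χ₂))⁻¹, ?_⟩
    rw [hnorm, one_mul, ← Module.End.mul_apply, ← map_mul, inv_mul_cancel_right, hg, hc]

theorem localInvariant_of_ramified_left (hψ : IsUnramifiedAdd ψ) (h2 : IsUnramified χ₂)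
    (h1 : 1 ≤ charConductorExponent χ₁) :
    LocalInvariantWellDefined (principalSeries χ₁ χ₂) ψ ∧
      localInvariant (principalSeries χ₁ χ₂) ψ =
        Real.sqrt ((p : ℝ) ^ (charConductorExponent χ₁ / 2)) := by
  obtain ⟨x₀, -, hx₀⟩ := hψ.2.2
  have h2' := isUnramified_iff.1 h2
  have hc : charConductorExponent (χ₂ * χ₁⁻¹) = charConductorExponent χ₁ := by
    rw [mul_comm, charConductorExponent_mul_of_isUnramified h2, charConductorExponent_inv]
  have hc1 : 1 ≤ charConductorExponent (χ₂ * χ₁⁻¹) := by rwa [hc]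
  have hfix := isK1Fixed_bigCellVec h2 h1
  have hne := bigCellVec_weyl_ne_zero (χ₁ := χ₁) (χ₂ := χ₂)
  have hnorm := norm_whittaker_bigCellVec_one hψ hx₀ (χ₁ := χ₁) (χ₂ := χ₂)
  refine localInvariant_eq hψ hx₀ ⟨ne_zero_of_apply_ne_zero hne, ?_⟩
    (fun f hf => exists_eq_smul_of_apply_weyl_ne_zero h2' h1 hfix hne hf)
    (norm_ne_zero_iff.1 (by rw [hnorm]; exact one_ne_zero)) (fun g => ?_) ?_
  · rwa [conductorExponent_principalSeries, h2', add_zero]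
  · rw [hnorm, one_mul, ← hc]
    exact norm_whittaker_bigCellVec_le hψ hx₀ hc1 _
  · rw [hnorm, one_mul, ← hc]
    exact exists_norm_whittaker_bigCellVec_eq hψ hx₀ hc1

theorem localInvariant_of_unramified (hψ : IsUnramifiedAdd ψ) (h1 : IsUnramified χ₁)
    (h2 : IsUnramified χ₂) (hp : 5 ≤ p) :
    LocalInvariantWellDefined (principalSeries χ₁ χ₂) ψ ∧
      localInvariant (principalSeries χ₁ χ₂) ψ = 1 := by
  obtain ⟨x₀, -, hx₀⟩ := hψ.2.2
  have h1' := isUnramified_iff.1 h1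
  have h2' := isUnramified_iff.1 h2
  have hfix := isK1Fixed_sphericalVec h1 h2
  have hne : (sphericalVec h1 h2).1 1 ≠ 0 := by
    change sphericalFun χ₁ χ₂ 1 ≠ 0
    rw [sphericalFun_one]
    exact one_ne_zero
  refine localInvariant_eq hψ hx₀ (f₀ := sphericalVec h1 h2) ⟨ne_zero_of_apply_ne_zero hne, ?_⟩
    (fun f hf => exists_eq_smul_of_apply_one_ne_zero h1' (by rwa [h2']) hne hf)
    (whittaker_sphericalVec_ne_zero hψ hx₀ h1 h2) (fun g => ?_) ⟨1, ?_⟩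
  · rwa [conductorExponent_principalSeries, h1', h2']
  · rw [mul_one]
    exact norm_whittaker_sphericalVec_le hψ hx₀ h1 h2 hp g
  · rw [map_one, Module.End.one_apply, mul_one]

theorem localInvariant_of_isUnramified_left (hψ : IsUnramifiedAdd ψ) (h1 : IsUnramified χ₁)
    (hc : 1 ≤ charConductorExponent χ₂ ∨ 5 ≤ p) :
    LocalInvariantWellDefined (principalSeries χ₁ χ₂) ψ ∧
      localInvariant (principalSeries χ₁ χ₂) ψ =
        Real.sqrt ((p : ℝ) ^ (charConductorExponent χ₂ / 2)) := by
  rcases Nat.eq_zero_or_pos (charConductorExponent χ₂) with h0 | h0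
  · have h := localInvariant_of_unramified hψ h1 (isUnramified_iff.2 h0) (by omega)
    simpa [h0] using h
  · exact localInvariant_of_ramified_right hψ h1 h0

end LocalWhittaker

/-! ### The value of the local invariant, and its consequence for twist-minimal principal series -/

theorem mainTheorem5 (p : ℕ) [Fact p.Prime] (ψ : AddChar ℚ_[p] Circle)
    (hψ : LocalWhittaker.IsUnramifiedAdd ψ) :
    (∀ (χ₁ χ₂ : LocalWhittaker.UnitaryChar p) (c : ℕ),
      LocalWhittaker.IsUnramified χ₁ → LocalWhittaker.charConductorExponent χ₂ = c →
      (1 ≤ c ∨ 5 ≤ p) →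
        LocalWhittaker.LocalInvariantWellDefined (LocalWhittaker.principalSeries χ₁ χ₂) ψ ∧
        LocalWhittaker.localInvariant (LocalWhittaker.principalSeries χ₁ χ₂) ψ =
          (p : ℝ) ^ ((1 / 2 : ℝ) * ((c / 2 : ℕ) : ℝ))) ∧
    (∀ (χ₁ χ₂ : LocalWhittaker.UnitaryChar p) (c : ℕ),
      LocalWhittaker.IsTwistMinimal (LocalWhittaker.principalSeries χ₁ χ₂) →
      LocalWhittaker.conductorExponent (LocalWhittaker.principalSeries χ₁ χ₂) = c →
      (1 ≤ c ∨ 5 ≤ p) →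
        LocalWhittaker.LocalInvariantWellDefined (LocalWhittaker.principalSeries χ₁ χ₂) ψ ∧
        LocalWhittaker.localInvariant (LocalWhittaker.principalSeries χ₁ χ₂) ψ =
          (p : ℝ) ^ ((1 / 2 : ℝ) * ((c / 2 : ℕ) : ℝ))) := by
  constructor
  · rintro χ₁ χ₂ c h1 rfl hc
    rw [LocalWhittaker.rpow_half_mul]
    exact LocalWhittaker.localInvariant_of_isUnramified_left hψ h1 hc
  · rintro χ₁ χ₂ c hmin rfl hc
    rw [LocalWhittaker.rpow_half_mul]
    rw [LocalWhittaker.conductorExponent_principalSeries] at hc ⊢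
    by_cases h1 : LocalWhittaker.IsUnramified χ₁
    · rw [LocalWhittaker.isUnramified_iff.1 h1, zero_add] at hc ⊢
      exact LocalWhittaker.localInvariant_of_isUnramified_left hψ h1 hc
    -- The case of ramified `χ₁` and unramified `χ₂` is treated directly with `bigCellVec`, without
    -- using the isomorphism of `χ₁ ⊞ χ₂` with `χ₂ ⊞ χ₁`.
    · have h2 := (LocalWhittaker.isUnramified_or_of_isTwistMinimal hmin).resolve_left h1
      rw [LocalWhittaker.isUnramified_iff.1 h2, add_zero]
      exact LocalWhittaker.localInvariant_of_ramified_left hψ h2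
        (Nat.one_le_iff_ne_zero.2 fun h => h1 (LocalWhittaker.isUnramified_iff.2 h))
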